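/- **Theorem.** Let $0<q<1$, $a\in\mathbb R$, $t=q^a-q^{-a}$, and write $[x]=\frac{q^x-q^{-x}}{q-q^{-1}}$, $\langle x\rangle=q^x+q^{-x}$. *The quantum groups.* Let $A=\mathcal O_q(SU(2))$ be the Hopf $*$-algebra generated by the entries of the unitary corepresentation matrix $U=\begin{pmatrix}\alpha&\beta\\ \gamma&\delta\end{pmatrix}$ with $U^*=\begin{pmatrix}\delta&-q^{-1}\beta\\-q\gamma&\alpha\end{pmatrix}$. Let $B=\mathcal O_q(S_t^2)\subseteq A$ be the Podleś sphere, the unital $*$-subalgebra generated by the entries of $$\begin{pmatrix} q^{-1}Z_t&Y_t\\X_t&-t-qZ_t\end{pmatrix}=U^*\begin{pmatrix}0&i\\-i&-t\end{pmatrix}U .$$ It is a right coideal. Put $B_+=B\cap\ker\varepsilon$, $C=A/AB_+$ with quotient map $\pi_C$, quotient coalgebra structure and $\pi_C(x)^\dagger=\pi_C(S(x)^*)$. Let $\mathcal I=\mathcal U_q(SO(2)_t)\subseteq C^*$ be the restricted dual of the cosemisimple coalgebra $C$ (functionals vanishing on all but finitely many simple subcoalgebras), with convolution product and $\omega^*(c)=\overline{\omega(c^\dagger)}$.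 Let $K,E,F$ be the functionals on $A$ given by $K(U)=\mathrm{diag}(q,q^{-1})$, $E(U)=\begin{pmatrix}0&q^{1/2}\\0&0\end{pmatrix}$, $F(U)=\begin{pmatrix}0&0\\q^{-1/2}&0\end{pmatrix}$ and by $\Delta(K)=K\otimes K$, $\Delta(E)=E\otimes1+K\otimes E$, $\Delta(F)=F\otimes K^{-1}+1\otimes F$; then $B_t=q^{-1/2}(E-FK)-i(q-q^{-1})^{-1}tK$ (convolution product $FK$) descends to a functional on $C$. For $c\in a+\mathbb Z$ let $p_{[c]}\in\mathcal I$ be the minimal projection on which $iB_t$ takes the value $[c]$. *Representations.* A unitary representation of $\mathcal U_q(SL(2,\mathbb R)_t)$, the Drinfeld double of $B$ and $\mathcal I$, is a pre-Hilbert space $V$ with a unital $*$-representation of $B$ and a unitary right $C$-coaction $\delta$ satisfying $\delta(bv)=\Delta(b)\delta(v)$; functionals on $C$ act by $\omega v=\omega(v_{(1)})v_{(0)}$. It is irreducible if $V\ne0$ and its completion has no non-trivial closed subspace invariant under $B$ and $\mathcal I$. The Casimir element is $\Omega_t=iq^{-1}X_t+(q-q^{-1})iZ_tB_t-iqY_t$.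 For real $\lambda$ let $\mathscr L_\lambda^{+}$ (resp. $\mathscr L_\lambda^-$) denote the irreducible unitary representation on which $\Omega_t=\lambda$ and for which the set of eigenvalues of $iB_t$ is $\{[a+2k]\mid k\in\mathbb Z\}$ (resp. $\{[a+2k+1]\mid k\in\mathbb Z\}$); these are defined for $$-\langle1-2s_+\rangle<\lambda<\langle1\rangle,\quad s_+=\lceil a\rceil-a,\qquad\text{resp.}\qquad -\langle1-2s_-\rangle<\lambda<\langle0\rangle=2,\quad s_-=\lceil a-\tfrac12\rceil-(a-\tfrac12).$$ *Induction.* Let $L^2_{q,0}(SO(2)_t)$ be $\mathcal I$ with the inner product $\langle y,z\rangle=\psi_t(y^*z)$, where $\psi_t(p_{[c]})=\langle c\rangle$, with left multiplication by $\mathcal I$ and with the $A$-action $\pi_g(x)\omega=g^{1/2}(x_{(1)})\,\omega(S^{-1}(x_{(2)})\,-)$, where $g=K^{-1}$ and $g^{1/2}$ is the character $U\mapsto\mathrm{diag}(q^{-1/2},q^{1/2})$. For a $*$-character $\chi$ of $B$, the induced representation $\mathrm{Ind}^{L^2_{q,0}(SO(2)_t)}(\chi)$ is $\mathbb C\otimes\mathcal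 I=\mathcal I$ with this inner product and left multiplication by $\mathcal I$, and with $b\cdot\omega=\chi(b_{(1)})\pi_g(b_{(2)})\omega$ for $b\in B$. *Claim.* Let $\theta\in\mathbb R$, $z=e^{-i\theta}$, and let $\chi_z$ be the $*$-character of $B$ with $\chi_z(Z_t)=0$, $\chi_z(X_t)=z$, $\chi_z(Y_t)=\overline z$. Assume that $\lambda=2\sin\theta$ lies in both ranges above (equivalently, $\sin\theta\neq1$, and $\sin\theta\ne-1$ if $2a\in\mathbb Z$). Then $\mathrm{Ind}^{L^2_{q,0}(SO(2)_t)}(\chi_z)$ is a well-defined unitary representation, the representations $\mathscr L^{\pm}_{2\sin\theta}$ exist, and there is a unitary equivalence of $\mathcal U_q(SL(2,\mathbb R)_t)$-representations (on the pre-Hilbert spaces, hence also on the completions) $$\mathrm{Ind}^{L^2_{q,0}(SO(2)_t)}(\chi_z)\;\cong\;\mathscr L^+_{2\sin\theta}\oplus\mathscr L^-_{2\sin\theta},$$ for every choice of $\mathscr L^\pm_{2\sin\theta}$ with the stated properties. -/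

import Mathlib

open scoped TensorProduct
open Coalgebra

noncomputable section

/-- The relations of quantum `SU(2)` between the entries `α = M 0 0`, `β = M 0 1`, `γ = M 1 0`,
`δ = M 1 1` of a `2 × 2`-matrix over a complex algebra. -/
structure SUqRels (q : ℝ) {R : Type*} [Ring R] [Algebra ℂ R] (M : Matrix (Fin 2) (Fin 2) R) :
    Prop where
  ab : M 0 0 * M 0 1 = (q : ℂ) • (M 0 1 * M 0 0)
  ac : M 0 0 * M 1 0 = (q : ℂ) • (M 1 0 * M 0 0)
  bc : M 0 1 * M 1 0 = M 1 0 * M 0 1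
  bd : M 0 1 * M 1 1 = (q : ℂ) • (M 1 1 * M 0 1)
  cd : M 1 0 * M 1 1 = (q : ℂ) • (M 1 1 * M 1 0)
  ad : M 0 0 * M 1 1 - (q : ℂ) • (M 0 1 * M 1 0) = 1
  da : M 1 1 * M 0 0 - (q : ℂ)⁻¹ • (M 1 0 * M 0 1) = 1

/-- The generator `U i j` of the free algebra on the entries of a `2 × 2`-matrix. -/
def freeU : Matrix (Fin 2) (Fin 2) (FreeAlgebra ℂ (Fin 2 × Fin 2)) :=
  fun i j => FreeAlgebra.ι ℂ (i, j)

/-- The defining relations of `O_q(SU(2))` on the free algebra. -/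
inductive SUqRel (q : ℝ) :
    FreeAlgebra ℂ (Fin 2 × Fin 2) → FreeAlgebra ℂ (Fin 2 × Fin 2) → Prop
  | ab : SUqRel q (freeU 0 0 * freeU 0 1) ((q : ℂ) • (freeU 0 1 * freeU 0 0))
  | ac : SUqRel q (freeU 0 0 * freeU 1 0) ((q : ℂ) • (freeU 1 0 * freeU 0 0))
  | bc : SUqRel q (freeU 0 1 * freeU 1 0) (freeU 1 0 * freeU 0 1)
  | bd : SUqRel q (freeU 0 1 * freeU 1 1) ((q : ℂ) • (freeU 1 1 * freeU 0 1))
  | cd : SUqRel q (freeU 1 0 * freeU 1 1) ((q : ℂ) • (freeU 1 1 * freeU 1 0))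
  | ad : SUqRel q (freeU 0 0 * freeU 1 1 - (q : ℂ) • (freeU 0 1 * freeU 1 0)) 1
  | da : SUqRel q (freeU 1 1 * freeU 0 0 - (q : ℂ)⁻¹ • (freeU 1 0 * freeU 0 1)) 1

/-- The algebra `O_q(SU(2))`. -/
def OqSU2 (q : ℝ) : Type := RingQuot (SUqRel q)

namespace OqSU2

instance (q : ℝ) : Ring (OqSU2 q) := inferInstanceAs (Ring (RingQuot (SUqRel q)))
instance (q : ℝ) : Algebra ℂ (OqSU2 q) := inferInstanceAs (Algebra ℂ (RingQuot (SUqRel q)))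

/-- The fundamental matrix `U = (α, β; γ, δ)`. -/
def U (q : ℝ) : Matrix (Fin 2) (Fin 2) (OqSU2 q) :=
  fun i j => RingQuot.mkAlgHom ℂ (SUqRel q) (freeU i j)

theorem U_rels (q : ℝ) : SUqRels q (U q) where
  ab := by
    have := RingQuot.mkAlgHom_rel ℂ (SUqRel.ab (q := q))
    rw [map_mul, map_smul, map_mul] at this; exact this
  ac := by
    have := RingQuot.mkAlgHom_rel ℂ (SUqRel.ac (q := q))
    rw [map_mul, map_smul, map_mul] at this; exact this
  bc := by
    have := RingQuot.mkAlgHom_rel ℂ (SUqRel.bc (q := q))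
    rw [map_mul, map_mul] at this; exact this
  bd := by
    have := RingQuot.mkAlgHom_rel ℂ (SUqRel.bd (q := q))
    rw [map_mul, map_smul, map_mul] at this; exact this
  cd := by
    have := RingQuot.mkAlgHom_rel ℂ (SUqRel.cd (q := q))
    rw [map_mul, map_smul, map_mul] at this; exact this
  ad := by
    have := RingQuot.mkAlgHom_rel ℂ (SUqRel.ad (q := q))
    rw [map_sub, map_mul, map_smul, map_mul, map_one] at this; exact this
  da := by
    have := RingQuot.mkAlgHom_rel ℂ (SUqRel.da (q := q))
    rw [map_sub, map_mul, map_smul, map_mul, map_one] at this; exact this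

/-- The universal property of `O_q(SU(2))`. -/
def lift {q : ℝ} {R : Type*} [Ring R] [Algebra ℂ R] (M : Matrix (Fin 2) (Fin 2) R)
    (h : SUqRels q M) : OqSU2 q →ₐ[ℂ] R :=
  RingQuot.liftAlgHom ℂ ⟨FreeAlgebra.lift ℂ (fun p : Fin 2 × Fin 2 => M p.1 p.2), by
    intro x y hxy
    cases hxy <;> simp only [freeU, map_mul, map_sub, map_smul, map_one, FreeAlgebra.lift_ι_apply]
    exacts [h.ab, h.ac, h.bc, h.bd, h.cd, h.ad, h.da]⟩

@[simp] theorem lift_U {q : ℝ} {R : Type*} [Ring R] [Algebra ℂ R] (M : Matrix (Fin 2) (Fin 2) R)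
    (h : SUqRels q M) (i j : Fin 2) : lift M h (U q i j) = M i j := by
  simp only [lift, U]
  exact (RingQuot.liftAlgHom_mkAlgHom_apply ℂ _ _ _).trans (by simp [freeU])

/-- Induction principle. -/
theorem induction {q : ℝ} {P : OqSU2 q → Prop} (hU : ∀ i j, P (U q i j))
    (hs : ∀ c : ℂ, P (algebraMap ℂ _ c)) (ha : ∀ x y, P x → P y → P (x + y))
    (hm : ∀ x y, P x → P y → P (x * y)) (x : OqSU2 q) : P x := by
  obtain ⟨y, rfl⟩ := RingQuot.mkAlgHom_surjective ℂ (SUqRel q) x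
  induction y using FreeAlgebra.induction with
  | grade0 r => rw [AlgHom.commutes]; exact hs r
  | grade1 p => exact hU p.1 p.2
  | mul a b iha ihb => rw [map_mul]; exact hm _ _ iha ihb
  | add a b iha ihb => rw [map_add]; exact ha _ _ iha ihb

theorem hom_ext {q : ℝ} {R : Type*} [Semiring R] [Algebra ℂ R] {f g : OqSU2 q →ₐ[ℂ] R}
    (h : ∀ i j, f (U q i j) = g (U q i j)) : f = g := by
  ext x
  induction x using OqSU2.induction with
  | hU i j => exact h i j
  | hs c => rw [AlgHom.commutes, AlgHom.commutes]
  | ha x y hx hy => rw [map_add, map_add, hx, hy]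
  | hm x y hx hy => rw [map_mul, map_mul, hx, hy]

/-- The inverse matrix of `M`, that is, the prescribed adjoint of the fundamental matrix. -/
def adjMat (q : ℝ) {R : Type*} [Ring R] [Algebra ℂ R] (M : Matrix (Fin 2) (Fin 2) R) :
    Matrix (Fin 2) (Fin 2) R :=
  !![M 1 1, -((q : ℂ)⁻¹ • M 0 1); -((q : ℂ) • M 1 0), M 0 0]

theorem _root_.SUqRels.iff_mul {q : ℝ} (hq : q ≠ 0) {R : Type*} [Ring R] [Algebra ℂ R]
    (M : Matrix (Fin 2) (Fin 2) R) :
    SUqRels q M ↔ (M * adjMat q M = 1 ∧ adjMat q M * M = 1) := by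
  have hq' : (q : ℂ) ≠ 0 := by exact_mod_cast hq
  constructor
  · intro h
    constructor
    · ext i j
      fin_cases i <;> fin_cases j <;>
        simp [Matrix.mul_apply, Fin.sum_univ_two, adjMat, -Complex.coe_smul]
      · rw [← sub_eq_add_neg]; exact h.ad
      · rw [h.ab, smul_smul, inv_mul_cancel₀ hq', one_smul]; simp
      · rw [h.cd]; simp
      · rw [add_comm, ← sub_eq_add_neg]; exact h.da
    · ext i j
      fin_cases i <;> fin_cases j <;>
        simp [Matrix.mul_apply, Fin.sum_univ_two, adjMat, -Complex.coe_smul]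
      · rw [← sub_eq_add_neg, h.bc]; exact h.da
      · rw [h.bd, smul_smul, inv_mul_cancel₀ hq', one_smul]; simp
      · rw [h.ac]; simp
      · rw [add_comm, ← sub_eq_add_neg, ← h.bc]; exact h.ad
  · rintro ⟨h1, h2⟩
    have e1 := fun i j => congrFun (congrFun h1 i) j
    have e2 := fun i j => congrFun (congrFun h2 i) j
    have a00 := e1 0 0
    have a01 := e1 0 1
    have a10 := e1 1 0
    have a11 := e1 1 1
    have b00 := e2 0 0
    have b01 := e2 0 1
    have b10 := e2 1 0
    have b11 := e2 1 1
    simp [Matrix.mul_apply, Fin.sum_univ_two, adjMat, -Complex.coe_smul] at a00 a01 a10 a11 b00 b01 b10 b11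
    refine ⟨?_, ?_, ?_, ?_, ?_, ?_, ?_⟩
    · rw [neg_add_eq_zero] at a01
      rw [← a01, smul_smul, mul_inv_cancel₀ hq', one_smul]
    · rw [neg_add_eq_zero] at b10
      exact b10.symm
    · have : (q : ℂ) • (M 0 1 * M 1 0) = (q : ℂ) • (M 1 0 * M 0 1) := by
        rw [← sub_eq_zero]
        have := a00.trans b11.symm
        rw [add_comm, add_right_cancel_iff, neg_inj] at this
        rw [this, sub_self]
      exact smul_right_injective R hq' this
    · have h := add_neg_eq_zero.1 b01
      rw [h, smul_smul, mul_inv_cancel₀ hq', one_smul]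
    · exact add_neg_eq_zero.1 a10
    · rw [sub_eq_add_neg]; exact a00
    · rw [sub_eq_add_neg, add_comm]; exact a11

end OqSU2

set_option linter.unusedSectionVars false
set_option linter.unusedSimpArgs false

theorem SUqRels.map {q : ℝ} {R S : Type*} [Ring R] [Algebra ℂ R] [Ring S] [Algebra ℂ S]
    {M : Matrix (Fin 2) (Fin 2) R} (h : SUqRels q M) (f : R →ₐ[ℂ] S) : SUqRels q (M.map f) where
  ab := by simpa only [Matrix.map_apply, map_mul, map_smul] using congrArg f h.ab
  ac := by simpa only [Matrix.map_apply, map_mul, map_smul] using congrArg f h.ac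
  bc := by simpa only [Matrix.map_apply, map_mul, map_smul] using congrArg f h.bc
  bd := by simpa only [Matrix.map_apply, map_mul, map_smul] using congrArg f h.bd
  cd := by simpa only [Matrix.map_apply, map_mul, map_smul] using congrArg f h.cd
  ad := by simpa only [Matrix.map_apply, map_mul, map_smul, map_sub, map_one] using congrArg f h.ad
  da := by simpa only [Matrix.map_apply, map_mul, map_smul, map_sub, map_one] using congrArg f h.da

theorem SUqRels.mul {q : ℝ} (hq : q ≠ 0) {R : Type*} [Ring R] [Algebra ℂ R]
    {M N : Matrix (Fin 2) (Fin 2) R} (hM : SUqRels q M) (hN : SUqRels q N)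
    (hc : ∀ i j k l, M i j * N k l = N k l * M i j) : SUqRels q (M * N) := by
  have hq' : (q : ℂ) ≠ 0 := by exact_mod_cast hq
  have key : OqSU2.adjMat q (M * N) = OqSU2.adjMat q N * OqSU2.adjMat q M := by
    ext i j
    fin_cases i <;> fin_cases j <;>
      simp [Matrix.mul_apply, Fin.sum_univ_two, OqSU2.adjMat, -Complex.coe_smul, hc, smul_smul, hq',
        add_comm]
  rw [SUqRels.iff_mul hq] at hM hN ⊢
  rw [key]
  constructor
  · rw [Matrix.mul_assoc, ← Matrix.mul_assoc N, hN.1, Matrix.one_mul, hM.1]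
  · rw [Matrix.mul_assoc, ← Matrix.mul_assoc _ M, hM.2, Matrix.one_mul, hN.2]

/-- The opposite algebra of `R` with complex conjugate scalar multiplication. -/
def ConjOp (R : Type*) : Type _ := Rᵐᵒᵖ

namespace ConjOp

variable {R : Type*} [Ring R] [Algebra ℂ R]

instance : Ring (ConjOp R) := inferInstanceAs (Ring Rᵐᵒᵖ)

/-- The canonical map to the conjugate opposite algebra. -/
def mk (x : R) : ConjOp R := MulOpposite.op x

/-- The canonical map from the conjugate opposite algebra. -/
def out (x : ConjOp R) : R := MulOpposite.unop x

instance : Algebra ℂ (ConjOp R) :=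
  RingHom.toAlgebra' ((algebraMap ℂ Rᵐᵒᵖ).comp (starRingEnd ℂ)) (fun c x => by
    exact Algebra.commutes (A := Rᵐᵒᵖ) (starRingEnd ℂ c) x)

theorem algebraMap_out (c : ℂ) :
    (algebraMap ℂ (ConjOp R) c).out = algebraMap ℂ R (starRingEnd ℂ c) := rfl

theorem mul_out (x y : ConjOp R) : (x * y).out = y.out * x.out := rfl
theorem add_out (x y : ConjOp R) : (x + y).out = x.out + y.out := rfl
theorem sub_out (x y : ConjOp R) : (x - y).out = x.out - y.out := rfl
theorem one_out : (1 : ConjOp R).out = 1 := rfl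
theorem mk_out (x : R) : (mk x).out = x := rfl
theorem smul_out (c : ℂ) (x : ConjOp R) : (c • x).out = starRingEnd ℂ c • x.out := by
  rw [Algebra.smul_def, mul_out, algebraMap_out, ← Algebra.commutes, Algebra.smul_def]
theorem out_inj {x y : ConjOp R} (h : x.out = y.out) : x = y := MulOpposite.unop_injective h

end ConjOp

namespace OqSU2

theorem counit_rels (q : ℝ) : SUqRels q (1 : Matrix (Fin 2) (Fin 2) ℂ) := by
  constructor <;> simp

variable (q : ℝ) [hq : Fact (q ∈ Set.Ioo (0 : ℝ) 1)]

/-- The comultiplication, `Δ(U i j) = ∑ k, U i k ⊗ U k j`. -/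
def comulHom : OqSU2 q →ₐ[ℂ] OqSU2 q ⊗[ℂ] OqSU2 q :=
  lift ((U q).map Algebra.TensorProduct.includeLeft * (U q).map Algebra.TensorProduct.includeRight)
    (SUqRels.mul hq.out.1.ne' ((U_rels q).map _) ((U_rels q).map _) (by simp))

/-- The counit, `ε(U) = 1`. -/
def counitHom : OqSU2 q →ₐ[ℂ] ℂ := lift 1 (counit_rels q)

theorem comulHom_U (i j : Fin 2) :
    comulHom q (U q i j) = U q i 0 ⊗ₜ U q 0 j + U q i 1 ⊗ₜ U q 1 j := by
  simp [comulHom, Matrix.mul_apply, Fin.sum_univ_two]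

instance : Bialgebra ℂ (OqSU2 q) :=
  Bialgebra.ofAlgHom (comulHom q) (counitHom q)
    (by
      apply hom_ext
      intro i j
      simp [comulHom_U, TensorProduct.add_tmul, TensorProduct.tmul_add]
      abel)
    (by
      apply hom_ext
      intro i j
      fin_cases i <;> simp [comulHom_U, counitHom])
    (by
      apply hom_ext
      intro i j
      fin_cases j <;> simp [comulHom_U, counitHom])

theorem comul_U (i j : Fin 2) :
    comul (R := ℂ) (U q i j) = U q i 0 ⊗ₜ U q 0 j + U q i 1 ⊗ₜ U q 1 j := comulHom_U q i j

theorem counit_U (i j : Fin 2) :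
    counit (R := ℂ) (U q i j) = (1 : Matrix (Fin 2) (Fin 2) ℂ) i j := by
  change counitHom q (U q i j) = _
  simp [counitHom]

theorem antipode_rels : SUqRels q ((adjMat q (U q)).map (MulOpposite.op)) := by
  have h := U_rels q
  have hq' : (q : ℂ) ≠ 0 := by exact_mod_cast hq.out.1.ne'
  constructor <;> apply MulOpposite.unop_injective <;>
    simp [adjMat, -Complex.coe_smul, smul_smul, hq', h.ab, h.ac, h.bc, h.bd, h.cd]
  · rw [← h.bc]; exact h.ad
  · exact h.da

/-- The inverse antipode as a matrix of values on the entries of `U`. -/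
def antipodeInvMat : Matrix (Fin 2) (Fin 2) (OqSU2 q) :=
  !![U q 1 1, -((q : ℂ) • U q 0 1); -((q : ℂ)⁻¹ • U q 1 0), U q 0 0]

theorem antipodeInv_rels : SUqRels q ((antipodeInvMat q).map (MulOpposite.op)) := by
  have h := U_rels q
  have hq' : (q : ℂ) ≠ 0 := by exact_mod_cast hq.out.1.ne'
  constructor <;> apply MulOpposite.unop_injective <;>
    simp [antipodeInvMat, -Complex.coe_smul, smul_smul, hq', h.ab, h.ac, h.bc, h.bd, h.cd]
  · rw [← h.bc]; exact h.ad
  · exact h.da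

/-- The antipode as a homomorphism to the opposite algebra, `S(U) = (δ, -q⁻¹β; -qγ, α)`. -/
def antipodeHom : OqSU2 q →ₐ[ℂ] (OqSU2 q)ᵐᵒᵖ := lift _ (antipode_rels q)

/-- The inverse antipode as a homomorphism to the opposite algebra,
`S⁻¹(U) = (δ, -qβ; -q⁻¹γ, α)`. -/
def antipodeInvHom : OqSU2 q →ₐ[ℂ] (OqSU2 q)ᵐᵒᵖ := lift _ (antipodeInv_rels q)

/-- The antipode as a linear map. -/
def antipodeLin : OqSU2 q →ₗ[ℂ] OqSU2 q :=
  (MulOpposite.opLinearEquiv ℂ).symm.toLinearMap ∘ₗ (antipodeHom q).toLinearMap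

/-- The inverse antipode as a linear map. -/
def antipodeInv : OqSU2 q →ₗ[ℂ] OqSU2 q :=
  (MulOpposite.opLinearEquiv ℂ).symm.toLinearMap ∘ₗ (antipodeInvHom q).toLinearMap

theorem antipodeLin_mul (x y : OqSU2 q) :
    antipodeLin q (x * y) = antipodeLin q y * antipodeLin q x := by simp [antipodeLin]

theorem antipodeInv_mul (x y : OqSU2 q) :
    antipodeInv q (x * y) = antipodeInv q y * antipodeInv q x := by simp [antipodeInv]

theorem antipodeLin_algebraMap (c : ℂ) :
    antipodeLin q (algebraMap ℂ _ c) = algebraMap ℂ _ c := by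
  simp only [antipodeLin, LinearMap.comp_apply, AlgHom.toLinearMap_apply, AlgHom.commutes]; rfl

theorem antipodeLin_one : antipodeLin q 1 = 1 := by
  simpa using antipodeLin_algebraMap q 1

theorem antipodeInv_algebraMap (c : ℂ) :
    antipodeInv q (algebraMap ℂ _ c) = algebraMap ℂ _ c := by
  simp only [antipodeInv, LinearMap.comp_apply, AlgHom.toLinearMap_apply, AlgHom.commutes]; rfl

theorem antipodeLin_U (i j : Fin 2) : antipodeLin q (U q i j) = adjMat q (U q) i j := by
  simp [antipodeLin, antipodeHom]

theorem antipodeInv_U (i j : Fin 2) : antipodeInv q (U q i j) = antipodeInvMat q i j := by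
  simp [antipodeInv, antipodeInvHom]

theorem antipodeInv_antipode (x : OqSU2 q) : antipodeInv q (antipodeLin q x) = x := by
  have hq' : (q : ℂ) ≠ 0 := by exact_mod_cast hq.out.1.ne'
  induction x using OqSU2.induction with
  | hU i j =>
    rw [antipodeLin_U]
    fin_cases i <;> fin_cases j <;>
      simp [adjMat, antipodeInv_U, antipodeInvMat, -Complex.coe_smul, smul_smul, hq']
  | hs c => rw [antipodeLin_algebraMap, antipodeInv_algebraMap]
  | ha x y hx hy => rw [map_add, map_add, hx, hy]
  | hm x y hx hy => rw [antipodeLin_mul, antipodeInv_mul, hx, hy]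

theorem antipode_antipodeInv (x : OqSU2 q) : antipodeLin q (antipodeInv q x) = x := by
  have hq' : (q : ℂ) ≠ 0 := by exact_mod_cast hq.out.1.ne'
  induction x using OqSU2.induction with
  | hU i j =>
    rw [antipodeInv_U]
    fin_cases i <;> fin_cases j <;>
      simp [adjMat, antipodeLin_U, antipodeInvMat, -Complex.coe_smul, smul_smul, hq']
  | hs c => rw [antipodeInv_algebraMap, antipodeLin_algebraMap]
  | ha x y hx hy => rw [map_add, map_add, hx, hy]
  | hm x y hx hy => rw [antipodeInv_mul, antipodeLin_mul, hx, hy]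

theorem antipode_left (x : OqSU2 q) :
    LinearMap.mul' ℂ _ ((antipodeLin q).rTensor _ (comul x)) = algebraMap ℂ _ (counit x) := by
  have key : ∀ (T Z : OqSU2 q ⊗[ℂ] OqSU2 q) (c : ℂ),
      LinearMap.mul' ℂ _ ((antipodeLin q).rTensor _ T) = algebraMap ℂ _ c →
      LinearMap.mul' ℂ _ ((antipodeLin q).rTensor _ (T * Z)) =
        c • LinearMap.mul' ℂ _ ((antipodeLin q).rTensor _ Z) := by
    intro T Z c hT
    induction Z with
    | zero => simp
    | add x y hx hy => rw [mul_add, map_add, map_add, hx, hy, map_add, map_add, smul_add]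
    | tmul x y =>
      have : ∀ T : OqSU2 q ⊗[ℂ] OqSU2 q,
          LinearMap.mul' ℂ _ ((antipodeLin q).rTensor _ (T * (x ⊗ₜ y))) =
          antipodeLin q x * LinearMap.mul' ℂ _ ((antipodeLin q).rTensor _ T) * y := by
        intro T
        induction T with
        | zero => simp
        | add u v hu hv => rw [add_mul, map_add, map_add, hu, hv, map_add, map_add, mul_add, add_mul]
        | tmul u v => simp [antipodeLin_mul, mul_assoc]
      rw [this, hT]
      simp only [LinearMap.rTensor_tmul, LinearMap.mul'_apply, Algebra.algebraMap_eq_smul_one]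
      simp
  induction x using OqSU2.induction with
  | hU i j =>
    have h2 := ((SUqRels.iff_mul hq.out.1.ne' _).1 (U_rels q)).2
    have := congrFun (congrFun h2 i) j
    rw [Matrix.mul_apply, Fin.sum_univ_two] at this
    rw [comul_U, counit_U]
    simp only [map_add, LinearMap.rTensor_tmul, LinearMap.mul'_apply, antipodeLin_U, this]
    fin_cases i <;> fin_cases j <;> simp
  | hs c =>
    rw [Bialgebra.comul_algebraMap, Bialgebra.counit_algebraMap,
      Algebra.TensorProduct.algebraMap_apply]
    simp [antipodeLin_algebraMap, antipodeLin_one]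
  | ha x y hx hy => simp only [map_add, hx, hy]
  | hm x y hx hy =>
    rw [Bialgebra.comul_mul, key _ _ _ hx, hy, Bialgebra.counit_mul, map_mul, Algebra.smul_def]

theorem antipode_right (x : OqSU2 q) :
    LinearMap.mul' ℂ _ ((antipodeLin q).lTensor _ (comul x)) = algebraMap ℂ _ (counit x) := by
  have key : ∀ (T Z : OqSU2 q ⊗[ℂ] OqSU2 q) (c : ℂ),
      LinearMap.mul' ℂ _ ((antipodeLin q).lTensor _ Z) = algebraMap ℂ _ c →
      LinearMap.mul' ℂ _ ((antipodeLin q).lTensor _ (T * Z)) =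
        c • LinearMap.mul' ℂ _ ((antipodeLin q).lTensor _ T) := by
    intro T Z c hZ
    induction T with
    | zero => simp
    | add x y hx hy => rw [add_mul, map_add, map_add, hx, hy, map_add, map_add, smul_add]
    | tmul x y =>
      have : ∀ T : OqSU2 q ⊗[ℂ] OqSU2 q,
          LinearMap.mul' ℂ _ ((antipodeLin q).lTensor _ ((x ⊗ₜ y) * T)) =
          x * LinearMap.mul' ℂ _ ((antipodeLin q).lTensor _ T) * antipodeLin q y := by
        intro T
        induction T with
        | zero => simp
        | add u v hu hv => rw [mul_add, map_add, map_add, hu, hv, map_add, map_add, mul_add, add_mul]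
        | tmul u v => simp [antipodeLin_mul, mul_assoc]
      rw [this, hZ]
      simp only [LinearMap.lTensor_tmul, LinearMap.mul'_apply, Algebra.algebraMap_eq_smul_one]
      simp
  induction x using OqSU2.induction with
  | hU i j =>
    have h2 := ((SUqRels.iff_mul hq.out.1.ne' _).1 (U_rels q)).1
    have := congrFun (congrFun h2 i) j
    rw [Matrix.mul_apply, Fin.sum_univ_two] at this
    rw [comul_U, counit_U]
    simp only [map_add, LinearMap.lTensor_tmul, LinearMap.mul'_apply, antipodeLin_U, this]
    fin_cases i <;> fin_cases j <;> simp
  | hs c =>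
    rw [Bialgebra.comul_algebraMap, Bialgebra.counit_algebraMap,
      Algebra.TensorProduct.algebraMap_apply]
    simp [antipodeLin_algebraMap, antipodeLin_one]
  | ha x y hx hy => simp only [map_add, hx, hy]
  | hm x y hx hy =>
    rw [Bialgebra.comul_mul, key _ _ _ hy, hx, Bialgebra.counit_mul, map_mul, Algebra.smul_def,
      ← Algebra.commutes]

instance : HopfAlgebra ℂ (OqSU2 q) where
  antipode := antipodeLin q
  mul_antipode_rTensor_comul := by
    ext x
    exact antipode_left q x
  mul_antipode_lTensor_comul := by
    ext x
    exact antipode_right q x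

theorem star_rels : SUqRels q (fun i j => ConjOp.mk (adjMat q (U q) j i)) := by
  have h := U_rels q
  have hq' : (q : ℂ) ≠ 0 := by exact_mod_cast hq.out.1.ne'
  constructor <;> apply ConjOp.out_inj <;>
    simp [adjMat, -Complex.coe_smul, smul_smul, hq', h.ab, h.ac, h.bc, h.bd, h.cd, ConjOp.mul_out,
      ConjOp.smul_out, ConjOp.mk_out, ConjOp.sub_out, ConjOp.one_out]
  · rw [← h.bc]; exact h.ad
  · exact h.da

/-- The involution as a homomorphism to the conjugate opposite algebra: `(U j i)* = S(U i j)`. -/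
def starHom : OqSU2 q →ₐ[ℂ] ConjOp (OqSU2 q) := lift _ (star_rels q)

instance : Star (OqSU2 q) := ⟨fun x => (starHom q x).out⟩

theorem star_def (x : OqSU2 q) : star x = (starHom q x).out := rfl

theorem star_U (i j : Fin 2) : star (U q i j) = adjMat q (U q) j i := by
  exact congrArg ConjOp.out (lift_U _ (star_rels q) i j)

theorem star_add' (x y : OqSU2 q) : star (x + y) = star x + star y := by
  rw [star_def, map_add]; rfl

theorem star_mul' (x y : OqSU2 q) : star (x * y) = star y * star x := by
  rw [star_def, map_mul]; rfl

theorem star_algebraMap' (c : ℂ) :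
    star (algebraMap ℂ (OqSU2 q) c) = algebraMap ℂ (OqSU2 q) (starRingEnd ℂ c) := by
  rw [star_def, AlgHom.commutes]; rfl

theorem star_smul' (c : ℂ) (x : OqSU2 q) : star (c • x) = starRingEnd ℂ c • star x := by
  rw [star_def, map_smul, ConjOp.smul_out]; rfl

theorem star_neg' (x : OqSU2 q) : star (-x) = -star x := by
  rw [star_def, map_neg]; rfl

instance : StarRing (OqSU2 q) where
  star_involutive x := by
    have hq' : (q : ℂ) ≠ 0 := by exact_mod_cast hq.out.1.ne'
    induction x using OqSU2.induction with
    | hU i j =>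
      rw [star_U]
      fin_cases i <;> fin_cases j <;>
        simp [adjMat, star_U, star_neg', star_smul', -Complex.coe_smul, smul_smul, hq']
    | hs c => simp [star_algebraMap']
    | ha x y hx hy => rw [star_add', star_add', hx, hy]
    | hm x y hx hy => rw [star_mul', star_mul', hx, hy]
  star_mul := star_mul' q
  star_add := star_add' q

instance : StarModule ℂ (OqSU2 q) := ⟨star_smul' q⟩

end OqSU2

/-- The `q`-number `[x] = (q ^ x - q ^ (-x)) / (q - q⁻¹)`. -/
def qNum (q x : ℝ) : ℝ := (q ^ x - q ^ (-x)) / (q - q⁻¹)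

/-- `q ^ x - q ^ (-x)`. -/
def qDiff (q x : ℝ) : ℝ := q ^ x - q ^ (-x)

/-- `q ^ x + q ^ (-x)`. -/
def qSum (q x : ℝ) : ℝ := q ^ x + q ^ (-x)

open OqSU2

section Podles

variable (q : ℝ) [hq : Fact (q ∈ Set.Ioo (0 : ℝ) 1)] (a : ℝ)

/-- The matrix `L_t = (0, i; -i, -t)` for `t = q ^ a - q ^ (-a)`. -/
def podlesL : Matrix (Fin 2) (Fin 2) ℂ :=
  !![0, Complex.I; -Complex.I, -(qDiff q a : ℂ)]

/-- The matrix `E_t = U* L_t U`. -/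
def podlesE : Matrix (Fin 2) (Fin 2) (OqSU2 q) :=
  (U q).conjTranspose * (podlesL q a).map (algebraMap ℂ (OqSU2 q)) * U q

/-- The Podleś sphere `O_q(S_t²)` for `t = q ^ a - q ^ (-a)`, the unital `*`-subalgebra generated
by the entries of `E_t`. -/
def Podles : StarSubalgebra ℂ (OqSU2 q) :=
  StarAlgebra.adjoin ℂ {x | ∃ i j, x = podlesE q a i j}

theorem podlesE_mem (i j : Fin 2) : podlesE q a i j ∈ Podles q a :=
  StarAlgebra.subset_adjoin ℂ _ ⟨i, j, rfl⟩

/-- The generator `Z_t`, from `E_t 0 0 = q⁻¹ Z_t`. -/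
def podlesZ : Podles q a := (q : ℂ) • ⟨podlesE q a 0 0, podlesE_mem q a 0 0⟩

/-- The generator `X_t = E_t 1 0`. -/
def podlesX : Podles q a := ⟨podlesE q a 1 0, podlesE_mem q a 1 0⟩

/-- The generator `Y_t = E_t 0 1`. -/
def podlesY : Podles q a := ⟨podlesE q a 0 1, podlesE_mem q a 0 1⟩

theorem conjTranspose_U : (U q).conjTranspose = adjMat q (U q) := by
  ext i j; exact star_U q j i

theorem star_podlesE (i j : Fin 2) : star (podlesE q a i j) = podlesE q a j i := by
  have h : (podlesE q a).conjTranspose = podlesE q a := by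
    have hL : ((podlesL q a).map (algebraMap ℂ (OqSU2 q))).conjTranspose =
        (podlesL q a).map (algebraMap ℂ (OqSU2 q)) := by
      ext i j
      fin_cases i <;> fin_cases j <;>
        simp [podlesL, Matrix.conjTranspose_apply, star_algebraMap']
    rw [podlesE, Matrix.conjTranspose_mul, Matrix.conjTranspose_mul, hL,
      Matrix.conjTranspose_conjTranspose, Matrix.mul_assoc]
  exact congrFun (congrFun h j) i

theorem Podles.induction {P : OqSU2 q → Prop} (hE : ∀ i j, P (podlesE q a i j))
    (hs : ∀ c : ℂ, P (algebraMap ℂ _ c)) (ha : ∀ x y, P x → P y → P (x + y))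
    (hm : ∀ x y, P x → P y → P (x * y)) (x : OqSU2 q) (hx : x ∈ Podles q a) : P x := by
  have hx' : x ∈ Algebra.adjoin ℂ ({x | ∃ i j, x = podlesE q a i j} ∪
      star {x | ∃ i j, x = podlesE q a i j}) := hx
  induction hx' using Algebra.adjoin_induction with
  | mem y hy =>
    rcases hy with ⟨i, j, rfl⟩ | hy
    · exact hE i j
    · obtain ⟨i, j, h⟩ := hy
      rw [star_eq_iff_star_eq, star_podlesE] at h
      rw [← h]; exact hE j i
  | algebraMap c => exact hs c
  | add y z hy hz ihy ihz => exact ha _ _ (ihy hy) (ihz hz)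
  | mul y z hy hz ihy ihz => exact hm _ _ (ihy hy) (ihz hz)

theorem podlesE_eq (i j : Fin 2) :
    podlesE q a i j =
      podlesL q a 0 0 • (adjMat q (U q) i 0 * U q 0 j) +
      podlesL q a 0 1 • (adjMat q (U q) i 0 * U q 1 j) +
      podlesL q a 1 0 • (adjMat q (U q) i 1 * U q 0 j) +
      podlesL q a 1 1 • (adjMat q (U q) i 1 * U q 1 j) := by
  simp only [podlesE, conjTranspose_U, Matrix.mul_apply, Fin.sum_univ_two, Matrix.map_apply,
    add_mul, ← Algebra.commutes, ← Algebra.smul_def, smul_mul_assoc]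
  abel

theorem counit_podlesE (m n : Fin 2) :
    counit (R := ℂ) (podlesE q a m n) = podlesL q a m n := by
  have hc : ∀ i j, counit (R := ℂ) (adjMat q (U q) i j) =
      (1 : Matrix (Fin 2) (Fin 2) ℂ) i j := by
    intro i j
    fin_cases i <;> fin_cases j <;> simp [adjMat, counit_U, -Complex.coe_smul]
  rw [podlesE_eq]
  simp only [map_add, map_smul, Bialgebra.counit_mul, hc, counit_U]
  fin_cases m <;> fin_cases n <;> simp [Matrix.one_apply]

theorem comul_podlesE (i j : Fin 2) :
    comul (R := ℂ) (podlesE q a i j) = ∑ m, ∑ n,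
      podlesE q a m n ⊗ₜ[ℂ] (adjMat q (U q) i m * U q n j) := by
  have h1 : ∀ i j, comul (R := ℂ) (adjMat q (U q) i j) =
      ∑ m, adjMat q (U q) m j ⊗ₜ[ℂ] adjMat q (U q) i m := by
    have hq' : (q : ℂ) ≠ 0 := by exact_mod_cast hq.out.1.ne'
    intro i j
    fin_cases i <;> fin_cases j <;>
      simp [adjMat, comul_U, -Complex.coe_smul, Fin.sum_univ_two, TensorProduct.tmul_neg,
        TensorProduct.neg_tmul, TensorProduct.tmul_smul, TensorProduct.smul_tmul', smul_smul, hq',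
        add_comm]
  simp only [podlesE_eq, Fin.sum_univ_two, map_add, map_smul,
    Bialgebra.comul_mul, h1, comul_U, add_mul, smul_add,
    mul_add, Algebra.TensorProduct.tmul_mul_tmul, TensorProduct.add_tmul,
    TensorProduct.smul_tmul']
  abel

/-- The inclusion of `O_q(S_t²) ⊗ O_q(SU(2))` in `O_q(SU(2)) ⊗ O_q(SU(2))`. -/
def podlesIncl : Podles q a ⊗[ℂ] OqSU2 q →ₐ[ℂ] OqSU2 q ⊗[ℂ] OqSU2 q :=
  Algebra.TensorProduct.map (Podles q a).toSubalgebra.val (AlgHom.id ℂ (OqSU2 q))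

theorem podlesIncl_injective : Function.Injective (podlesIncl q a) :=
  Module.Flat.rTensor_preserves_injective_linearMap (M := OqSU2 q)
    (Podles q a).toSubalgebra.val.toLinearMap Subtype.val_injective

theorem comul_mem_range (b : Podles q a) :
    Bialgebra.comulAlgHom ℂ (OqSU2 q) b ∈ (podlesIncl q a).range := by
  refine Podles.induction q a
    (P := fun x => Bialgebra.comulAlgHom ℂ (OqSU2 q) x ∈ (podlesIncl q a).range)
    ?_ ?_ ?_ ?_ b b.2
  · intro i j
    rw [Bialgebra.comulAlgHom_apply, comul_podlesE]
    refine Subalgebra.sum_mem _ fun m _ => Subalgebra.sum_mem _ fun n _ => ?_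
    exact ⟨(⟨podlesE q a m n, podlesE_mem q a m n⟩ : Podles q a) ⊗ₜ _, rfl⟩
  · intro c; rw [AlgHom.commutes]; exact Subalgebra.algebraMap_mem _ c
  · intro x y hx hy; rw [map_add]; exact add_mem hx hy
  · intro x y hx hy; rw [map_mul]; exact mul_mem hx hy

/-- The coaction of `O_q(SU(2))` on the Podleś sphere by restriction of the comultiplication. -/
def podlesCoact : Podles q a →ₐ[ℂ] Podles q a ⊗[ℂ] OqSU2 q :=
  (AlgEquiv.ofInjective (podlesIncl q a) (podlesIncl_injective q a)).symm.toAlgHom.comp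
    (((Bialgebra.comulAlgHom ℂ (OqSU2 q)).comp (Podles q a).toSubalgebra.val).codRestrict
      (podlesIncl q a).range (comul_mem_range q a))

theorem podlesIncl_podlesCoact (b : Podles q a) :
    podlesIncl q a (podlesCoact q a b) = comul (R := ℂ) (b : OqSU2 q) := by
  have := congrArg Subtype.val
    ((AlgEquiv.ofInjective (podlesIncl q a) (podlesIncl_injective q a)).apply_symm_apply
    ((((Bialgebra.comulAlgHom ℂ (OqSU2 q)).comp (Podles q a).toSubalgebra.val).codRestrict
      (podlesIncl q a).range (comul_mem_range q a)) b))
  exact this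

/-- The left ideal `A B₊` of `A = O_q(SU(2))` for `B = O_q(S_t²)` and `B₊ = B ∩ ker ε`. -/
def idealABplus : Submodule ℂ (OqSU2 q) :=
  Submodule.span ℂ {x | ∃ c : OqSU2 q, ∃ b ∈ Podles q a, counit (R := ℂ) b = 0 ∧ x = c * b}

theorem mul_sub_mem (c b : OqSU2 q) (hb : b ∈ Podles q a) :
    c * b - counit (R := ℂ) b • c ∈ idealABplus q a := by
  refine Submodule.subset_span ⟨c, b - algebraMap ℂ _ (counit b), ?_, ?_, ?_⟩
  · exact sub_mem hb (algebraMap_mem (Podles q a) _)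
  · simp
  · rw [mul_sub, Algebra.smul_def, Algebra.commutes]

theorem mkQ_mul (c b : OqSU2 q) (hb : b ∈ Podles q a) :
    (idealABplus q a).mkQ (c * b) = counit (R := ℂ) b • (idealABplus q a).mkQ c := by
  rw [← map_smul, ← sub_eq_zero, ← map_sub, Submodule.mkQ_apply, Submodule.Quotient.mk_eq_zero]
  exact mul_sub_mem q a c b hb

theorem map_mkQ_mul_comul (b : OqSU2 q) (hb : b ∈ Podles q a) (T : OqSU2 q ⊗[ℂ] OqSU2 q) :
    TensorProduct.map (idealABplus q a).mkQ (idealABplus q a).mkQ (T * comul b) =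
      counit (R := ℂ) b •
        TensorProduct.map (idealABplus q a).mkQ (idealABplus q a).mkQ T := by
  revert T
  refine Podles.induction q a (P := fun b => ∀ T : OqSU2 q ⊗[ℂ] OqSU2 q,
    TensorProduct.map (idealABplus q a).mkQ (idealABplus q a).mkQ (T * comul b) =
      counit (R := ℂ) b •
        TensorProduct.map (idealABplus q a).mkQ (idealABplus q a).mkQ T) ?_ ?_ ?_ ?_ b hb
  · intro i j T
    induction T with
    | zero => simp
    | add x y hx hy => rw [add_mul, map_add, hx, hy, map_add, smul_add]
    | tmul x y =>
      rw [comul_podlesE]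
      have : ∀ m n, TensorProduct.map (idealABplus q a).mkQ (idealABplus q a).mkQ
          ((x ⊗ₜ[ℂ] y) * podlesE q a m n ⊗ₜ[ℂ] (adjMat q (U q) i m * U q n j)) =
          (idealABplus q a).mkQ x ⊗ₜ[ℂ] (idealABplus q a).mkQ
            (y * (adjMat q (U q) i m * algebraMap ℂ _ (podlesL q a m n) * U q n j)) := by
        intro m n
        rw [Algebra.TensorProduct.tmul_mul_tmul, TensorProduct.map_tmul,
          mkQ_mul q a _ _ (podlesE_mem q a m n), counit_podlesE, TensorProduct.smul_tmul, ← map_smul]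
        congr 2
        rw [← Algebra.commutes, ← Algebra.smul_def, smul_mul_assoc, mul_smul_comm]
      rw [Finset.mul_sum, map_sum]
      simp only [Finset.mul_sum, map_sum, this]
      rw [TensorProduct.map_tmul, TensorProduct.smul_tmul', TensorProduct.smul_tmul,
        ← mkQ_mul q a _ _ (podlesE_mem q a i j)]
      simp only [← TensorProduct.tmul_sum, ← map_sum, ← Finset.mul_sum]
      congr 3
      simp [podlesE, conjTranspose_U, Matrix.mul_apply, Fin.sum_univ_two, add_mul]
      abel
  · intro c T
    rw [Bialgebra.comul_algebraMap, Bialgebra.counit_algebraMap, ← Algebra.commutes,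
      ← Algebra.smul_def, map_smul]
  · intro x y hx hy T
    simp only [map_add, mul_add, hx, hy, add_smul]
  · intro x y hx hy T
    rw [Bialgebra.comul_mul, ← mul_assoc, hy, hx, Bialgebra.counit_mul, smul_smul, mul_comm]

instance : (idealABplus q a).IsCoideal where
  counit_eq_zero := by
    intro x hx
    refine (Submodule.span_le (p := LinearMap.ker (counit (R := ℂ) (A := OqSU2 q)))).2 ?_ hx
    rintro _ ⟨c, b, -, h0, rfl⟩
    simp [h0]
  map_mkQ_comul_eq_zero := by
    intro x hx
    refine (Submodule.span_le (p := LinearMap.ker ((TensorProduct.map (idealABplus q a).mkQ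
      (idealABplus q a).mkQ) ∘ₗ (comul (R := ℂ) (A := OqSU2 q))))).2 ?_ hx
    rintro _ ⟨c, b, hb, h0, rfl⟩
    change TensorProduct.map _ _ (comul (c * b)) = 0
    rw [Bialgebra.comul_mul, map_mkQ_mul_comul q a b hb, h0, zero_smul]

/-- The quotient coalgebra `C = O_q(SO(2)_t) = A / A B₊`. -/
abbrev OqSO2 : Type := OqSU2 q ⧸ idealABplus q a

/-- The quotient map `A → C`. -/
abbrev projC : OqSU2 q →ₗ[ℂ] OqSO2 q a := (idealABplus q a).mkQ

/-- The left `A`-module structure on `C`, as a map `A → End C`. -/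
def actC : OqSU2 q →ₗ[ℂ] OqSO2 q a →ₗ[ℂ] OqSO2 q a where
  toFun x := (idealABplus q a).mapQ (idealABplus q a) (LinearMap.mulLeft ℂ x) (by
    refine Submodule.span_le.2 ?_
    rintro _ ⟨c, b, hb, h0, rfl⟩
    exact Submodule.subset_span ⟨x * c, b, hb, h0, by simp [mul_assoc]⟩)
  map_add' x y := by
    refine Submodule.linearMap_qext _ (LinearMap.ext fun z => ?_)
    exact congrArg (idealABplus q a).mkQ (add_mul x y z)
  map_smul' c x := by
    refine Submodule.linearMap_qext _ (LinearMap.ext fun z => ?_)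
    exact congrArg (idealABplus q a).mkQ (smul_mul_assoc c x z)

theorem actC_projC (x y : OqSU2 q) : actC q a x (projC q a y) = projC q a (x * y) := rfl

/-- The involution `x† = S(x)*` of `A`. -/
def dagA : OqSU2 q →ₛₗ[starRingEnd ℂ] OqSU2 q where
  toFun x := star (HopfAlgebra.antipode ℂ x)
  map_add' x y := by simp
  map_smul' c x := by simp [star_smul']

theorem dagA_mul (x y : OqSU2 q) : dagA q (x * y) = dagA q x * dagA q y := by
  change star (antipodeLin q (x * y)) = star (antipodeLin q x) * star (antipodeLin q y)
  rw [antipodeLin_mul, star_mul]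

theorem dagA_algebraMap (c : ℂ) :
    dagA q (algebraMap ℂ _ c) = algebraMap ℂ _ (starRingEnd ℂ c) := by
  change star (antipodeLin q (algebraMap ℂ _ c)) = _
  rw [antipodeLin_algebraMap, star_algebraMap']

theorem dagA_U (i j : Fin 2) : dagA q (U q i j) = U q j i := by
  change star (antipodeLin q (U q i j)) = _
  rw [antipodeLin_U, ← star_U, star_star]

theorem mkQ_mul_UL (c : OqSU2 q) (j k : Fin 2) :
    projC q a (c * (podlesL q a 0 k • U q j 0 + podlesL q a 1 k • U q j 1)) =
      projC q a (c * (podlesL q a j 0 • U q 0 k + podlesL q a j 1 • U q 1 k)) := by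
  have hUV := ((SUqRels.iff_mul hq.out.1.ne' _).1 (U_rels q)).1
  have hUE : U q * podlesE q a = (podlesL q a).map (algebraMap ℂ (OqSU2 q)) * U q := by
    rw [podlesE, conjTranspose_U, ← Matrix.mul_assoc, ← Matrix.mul_assoc, hUV, Matrix.one_mul]
  have h := congrFun (congrFun hUE j) k
  simp only [Matrix.mul_apply, Fin.sum_univ_two, Matrix.map_apply, ← Algebra.smul_def] at h
  rw [← h, mul_add, mul_add, ← mul_assoc, ← mul_assoc, map_add, map_add,
    mkQ_mul q a _ _ (podlesE_mem q a 0 k), mkQ_mul q a _ _ (podlesE_mem q a 1 k),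
    counit_podlesE, counit_podlesE, mul_smul_comm, mul_smul_comm, map_smul, map_smul]

theorem mkQ_mul_dagA (b : OqSU2 q) (hb : b ∈ Podles q a) (c : OqSU2 q) :
    projC q a (c * dagA q b) = starRingEnd ℂ (counit (R := ℂ) b) • projC q a c := by
  revert c
  refine Podles.induction q a (P := fun b => ∀ c : OqSU2 q,
    projC q a (c * dagA q b) = starRingEnd ℂ (counit (R := ℂ) b) • projC q a c) ?_ ?_ ?_ ?_ b hb
  · intro i j c
    have hr := U_rels q
    have hL : ∀ k l, starRingEnd ℂ (podlesL q a k l) = podlesL q a l k := by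
      intro k l
      fin_cases k <;> fin_cases l <;> simp [podlesL]
    have hV : ∀ k m, dagA q (adjMat q (U q) k 0) * U q m 0 + dagA q (adjMat q (U q) k 1) * U q m 1
        = (1 : Matrix (Fin 2) (Fin 2) (OqSU2 q)) k m := by
      intro k m
      fin_cases k <;> fin_cases m <;>
        simp [adjMat, dagA_U, -Complex.coe_smul, Matrix.one_apply]
      · rw [← sub_eq_add_neg]; exact hr.da
      · rw [hr.cd, smul_smul, inv_mul_cancel₀ (by exact_mod_cast hq.out.1.ne'), one_smul]; simp
      · rw [hr.ab]; simp
      · rw [add_comm, ← sub_eq_add_neg]; exact hr.ad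
    have e1 : c * dagA q (podlesE q a i j) =
        (c * dagA q (adjMat q (U q) i 0)) *
          (podlesL q a 0 0 • U q j 0 + podlesL q a 1 0 • U q j 1) +
        (c * dagA q (adjMat q (U q) i 1)) *
          (podlesL q a 0 1 • U q j 0 + podlesL q a 1 1 • U q j 1) := by
      simp only [podlesE_eq, map_add, map_smulₛₗ, dagA_mul, dagA_U, hL, mul_add, mul_smul_comm,
        mul_assoc]
      abel
    have e2 : (c * dagA q (adjMat q (U q) i 0)) *
          (podlesL q a j 0 • U q 0 0 + podlesL q a j 1 • U q 1 0) +
        (c * dagA q (adjMat q (U q) i 1)) *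
          (podlesL q a j 0 • U q 0 1 + podlesL q a j 1 • U q 1 1) =
        podlesL q a j i • c := by
      have : (c * dagA q (adjMat q (U q) i 0)) *
          (podlesL q a j 0 • U q 0 0 + podlesL q a j 1 • U q 1 0) +
        (c * dagA q (adjMat q (U q) i 1)) *
          (podlesL q a j 0 • U q 0 1 + podlesL q a j 1 • U q 1 1) =
          podlesL q a j 0 • (c * (dagA q (adjMat q (U q) i 0) * U q 0 0 +
            dagA q (adjMat q (U q) i 1) * U q 0 1)) +
          podlesL q a j 1 • (c * (dagA q (adjMat q (U q) i 0) * U q 1 0 +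
            dagA q (adjMat q (U q) i 1) * U q 1 1)) := by
        simp only [mul_add, mul_smul_comm, mul_assoc, smul_add]
        abel
      rw [this, hV, hV]
      fin_cases i <;> simp [Matrix.one_apply]
    rw [e1, map_add, mkQ_mul_UL, mkQ_mul_UL, ← map_add, e2, counit_podlesE, hL, map_smul]
  · intro z c
    rw [dagA_algebraMap, Bialgebra.counit_algebraMap, ← Algebra.commutes, ← Algebra.smul_def,
      map_smul]
  · intro x y hx hy c
    simp only [map_add, mul_add, hx, hy, add_smul]
  · intro x y hx hy c
    rw [dagA_mul, ← mul_assoc, hy, hx, Bialgebra.counit_mul, map_mul, smul_smul, mul_comm]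

/-- The involution `†` of the coalgebra `C`, induced by `x† = S(x)*` on `A`. -/
def dagC : OqSO2 q a →ₛₗ[starRingEnd ℂ] OqSO2 q a :=
  (idealABplus q a).mapQ (idealABplus q a) (dagA q) (by
    refine Submodule.span_le.2 ?_
    rintro _ ⟨c, b, hb, h0, rfl⟩
    change dagA q (c * b) ∈ idealABplus q a
    rw [← Submodule.Quotient.mk_eq_zero, ← Submodule.mkQ_apply, dagA_mul, mkQ_mul_dagA q a b hb,
      h0, map_zero, zero_smul])

theorem dagC_projC (x : OqSU2 q) : dagC q a (projC q a x) = projC q a (dagA q x) := rfl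

end Podles

/-- The convolution product of functionals on a coalgebra. -/
def convMul {C : Type*} [AddCommGroup C] [Module ℂ C] [Coalgebra ℂ C] (ω χ : C →ₗ[ℂ] ℂ) :
    C →ₗ[ℂ] ℂ :=
  LinearMap.mul' ℂ ℂ ∘ₗ TensorProduct.map ω χ ∘ₗ comul

section Functionals

variable (q : ℝ) [hq : Fact (q ∈ Set.Ioo (0 : ℝ) 1)] (a : ℝ)

/-- The character `U ↦ (s, 0; 0, s⁻¹)` of `O_q(SU(2))`, for nonzero `s`. -/
def torusChar (s : ℂˣ) : OqSU2 q →ₐ[ℂ] ℂ :=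
  lift !![(s : ℂ), 0; 0, ((s⁻¹ : ℂˣ) : ℂ)] (by constructor <;> simp)

theorem torusChar_U (s : ℂˣ) (i j : Fin 2) :
    torusChar q s (U q i j) = !![(s : ℂ), 0; 0, ((s⁻¹ : ℂˣ) : ℂ)] i j := by
  rw [torusChar, lift_U]

/-- The positive number `q ^ x` as a unit of `ℂ`. -/
def qUnit (x : ℝ) : ℂˣ :=
  Units.mk0 ((q ^ x : ℝ) : ℂ) (by
    exact_mod_cast (Real.rpow_pos_of_pos hq.out.1 x).ne')

/-- `K` as a functional, `τ(U, K) = (q, 0; 0, q⁻¹)`. -/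
def pairK : OqSU2 q →ₐ[ℂ] ℂ := torusChar q (qUnit q 1)

/-- `K⁻¹` as a functional, `τ(U, K⁻¹) = (q⁻¹, 0; 0, q)`. -/
def pairKinv : OqSU2 q →ₐ[ℂ] ℂ := torusChar q (qUnit q (-1))

/-- The positive square root of `g = K⁻¹` as a functional. -/
def pairGHalf : OqSU2 q →ₐ[ℂ] ℂ := torusChar q (qUnit q (-(1 / 2)))

/-- The homomorphism `x ↦ (K(x), E(x); 0, ε(x))` that encodes `Δ(E) = E ⊗ 1 + K ⊗ E`. -/
def matE : OqSU2 q →ₐ[ℂ] Matrix (Fin 2) (Fin 2) ℂ :=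
  lift (fun i j => !![pairK q (U q i j), !![0, ((q ^ (1 / 2 : ℝ) : ℝ) : ℂ); 0, 0] i j;
      0, counit (U q i j)]) (by
    have hq' : (q : ℂ) ≠ 0 := by exact_mod_cast hq.out.1.ne'
    constructor <;> ext i j <;> fin_cases i <;> fin_cases j <;>
      simp [pairK, torusChar_U, counit_U, qUnit, -Complex.coe_smul, hq', mul_comm])

theorem matE_U (i j : Fin 2) : matE q (U q i j) =
    !![pairK q (U q i j), !![0, ((q ^ (1 / 2 : ℝ) : ℝ) : ℂ); 0, 0] i j; 0, counit (U q i j)] :=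
  lift_U _ _ i j

/-- `E` as a functional, `τ(U, E) = (0, q ^ (1/2); 0, 0)`. -/
def pairE : OqSU2 q →ₗ[ℂ] ℂ := Matrix.entryLinearMap ℂ ℂ 0 1 ∘ₗ (matE q).toLinearMap

/-- The homomorphism `x ↦ (ε(x), F(x); 0, K⁻¹(x))` that encodes `Δ(F) = F ⊗ K⁻¹ + 1 ⊗ F`. -/
def matF : OqSU2 q →ₐ[ℂ] Matrix (Fin 2) (Fin 2) ℂ :=
  lift (fun i j => !![counit (U q i j), !![0, 0; ((q ^ (-(1 / 2) : ℝ) : ℝ) : ℂ), 0] i j;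
      0, pairKinv q (U q i j)]) (by
    have hq' : (q : ℂ) ≠ 0 := by exact_mod_cast hq.out.1.ne'
    constructor <;> ext i j <;> fin_cases i <;> fin_cases j <;>
      simp [pairKinv, torusChar_U, counit_U, qUnit, -Complex.coe_smul, hq', mul_comm,
        Real.rpow_neg_one])

theorem matF_U (i j : Fin 2) : matF q (U q i j) =
    !![counit (U q i j), !![0, 0; ((q ^ (-(1 / 2) : ℝ) : ℝ) : ℂ), 0] i j;
      0, pairKinv q (U q i j)] :=
  lift_U _ _ i j

/-- `F` as a functional, `τ(U, F) = (0, 0; q ^ (-1/2), 0)`. -/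
def pairF : OqSU2 q →ₗ[ℂ] ℂ := Matrix.entryLinearMap ℂ ℂ 0 1 ∘ₗ (matF q).toLinearMap

/-- `B_t = q ^ (-1/2) (E - F K) - i (q - q⁻¹)⁻¹ t K` as a functional, with
`t = q ^ a - q ^ (-a)`. -/
def pairB : OqSU2 q →ₗ[ℂ] ℂ :=
  ((q ^ (-(1 / 2) : ℝ) : ℝ) : ℂ) • (pairE q - convMul (pairF q) (pairK q).toLinearMap) -
    (Complex.I * ((q : ℂ) - (q : ℂ)⁻¹)⁻¹ * (qDiff q a : ℂ)) • (pairK q).toLinearMap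

theorem triangular {φ : OqSU2 q →ₐ[ℂ] Matrix (Fin 2) (Fin 2) ℂ} {χ₁ χ₂ : OqSU2 q →ₐ[ℂ] ℂ}
    (h : ∀ i j, φ (U q i j) 1 0 = 0 ∧ φ (U q i j) 0 0 = χ₁ (U q i j) ∧
      φ (U q i j) 1 1 = χ₂ (U q i j)) (x : OqSU2 q) :
    φ x 1 0 = 0 ∧ φ x 0 0 = χ₁ x ∧ φ x 1 1 = χ₂ x := by
  induction x using OqSU2.induction with
  | hU i j => exact h i j
  | hs c => simp [Matrix.algebraMap_matrix_apply, AlgHom.commutes]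
  | ha x y hx hy => simp [map_add, hx, hy]
  | hm x y hx hy => simp [map_mul, Matrix.mul_apply, Fin.sum_univ_two, hx, hy]

theorem triangular_mul {φ : OqSU2 q →ₐ[ℂ] Matrix (Fin 2) (Fin 2) ℂ} {χ₁ χ₂ : OqSU2 q →ₐ[ℂ] ℂ}
    (h : ∀ i j, φ (U q i j) 1 0 = 0 ∧ φ (U q i j) 0 0 = χ₁ (U q i j) ∧
      φ (U q i j) 1 1 = χ₂ (U q i j)) (x y : OqSU2 q) :
    φ (x * y) 0 1 = φ x 0 1 * χ₂ y + χ₁ x * φ y 0 1 := by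
  rw [map_mul, Matrix.mul_apply, Fin.sum_univ_two, (triangular q h x).2.1,
    (triangular q h y).2.2, add_comm]

theorem pairE_mul (x y : OqSU2 q) :
    pairE q (x * y) = pairE q x * counit y + pairK q x * pairE q y :=
  triangular_mul q (φ := matE q) (χ₁ := pairK q) (χ₂ := Bialgebra.counitAlgHom ℂ (OqSU2 q))
    (by intro i j; simp [matE_U]) x y

theorem commute_matF (x y : OqSU2 q) :
    Commute (matF q x) (((Algebra.ofId ℂ (Matrix (Fin 2) (Fin 2) ℂ)).comp (pairK q)) y) :=
  (Algebra.commutes (pairK q y) (matF q x)).symm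

/-- The homomorphism `x ↦ (K(x), (F K)(x); 0, ε(x))`. -/
def matFK : OqSU2 q →ₐ[ℂ] Matrix (Fin 2) (Fin 2) ℂ :=
  (Algebra.TensorProduct.lift (matF q) ((Algebra.ofId ℂ _).comp (pairK q))
    (commute_matF q)).comp
      (Bialgebra.comulAlgHom ℂ (OqSU2 q))

theorem matFK_apply (x : OqSU2 q) :
    matFK q x 0 1 = convMul (pairF q) (pairK q).toLinearMap x := by
  have : ∀ T : OqSU2 q ⊗[ℂ] OqSU2 q,
      (Algebra.TensorProduct.lift (matF q) ((Algebra.ofId ℂ _).comp (pairK q))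
        (commute_matF q) T) 0 1 =
      LinearMap.mul' ℂ ℂ (TensorProduct.map (pairF q) (pairK q).toLinearMap T) := by
    intro T
    induction T with
    | zero => simp
    | add x y hx hy => simp only [map_add, Matrix.add_apply, hx, hy]
    | tmul x y =>
      have h : matF q x * algebraMap ℂ (Matrix (Fin 2) (Fin 2) ℂ) (pairK q y) =
          pairK q y • matF q x := by rw [← Algebra.commutes, ← Algebra.smul_def]
      rw [Algebra.TensorProduct.lift_tmul, AlgHom.comp_apply, Algebra.ofId_apply, h]
      simp [pairF, mul_comm]
  exact this _

theorem pairFK_mul (x y : OqSU2 q) :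
    convMul (pairF q) (pairK q).toLinearMap (x * y) =
      convMul (pairF q) (pairK q).toLinearMap x * counit y +
        pairK q x * convMul (pairF q) (pairK q).toLinearMap y := by
  rw [← matFK_apply, ← matFK_apply, ← matFK_apply]
  refine triangular_mul q (φ := matFK q) (χ₁ := pairK q)
    (χ₂ := Bialgebra.counitAlgHom ℂ (OqSU2 q)) (fun i j => ?_) x y
  have hq' : (q : ℂ) ≠ 0 := by exact_mod_cast hq.out.1.ne'
  have hm : matFK q (U q i j) = pairK q (U q 0 j) • matF q (U q i 0) +
      pairK q (U q 1 j) • matF q (U q i 1) := by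
    rw [matFK, AlgHom.comp_apply, Bialgebra.comulAlgHom_apply, comul_U, map_add,
      Algebra.TensorProduct.lift_tmul, Algebra.TensorProduct.lift_tmul]
    simp only [AlgHom.comp_apply, Algebra.ofId_apply, ← Algebra.commutes, ← Algebra.smul_def]
  rw [hm]
  fin_cases i <;> fin_cases j <;>
    simp [counit_U, matF_U, pairK, pairKinv, torusChar_U, Algebra.ofId_apply, qUnit,
      Matrix.algebraMap_eq_diagonal, Matrix.mul_diagonal, Real.rpow_neg_one, hq']

theorem pairB_mul (x y : OqSU2 q) :
    Complex.I * pairB q a (x * y) = Complex.I * pairB q a x * counit y +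
      pairK q x * (Complex.I * pairB q a y - (qNum q a : ℂ) * counit y) := by
  have h : Complex.I * (Complex.I * ((q : ℂ) - (q : ℂ)⁻¹)⁻¹ * (qDiff q a : ℂ)) =
      -(qNum q a : ℂ) := by
    rw [← mul_assoc, ← mul_assoc, Complex.I_mul_I, qNum, qDiff]
    push_cast
    ring
  simp only [pairB, LinearMap.sub_apply, LinearMap.smul_apply, smul_eq_mul, pairE_mul, pairFK_mul,
    AlgHom.toLinearMap_apply, map_mul]
  linear_combination (pairK q x * counit (R := ℂ) y) * h

theorem pairB_U (i j : Fin 2) : Complex.I * pairB q a (U q i j) =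
    !![(q : ℂ) * qNum q a, Complex.I; -Complex.I, (q : ℂ)⁻¹ * qNum q a] i j := by
  have hFK : ∀ i j, convMul (pairF q) (pairK q).toLinearMap (U q i j) =
      pairF q (U q i 0) * pairK q (U q 0 j) + pairF q (U q i 1) * pairK q (U q 1 j) := by
    intro i j
    simp [convMul, comul_U]
  have h : Complex.I * (Complex.I * ((q : ℂ) - (q : ℂ)⁻¹)⁻¹ * (qDiff q a : ℂ)) =
      -(qNum q a : ℂ) := by
    rw [← mul_assoc, ← mul_assoc, Complex.I_mul_I, qNum, qDiff]
    push_cast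
    ring
  have h1 : ((q ^ (-(1 / 2) : ℝ) : ℝ) : ℂ) * ((q ^ (1 / 2 : ℝ) : ℝ) : ℂ) = 1 := by
    rw [← Complex.ofReal_mul, ← Real.rpow_add hq.out.1]; simp
  have h2 : ((q ^ (-(1 / 2) : ℝ) : ℝ) : ℂ) * (((q ^ (-(1 / 2) : ℝ) : ℝ) : ℂ) * q) = 1 := by
    rw [← Complex.ofReal_mul, ← Complex.ofReal_mul, ← mul_assoc, ← Real.rpow_add hq.out.1]
    norm_num
    rw [Real.rpow_neg_one, ← Complex.ofReal_mul, inv_mul_cancel₀ hq.out.1.ne', Complex.ofReal_one]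
  have hE : ∀ i j, pairE q (U q i j) = !![0, ((q ^ (1 / 2 : ℝ) : ℝ) : ℂ); 0, 0] i j := by
    intro i j; simp [pairE, matE_U]
  have hF : ∀ i j, pairF q (U q i j) = !![0, 0; ((q ^ (-(1 / 2) : ℝ) : ℝ) : ℂ), 0] i j := by
    intro i j; simp [pairF, matF_U]
  have hK : ∀ i j, pairK q (U q i j) = !![(q : ℂ), 0; 0, (q : ℂ)⁻¹] i j := by
    intro i j; simp [pairK, torusChar_U, qUnit]
  simp only [pairB, LinearMap.sub_apply, LinearMap.smul_apply, smul_eq_mul, hFK, hE, hF, hK,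
    AlgHom.toLinearMap_apply]
  generalize ((q ^ (-(1 / 2) : ℝ) : ℝ) : ℂ) = s at *
  generalize ((q ^ (1 / 2 : ℝ) : ℝ) : ℂ) = r at *
  fin_cases i <;> fin_cases j <;> simp
  · linear_combination -(q : ℂ) * h
  · linear_combination h1
  · linear_combination h2
  · linear_combination -(q : ℂ)⁻¹ * h

theorem pairB_podles (b : OqSU2 q) (hb : b ∈ Podles q a) :
    Complex.I * pairB q a b = (qNum q a : ℂ) * counit b := by
  have hq' : (q : ℂ) ≠ 0 := by exact_mod_cast hq.out.1.ne'
  have hK : ∀ i j, pairK q (U q i j) = !![(q : ℂ), 0; 0, (q : ℂ)⁻¹] i j := by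
    intro i j; simp [pairK, torusChar_U, qUnit]
  have ht : (qDiff q a : ℂ) = ((q : ℂ) - (q : ℂ)⁻¹) * qNum q a := by
    have : q - q⁻¹ ≠ 0 := by
      have h1 : 1 < q⁻¹ := (one_lt_inv₀ hq.out.1).2 hq.out.2
      have := hq.out.2
      linarith
    have h2 : qDiff q a = (q - q⁻¹) * qNum q a := (mul_div_cancel₀ _ this).symm
    exact_mod_cast h2
  refine Podles.induction q a (P := fun b => Complex.I * pairB q a b = (qNum q a : ℂ) * counit b)
    ?_ ?_ ?_ ?_ b hb
  · intro i j
    rw [podlesE_eq, map_add, map_add, map_add, map_smul, map_smul, map_smul, map_smul,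
      ← podlesE_eq, counit_podlesE]
    simp only [smul_eq_mul, mul_add, mul_left_comm Complex.I, pairB_mul]
    have hB0 : ∀ c : ℂ, ∀ x, Complex.I * pairB q a (c • x) = c * (Complex.I * pairB q a x) := by
      intro c x; rw [map_smul, smul_eq_mul]; ring
    have hBn : ∀ x, Complex.I * pairB q a (-x) = -(Complex.I * pairB q a x) := by
      intro x; rw [map_neg]; ring
    have h01 : Complex.I * pairB q a (U q 0 1) = Complex.I := by simpa using pairB_U q a 0 1
    have h10 : Complex.I * pairB q a (U q 1 0) = -Complex.I := by simpa using pairB_U q a 1 0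
    have hqq : (q : ℂ) * (q : ℂ)⁻¹ = 1 := mul_inv_cancel₀ hq'
    fin_cases i <;> fin_cases j <;>
      simp [adjMat, podlesL, counit_U, hK, pairB_U, hB0, hBn, -Complex.coe_smul, ht]
    · linear_combination Complex.I * (q : ℂ)⁻¹ * h01
    · linear_combination ((q : ℂ) - (q : ℂ)⁻¹) * qNum q a * (q : ℂ)⁻¹ * h01 +
        Complex.I * qNum q a * hqq
    · linear_combination -Complex.I * qNum q a * hqq
    · linear_combination -(Complex.I * q) * h10 -
        ((q : ℂ) - (q : ℂ)⁻¹) * (qNum q a : ℂ) ^ 2 * hqq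
  · intro c
    have h1 : Complex.I * pairB q a 1 = qNum q a := by
      have h := pairB_mul q a 1 1
      rw [mul_one, map_one (pairK q), Bialgebra.counit_one] at h
      linear_combination -h
    rw [Algebra.algebraMap_eq_smul_one, map_smul, map_smul, Bialgebra.counit_one, smul_eq_mul,
      smul_eq_mul]
    linear_combination c * h1
  · intro x y hx hy
    rw [map_add, map_add, mul_add, mul_add, hx, hy]
  · intro x y hx hy
    rw [pairB_mul, hx, hy, Bialgebra.counit_mul]
    ring

/-- `B_t` as a functional on `C`. -/
def pairBC : OqSO2 q a →ₗ[ℂ] ℂ :=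
  (idealABplus q a).liftQ (pairB q a) (by
    refine Submodule.span_le.2 ?_
    rintro _ ⟨c, b, hb, h0, rfl⟩
    have h := pairB_mul q a c b
    rw [pairB_podles q a b hb, h0] at h
    simpa using h)

end Functionals

section SubCoalgebra

variable {C : Type*} [AddCommGroup C] [Module ℂ C] [Coalgebra ℂ C]

/-- `D` is a subcoalgebra, `Δ(D) ⊆ D ⊗ D`. -/
def IsSubcoalgebra (D : Submodule ℂ C) : Prop :=
  ∀ d ∈ D, comul (R := ℂ) d ∈ LinearMap.range (TensorProduct.map D.subtype D.subtype)

/-- `D` is a simple subcoalgebra, that is, the space of matrix coefficients of an irreducible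
comodule. -/
def IsSimpleSubcoalgebra (D : Submodule ℂ C) : Prop :=
  IsSubcoalgebra D ∧ D ≠ ⊥ ∧ ∀ D' ≤ D, IsSubcoalgebra D' → D' = ⊥ ∨ D' = D

end SubCoalgebra

section Induction

variable (q : ℝ) [hq : Fact (q ∈ Set.Ioo (0 : ℝ) 1)] (a : ℝ)

/-- The restricted dual `𝒰_q(SO(2)_t)` of the cosemisimple coalgebra `C`: the functionals that
vanish on all but finitely many of the simple subcoalgebras of `C`. In the product of matrix
algebras that is the full dual of `C`, this is the direct sum. -/
def restrictedDual : Submodule ℂ (OqSO2 q a →ₗ[ℂ] ℂ) where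
  carrier := {ω | {D : Submodule ℂ (OqSO2 q a) |
    IsSimpleSubcoalgebra D ∧ ∃ d ∈ D, ω d ≠ 0}.Finite}
  zero_mem' := by simp
  add_mem' := by
    intro ω χ hω hχ
    refine (hω.union hχ).subset ?_
    rintro D ⟨hD, d, hd, h⟩
    by_cases h1 : ω d = 0
    · exact Or.inr ⟨hD, d, hd, fun h2 => h (by simp [h1, h2])⟩
    · exact Or.inl ⟨hD, d, hd, h1⟩
  smul_mem' := by
    intro c ω hω
    refine hω.subset ?_
    rintro D ⟨hD, d, hd, h⟩
    exact ⟨hD, d, hd, fun h2 => h (by simp [h2])⟩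

/-- The involution `ω*(c) = conj (ω(c†))` of the full dual of `C`. -/
def starDual (ω : OqSO2 q a →ₗ[ℂ] ℂ) : OqSO2 q a →ₗ[ℂ] ℂ where
  toFun c := starRingEnd ℂ (ω (dagC q a c))
  map_add' x y := by simp
  map_smul' c x := by simp [map_smulₛₗ]

/-- The integral `ψ_t` with `ψ_t(p_[c]) = q ^ c + q ^ (-c)` for `c ∈ a + ℤ`, where `p_[c]` is the
minimal projection on which `i B_t` is `[c]`. The component of `ω` at `p_[c]` is `ω(g)` for the
grouplike element `g` of `C` with `i B_t(g) = [c]`. -/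
def psiT (ω : OqSO2 q a →ₗ[ℂ] ℂ) : ℂ :=
  ∑ᶠ n : ℤ, ∑ᶠ g : {g : OqSO2 q a // IsGroupLikeElem ℂ g ∧
    Complex.I * pairBC q a g = (qNum q (a + n) : ℂ)}, (qSum q (a + n) : ℂ) * ω g

/-- The operators `x ↦ (ω ↦ ω(S⁻¹(x) -))` on the full dual of `C`. -/
def leftTrans : OqSU2 q →ₗ[ℂ] Module.End ℂ (OqSO2 q a →ₗ[ℂ] ℂ) where
  toFun x := LinearMap.lcomp ℂ ℂ (actC q a (antipodeInv q x))
  map_add' x y := by ext; simp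
  map_smul' c x := by ext; simp

/-- The operators `π_g(x) ω = τ(x₁, g ^ (1/2)) ω(S⁻¹(x₂) -)` on the full dual of `C`, where
`g = K⁻¹`. -/
def piG : OqSU2 q →ₗ[ℂ] Module.End ℂ (OqSO2 q a →ₗ[ℂ] ℂ) :=
  (TensorProduct.lid ℂ _).toLinearMap ∘ₗ
    TensorProduct.map (pairGHalf q).toLinearMap (leftTrans q a) ∘ₗ comul

/-- The operators `b · ω = χ(b₁) π_g(b₂) ω` for a character `χ` of the Podleś sphere. -/
def inducedAct (χ : Podles q a →⋆ₐ[ℂ] ℂ) :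
    Podles q a →ₗ[ℂ] Module.End ℂ (OqSO2 q a →ₗ[ℂ] ℂ) :=
  (TensorProduct.lid ℂ _).toLinearMap ∘ₗ
    TensorProduct.map χ.toAlgHom.toLinearMap (piG q a) ∘ₗ (podlesCoact q a).toLinearMap

/-- The action of `B ⊗ A` on `V ⊗ C`, for an action of `B` on `V`. -/
def tensorAct {V : Type*} [AddCommGroup V] [Module ℂ V]
    (act : Podles q a →ₐ[ℂ] Module.End ℂ V) :
    Podles q a ⊗[ℂ] OqSU2 q →ₗ[ℂ] Module.End ℂ (V ⊗[ℂ] OqSO2 q a) :=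
  TensorProduct.homTensorHomMap (RingHom.id ℂ) V (OqSO2 q a) V (OqSO2 q a) ∘ₗ
    TensorProduct.map act.toLinearMap (actC q a)

/-- A unitary Doi-Koppinen representation for `(O_q(SU(2)), O_q(S_t²), O_q(SO(2)_t))`, that is, a
unitary representation of the Drinfeld double `𝒰_q(SL(2,ℝ)_t)` of `O_q(S_t²)` and
`𝒰_q(SO(2)_t)`, on the pre-Hilbert space `V`. -/
structure UnitaryDKRep (V : Type*) [AddCommGroup V] [Module ℂ V] where
  /-- the inner product, linear in the second variable -/
  ip : V →ₗ⋆[ℂ] V →ₗ[ℂ] ℂ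
  ip_symm : ∀ v w, starRingEnd ℂ (ip v w) = ip w v
  ip_pos : ∀ v, v ≠ 0 → 0 < (ip v v).re
  /-- the action of `O_q(S_t²)` -/
  act : Podles q a →ₐ[ℂ] Module.End ℂ V
  /-- the right coaction of `C` -/
  coact : V →ₗ[ℂ] V ⊗[ℂ] OqSO2 q a
  coassoc : (TensorProduct.assoc ℂ V (OqSO2 q a) (OqSO2 q a)).toLinearMap ∘ₗ
    coact.rTensor (OqSO2 q a) ∘ₗ coact = (comul (R := ℂ)).lTensor V ∘ₗ coact
  counit_coact : (TensorProduct.rid ℂ V).toLinearMap ∘ₗ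
    (counit (R := ℂ) (A := OqSO2 q a)).lTensor V ∘ₗ coact = LinearMap.id
  coact_act : ∀ b v, coact (act b v) = tensorAct q a act (podlesCoact q a b) (coact v)
  ip_act : ∀ b v w, ip v (act b w) = ip (act (star b) v) w
  /-- Unitarity of the coaction, `⟨v, w₀⟩ w₁ = ⟨v₀, w⟩ v₁†`; the right hand side is
  `(⟨w, v₀⟩ v₁)†`. -/
  ip_coact : ∀ v w,
    TensorProduct.lid ℂ (OqSO2 q a) ((ip v).rTensor (OqSO2 q a) (coact w)) =
      dagC q a (TensorProduct.lid ℂ (OqSO2 q a) ((ip w).rTensor (OqSO2 q a) (coact v)))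

namespace UnitaryDKRep

variable {q a} {V : Type*} [AddCommGroup V] [Module ℂ V] (R : UnitaryDKRep q a V)

/-- The action `ω v = ω(v₁) v₀` of a functional on `C`. -/
def actDual (ω : OqSO2 q a →ₗ[ℂ] ℂ) : Module.End ℂ V :=
  (TensorProduct.rid ℂ V).toLinearMap ∘ₗ ω.lTensor V ∘ₗ R.coact

/-- The operator `i B_t`. -/
def opIB : Module.End ℂ V := Complex.I • R.actDual (pairBC q a)

/-- The Casimir operator `Ω_t = i q⁻¹ X_t + (q - q⁻¹) Z_t (i B_t) - i q Y_t`. -/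
def casimir : Module.End ℂ V :=
  (Complex.I * (q : ℂ)⁻¹) • R.act (podlesX q a) +
    ((q : ℂ) - (q : ℂ)⁻¹) • (R.act (podlesZ q a) ∘ₗ R.opIB) -
    (Complex.I * (q : ℂ)) • R.act (podlesY q a)

/-- Irreducibility in the analytic sense: every nonzero subspace that is invariant under the
Drinfeld double is dense, that is, the completion has no nontrivial closed invariant subspace. -/
def IsIrreducible : Prop :=
  Nontrivial V ∧ ∀ W : Submodule ℂ V, (∀ b, ∀ w ∈ W, R.act b w ∈ W) →
    (∀ ω ∈ restrictedDual q a, ∀ w ∈ W, R.actDual ω w ∈ W) → W ≠ ⊥ →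
      ∀ v, ∀ ε > 0, ∃ w ∈ W, (R.ip (v - w) (v - w)).re < ε

/-- `R` is the representation `L_lam⁺`: it is irreducible, the Casimir element takes the value
`lam`, and the set of eigenvalues of `i B_t` is `{[a + 2k] | k ∈ ℤ}`. -/
def IsEvenSeries (lam : ℝ) : Prop :=
  R.IsIrreducible ∧ R.casimir = (lam : ℂ) • LinearMap.id ∧
    ∀ μ : ℂ, R.opIB.HasEigenvalue μ ↔ ∃ k : ℤ, μ = (qNum q (a + 2 * k) : ℂ)

/-- `R` is the representation `L_lam⁻`: it is irreducible, the Casimir element takes the value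
`lam`, and the set of eigenvalues of `i B_t` is `{[a + 2k + 1] | k ∈ ℤ}`. -/
def IsOddSeries (lam : ℝ) : Prop :=
  R.IsIrreducible ∧ R.casimir = (lam : ℂ) • LinearMap.id ∧
    ∀ μ : ℂ, R.opIB.HasEigenvalue μ ↔ ∃ k : ℤ, μ = (qNum q (a + 2 * k + 1) : ℂ)

/-- `R` is unitarily equivalent to the orthogonal direct sum of `R₁` and `R₂`. -/
def EquivDirectSum {V₁ V₂ : Type*} [AddCommGroup V₁] [Module ℂ V₁] [AddCommGroup V₂]
    [Module ℂ V₂] (R₁ : UnitaryDKRep q a V₁) (R₂ : UnitaryDKRep q a V₂) : Prop :=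
  ∃ T : V ≃ₗ[ℂ] V₁ × V₂,
    (∀ v w, R.ip v w = R₁.ip (T v).1 (T w).1 + R₂.ip (T v).2 (T w).2) ∧
    (∀ b v, T (R.act b v) = (R₁.act b (T v).1, R₂.act b (T v).2)) ∧
    ∀ ω ∈ restrictedDual q a, ∀ v,
      T (R.actDual ω v) = (R₁.actDual ω (T v).1, R₂.actDual ω (T v).2)

/-- `R` is the induced representation `Ind(χ)` on `ℂ ⊗ L²_{q,0}(SO(2)_t) = L²_{q,0}(SO(2)_t)`, that
is, on the restricted dual `𝒰_q(SO(2)_t)` with the inner product `⟨y, z⟩ = ψ_t(y* z)`, with the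
action `b · y = χ(b₁) π_g(b₂) y` of `O_q(S_t²)` and with left multiplication by
`𝒰_q(SO(2)_t)`. -/
def IsInduced (R : UnitaryDKRep q a (restrictedDual q a)) (χ : Podles q a →⋆ₐ[ℂ] ℂ) : Prop :=
  (∀ y z : restrictedDual q a, R.ip y z = psiT q a (convMul (starDual q a y) z)) ∧
  (∀ (b : Podles q a) (y : restrictedDual q a),
    (R.act b y : OqSO2 q a →ₗ[ℂ] ℂ) = inducedAct q a χ b y) ∧
  ∀ ω ∈ restrictedDual q a, ∀ y : restrictedDual q a,
    (R.actDual ω y : OqSO2 q a →ₗ[ℂ] ℂ) = convMul ω y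

end UnitaryDKRep

/-- The values of the Casimir element for which `L⁺` is defined. -/
def evenRange : Set ℝ := Set.Ioo (-qSum q (1 - 2 * (⌈a⌉ - a))) (qSum q 1)

/-- The values of the Casimir element for which `L⁻` is defined. -/
def oddRange : Set ℝ :=
  Set.Ioo (-qSum q (1 - 2 * (⌈a - 1 / 2⌉ - (a - 1 / 2)))) (qSum q 0)

/-- The conditions `χ(Z_t) = 0`, `χ(X_t) = z`, `χ(Y_t) = conj z` that determine the character
`χ_z`. -/
def IsPodlesChar (χ : Podles q a →⋆ₐ[ℂ] ℂ) (z : ℂ) : Prop :=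
  χ (podlesZ q a) = 0 ∧ χ (podlesX q a) = z ∧ χ (podlesY q a) = starRingEnd ℂ z

/-- The character `χ_z` exists for `z = exp(-iθ)`: it is the restriction of a torus character. -/
theorem exists_isPodlesChar (θ : ℝ) :
    ∃ χ : Podles q a →⋆ₐ[ℂ] ℂ, IsPodlesChar q a χ (Complex.exp (-(Complex.I * θ))) := by
  have hq' : (q : ℂ) ≠ 0 := by exact_mod_cast hq.out.1.ne'
  let u : ℂˣ := Units.mk0 (Complex.exp (Complex.I * (Real.pi / 4 - θ / 2))) (Complex.exp_ne_zero _)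
  have hu : ∀ z : ℂ, z = u → starRingEnd ℂ z = ((u⁻¹ : ℂˣ) : ℂ) := by
    rintro _ rfl
    simp only [u, Units.val_inv_eq_inv_val, Units.val_mk0, ← Complex.exp_conj, ← Complex.exp_neg]
    congr 1
    simp [Complex.conj_ofNat]
  have hstar : ∀ x : OqSU2 q, torusChar q u (star x) = star (torusChar q u x) := by
    intro x
    induction x using OqSU2.induction with
    | hU i j =>
      rw [star_U]
      have h1 := hu u rfl
      have h2 : starRingEnd ℂ ((u⁻¹ : ℂˣ) : ℂ) = u := by rw [← h1]; simp
      fin_cases i <;> fin_cases j <;> simp [adjMat, torusChar_U, -Complex.coe_smul]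
      · exact h1.symm.trans (by simp)
      · simpa using h2.symm
    | hs c => rw [star_algebraMap', AlgHom.commutes, AlgHom.commutes]; rfl
    | ha x y hx hy => rw [star_add, map_add, map_add, hx, hy, star_add]
    | hm x y hx hy => rw [star_mul, map_mul, map_mul, hx, hy, star_mul]
  have hE : ∀ i j, torusChar q u (podlesE q a i j) =
      podlesL q a 0 0 * (torusChar q u (adjMat q (U q) i 0) * torusChar q u (U q 0 j)) +
      podlesL q a 0 1 * (torusChar q u (adjMat q (U q) i 0) * torusChar q u (U q 1 j)) +
      podlesL q a 1 0 * (torusChar q u (adjMat q (U q) i 1) * torusChar q u (U q 0 j)) +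
      podlesL q a 1 1 * (torusChar q u (adjMat q (U q) i 1) * torusChar q u (U q 1 j)) := by
    intro i j
    rw [podlesE_eq]
    simp only [map_add, map_smul, map_mul, smul_eq_mul]
  have huu : (u : ℂ) * u = Complex.I * Complex.exp (-(Complex.I * θ)) := by
    have h1 : Complex.exp (Real.pi / 2 * Complex.I) = Complex.I := Complex.exp_pi_div_two_mul_I
    rw [show Complex.I * Complex.exp (-(Complex.I * θ)) = Complex.exp (Real.pi / 2 * Complex.I) *
      Complex.exp (-(Complex.I * θ)) by rw [h1], ← Complex.exp_add]
    simp only [u, Units.val_mk0, ← Complex.exp_add]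
    congr 1
    ring
  refine ⟨{ (torusChar q u).comp (Podles q a).toSubalgebra.val with
    map_star' := fun b => hstar b }, ?_, ?_, ?_⟩
  · change torusChar q u ((q : ℂ) • podlesE q a 0 0) = 0
    rw [map_smul, hE]
    simp [adjMat, torusChar_U, podlesL, -Complex.coe_smul]
  · change torusChar q u (podlesE q a 1 0) = _
    rw [hE]
    simp [adjMat, torusChar_U, podlesL, -Complex.coe_smul]
    linear_combination -Complex.I * huu - Complex.exp (-(Complex.I * θ)) * Complex.I_mul_I
  · change torusChar q u (podlesE q a 0 1) = _
    have h1 : torusChar q u (podlesE q a 1 0) = Complex.exp (-(Complex.I * θ)) := by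
      rw [hE]
      simp [adjMat, torusChar_U, podlesL, -Complex.coe_smul]
      linear_combination -Complex.I * huu - Complex.exp (-(Complex.I * θ)) * Complex.I_mul_I
    rw [← h1, ← star_podlesE, hstar]
    rfl

end Induction

end

open scoped TensorProduct
open Coalgebra
open OqSU2

noncomputable section

set_option linter.unusedSectionVars false
set_option linter.unusedSimpArgs false

/-! The theorem reduces to a weight calculus in which a Casimir value leaves one scalar per weight.

The coalgebra C has a basis of grouplike elements g_n, n ∈ ℤ, with iB_t(g_n) = [a + n]
(`glikeBasis`). They are found by climbing from π_C(1): if g is such an element and x = q^(a+n), the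
matrix entries U_ij g are spanned by αg and βg, and this span contains the neighbours αg - i x⁻¹ βg
and αg + i x βg. Hence a C-comodule is a ℤ-graded space, the restricted dual consists of the
finitely supported functions on ℤ with pointwise product, and ψ_t is a weighted sum of values.

Entries of U and U* move the degree by one, so the entries of E_t = U* L U move it by -2, 0 or 2.
The coaction, the quantum trace of E_t and the Casimir value λ together determine the four entries
on a weight vector from one raising operator, one lowering operator and one explicit matrix of
scalars (`IsWt.act_podlesGen`). The quadratic relation for E_t then makes lowering after raising a
scalar κ depending on x, t and λ only (`IsWt.lower_raise`). Since E_00 is self-adjoint, κ is also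
the factor by which raising changes squared norms. An irreducible representation with Casimir value
λ and one parity of weights therefore has one-dimensional weight spaces and an orthogonal basis w_k
with w_(k+1) the raising of w_k, on which the action and the norms are expressed by λ alone. This is
uniqueness (`IsSeries.exists_unitaryEquiv`).

In the induced representation the minimal projections p_n are weight vectors, one for each n. The
Casimir value is i(z - conj z) = 2 sin θ, and the weights ⟨c⟩ of ψ_t are what makes raising and
lowering adjoint (`indUp_eq_conj_indDown`). As the degree moves by even steps, the space splits
orthogonally into the parts with n even and n odd. Such a part is irreducible if no raising
coefficient vanishes on it, because κ ≠ 0 then makes lowering injective as well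
(`isSeries_of_raise`). A vanishing coefficient forces cos θ = 0 and t = sin θ (y - y⁻¹) with y =
q^(a+n+1), which the two ranges of λ exclude for the parity at hand. The two parts prove existence
of the two series, and uniqueness identifies them with any other choice. -/

/-- Two-sided recursion along the integers for a relation that can be continued both ways. -/
theorem Int.exists_bi_seq {α : Type*} (P : ℤ → α → Prop) (T : ℤ → α → α → Prop) (x₀ : α)
    (h₀ : P 0 x₀) (up : ∀ n x, P n x → ∃ y, P (n + 1) y ∧ T n x y)
    (down : ∀ n y, P (n + 1) y → ∃ x, P n x ∧ T n x y) :
    ∃ f : ℤ → α, f 0 = x₀ ∧ ∀ n, P n (f n) ∧ T n (f n) (f (n + 1)) := by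
  choose! u hu using up
  choose! d hd using down
  let f₁ : ℕ → α := fun n => Nat.rec x₀ (fun k x => u k x) n
  let f₂ : ℕ → α := fun n => Nat.rec x₀ (fun k x => d (-(k : ℤ) - 1) x) n
  have h₁ : ∀ n : ℕ, P n (f₁ n) := by
    intro n
    induction n with
    | zero => exact h₀
    | succ k ih => exact_mod_cast (hu k _ ih).1
  have h₂ : ∀ n : ℕ, P (-(n : ℤ)) (f₂ n) := by
    intro n
    induction n with
    | zero => exact h₀
    | succ k ih =>
      have := (hd (-(k : ℤ) - 1) (f₂ k) (by simpa using ih)).1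
      rw [show -((k + 1 : ℕ) : ℤ) = -(k : ℤ) - 1 by push_cast; ring]
      exact this
  refine ⟨fun n => if 0 ≤ n then f₁ n.toNat else f₂ (-n).toNat, by simp [f₁], fun n => ?_⟩
  rcases le_or_gt 0 n with hn | hn
  · obtain ⟨k, rfl⟩ := Int.eq_ofNat_of_zero_le hn
    beta_reduce
    rw [if_pos hn, if_pos (by omega)]
    exact ⟨by simpa using h₁ k, by simpa using (hu k _ (h₁ k)).2⟩
  · obtain ⟨k, rfl⟩ : ∃ k : ℕ, n = -(k : ℤ) - 1 := ⟨(-n - 1).toNat, by omega⟩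
    have hk : f₂ (-(-(k : ℤ) - 1)).toNat = d (-(k : ℤ) - 1) (f₂ k) := by
      rw [show (-(-(k : ℤ) - 1)).toNat = k + 1 by omega]
    have := hd (-(k : ℤ) - 1) (f₂ k) (by simpa using h₂ k)
    beta_reduce
    rw [if_neg (by omega), hk]
    refine ⟨this.1, ?_⟩
    -- For k = 0 the successor index is 0 and falls in the upper branch; both branches start at x₀,
    -- so the halves fit together.
    have h3 : (if 0 ≤ -(k : ℤ) - 1 + 1 then f₁ (-(k : ℤ) - 1 + 1).toNat
        else f₂ (-(-(k : ℤ) - 1 + 1)).toNat) = f₂ k := by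
      rcases Nat.eq_zero_or_pos k with rfl | hk
      · simp [f₁, f₂]
      · rw [if_neg (by omega)]
        congr 1
        omega
    rw [h3]
    exact this.2

/-! ### The numbers q^(a+n) and the separation of weights by q-numbers. -/

section Weights

variable (q : ℝ) [hq : Fact (q ∈ Set.Ioo (0 : ℝ) 1)] (a : ℝ)

/-- The number `q ^ (a + n)` as a complex number. -/
def wt (n : ℤ) : ℂ := ((q ^ (a + n) : ℝ) : ℂ)

theorem cq_ne_zero : (q : ℂ) ≠ 0 := by exact_mod_cast hq.out.1.ne'

theorem cq_sq_sub_one_ne_zero : (q : ℂ) ^ 2 - 1 ≠ 0 := by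
  have h1 : q ^ 2 < 1 := pow_lt_one₀ hq.out.1.le hq.out.2 two_ne_zero
  have : q ^ 2 - 1 ≠ 0 := by linarith
  exact_mod_cast this

theorem wt_ne_zero (n : ℤ) : wt q a n ≠ 0 := by
  have := (Real.rpow_pos_of_pos hq.out.1 (a + n)).ne'
  rw [wt]
  exact_mod_cast this

theorem wt_add_inv_ne_zero (n : ℤ) : wt q a n + (wt q a n)⁻¹ ≠ 0 := by
  have h := Real.rpow_pos_of_pos hq.out.1 (a + n)
  have : q ^ (a + n) + (q ^ (a + n))⁻¹ ≠ 0 := by positivity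
  rw [wt]
  exact_mod_cast this

theorem conj_wt (n : ℤ) : starRingEnd ℂ (wt q a n) = wt q a n := Complex.conj_ofReal _

theorem wt_add (n m : ℤ) : wt q a (n + m) = (q : ℂ) ^ m * wt q a n := by
  rw [wt, wt, Int.cast_add, ← add_assoc, Real.rpow_add hq.out.1, Real.rpow_intCast]
  push_cast
  ring

theorem wt_add_one (n : ℤ) : wt q a (n + 1) = q * wt q a n := by simp [wt_add]

theorem wt_sub_one (n : ℤ) : wt q a (n - 1) = (q : ℂ)⁻¹ * wt q a n := by
  rw [sub_eq_add_neg, wt_add, zpow_neg_one]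

theorem wt_add_two (n : ℤ) : wt q a (n + 2) = (q : ℂ) ^ 2 * wt q a n := by
  rw [wt_add]; norm_cast

theorem wt_sub_two (n : ℤ) : wt q a (n - 2) = ((q : ℂ) ^ 2)⁻¹ * wt q a n := by
  rw [sub_eq_add_neg, wt_add, zpow_neg]; norm_cast

theorem qNum_wt (n : ℤ) :
    (qNum q (a + n) : ℂ) = (wt q a n - (wt q a n)⁻¹) / ((q : ℂ) - (q : ℂ)⁻¹) := by
  rw [qNum, Real.rpow_neg hq.out.1.le, wt]
  push_cast
  rfl

theorem qSum_wt (n : ℤ) : (qSum q (a + n) : ℂ) = wt q a n + (wt q a n)⁻¹ := by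
  rw [qSum, Real.rpow_neg hq.out.1.le, wt]
  push_cast
  rfl

theorem qDiff_wt : (qDiff q a : ℂ) = wt q a 0 - (wt q a 0)⁻¹ := by
  rw [qDiff, Real.rpow_neg hq.out.1.le, wt]
  push_cast
  simp

/-- For 0 < q < 1 the numerator q^x - q^(-x) decreases and the denominator q - q⁻¹ is negative. This
is what lets iB_t separate the weights. -/
theorem qNum_strictMono : StrictMono (qNum q) := by
  intro x y hxy
  have h1 := Real.rpow_lt_rpow_of_exponent_gt hq.out.1 hq.out.2 hxy
  have h2 := Real.rpow_lt_rpow_of_exponent_gt hq.out.1 hq.out.2 (neg_lt_neg hxy)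
  have h3 : 1 < q⁻¹ := (one_lt_inv₀ hq.out.1).2 hq.out.2
  have h4 := hq.out.2
  rw [qNum, qNum]
  exact div_lt_div_of_neg_of_lt (by linarith) (by linarith)

theorem qNum_wt_injective : Function.Injective fun n : ℤ => (qNum q (a + n) : ℂ) := by
  intro n m h
  have h1 : qNum q (a + n) = qNum q (a + m) := by
    beta_reduce at h
    exact_mod_cast h
  have := (qNum_strictMono q).injective h1
  exact_mod_cast add_left_cancel this

end Weights

/-! ### Climbing from one grouplike element of C to its neighbours. -/

section GroupLike

variable (q : ℝ) [hq : Fact (q ∈ Set.Ioo (0 : ℝ) 1)] (a : ℝ)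

theorem actC_mul (x y : OqSU2 q) : actC q a (x * y) = actC q a x * actC q a y := by
  refine Submodule.linearMap_qext _ (LinearMap.ext fun z => ?_)
  exact congrArg (projC q a) (mul_assoc x y z)

theorem actC_mul_apply (x y : OqSU2 q) (c : OqSO2 q a) :
    actC q a (x * y) c = actC q a x (actC q a y c) := by
  rw [actC_mul]; rfl

theorem actC_one : actC q a 1 = LinearMap.id := by
  refine Submodule.linearMap_qext _ (LinearMap.ext fun z => ?_)
  exact congrArg (projC q a) (one_mul z)

theorem counit_projC (x : OqSU2 q) : counit (R := ℂ) (projC q a x) = counit (R := ℂ) x := rfl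

theorem comul_projC (x : OqSU2 q) : comul (R := ℂ) (projC q a x) =
    TensorProduct.map (projC q a) (projC q a) (comul x) := rfl

theorem counit_actC (x : OqSU2 q) (c : OqSO2 q a) :
    counit (R := ℂ) (actC q a x c) = counit (R := ℂ) x * counit (R := ℂ) c := by
  obtain ⟨y, rfl⟩ := Submodule.mkQ_surjective _ c
  rw [actC_projC, counit_projC, counit_projC, Bialgebra.counit_mul]

theorem comul_actC (x : OqSU2 q) (c : OqSO2 q a) :
    comul (R := ℂ) (actC q a x c) =
      TensorProduct.homTensorHomMap (RingHom.id ℂ) (OqSO2 q a) (OqSO2 q a) (OqSO2 q a) (OqSO2 q a)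
        (TensorProduct.map (actC q a) (actC q a) (comul x)) (comul c) := by
  obtain ⟨y, rfl⟩ := Submodule.mkQ_surjective _ c
  rw [actC_projC, comul_projC, comul_projC, Bialgebra.comul_mul]
  generalize comul (R := ℂ) x = S
  generalize comul (R := ℂ) y = T
  induction S with
  | zero => simp
  | add s t hs ht => rw [add_mul, map_add, hs, ht, map_add, map_add, LinearMap.add_apply]
  | tmul s t =>
    induction T with
    | zero => simp
    | add u v hu hv => rw [mul_add, map_add, hu, hv, map_add, map_add]
    | tmul u v =>
      rw [Algebra.TensorProduct.tmul_mul_tmul]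
      rfl

theorem dagC_actC (x : OqSU2 q) (c : OqSO2 q a) :
    dagC q a (actC q a x c) = actC q a (dagA q x) (dagC q a c) := by
  obtain ⟨y, rfl⟩ := Submodule.mkQ_surjective _ c
  rw [actC_projC, dagC_projC, dagC_projC, actC_projC, dagA_mul]

theorem pairBC_actC (x : OqSU2 q) (c : OqSO2 q a) :
    Complex.I * pairBC q a (actC q a x c) = Complex.I * pairB q a x * counit (R := ℂ) c +
      pairK q x * (Complex.I * pairBC q a c - (qNum q a : ℂ) * counit (R := ℂ) c) := by
  obtain ⟨y, rfl⟩ := Submodule.mkQ_surjective _ c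
  exact pairB_mul q a x y

theorem actC_comm_ab (c : OqSO2 q a) : actC q a (U q 0 0) (actC q a (U q 0 1) c) =
    (q : ℂ) • actC q a (U q 0 1) (actC q a (U q 0 0) c) := by
  rw [← actC_mul_apply, (U_rels q).ab, map_smul, LinearMap.smul_apply, actC_mul_apply]

theorem actC_comm_ac (c : OqSO2 q a) : actC q a (U q 0 0) (actC q a (U q 1 0) c) =
    (q : ℂ) • actC q a (U q 1 0) (actC q a (U q 0 0) c) := by
  rw [← actC_mul_apply, (U_rels q).ac, map_smul, LinearMap.smul_apply, actC_mul_apply]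

theorem actC_comm_bc (c : OqSO2 q a) : actC q a (U q 0 1) (actC q a (U q 1 0) c) =
    actC q a (U q 1 0) (actC q a (U q 0 1) c) := by
  rw [← actC_mul_apply, (U_rels q).bc, actC_mul_apply]

theorem actC_comm_bd (c : OqSO2 q a) : actC q a (U q 0 1) (actC q a (U q 1 1) c) =
    (q : ℂ) • actC q a (U q 1 1) (actC q a (U q 0 1) c) := by
  rw [← actC_mul_apply, (U_rels q).bd, map_smul, LinearMap.smul_apply, actC_mul_apply]

theorem actC_ad (c : OqSO2 q a) : actC q a (U q 0 0) (actC q a (U q 1 1) c) =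
    c + (q : ℂ) • actC q a (U q 0 1) (actC q a (U q 1 0) c) := by
  rw [← actC_mul_apply, ← actC_mul_apply, ← LinearMap.smul_apply, ← map_smul,
    sub_eq_iff_eq_add.1 (U_rels q).ad, map_add, actC_one]
  rfl

theorem actC_da (c : OqSO2 q a) : actC q a (U q 1 1) (actC q a (U q 0 0) c) =
    c + (q : ℂ)⁻¹ • actC q a (U q 1 0) (actC q a (U q 0 1) c) := by
  rw [← actC_mul_apply, ← actC_mul_apply, ← LinearMap.smul_apply, ← map_smul,
    sub_eq_iff_eq_add.1 (U_rels q).da, map_add, actC_one]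
  rfl

/-- The grouplike elements of `C` on which `i B_t` takes the value `[a + n]`, together with the
relations between the entries of `U` on such an element. -/
structure IsWeightGroupLike (n : ℤ) (g : OqSO2 q a) : Prop where
  counit : counit (R := ℂ) g = 1
  comul : comul (R := ℂ) g = g ⊗ₜ g
  dag : dagC q a g = g
  pair : Complex.I * pairBC q a g = (qNum q (a + n) : ℂ)
  offdiag : actC q a (U q 1 0) g = -actC q a (U q 0 1) g
  diag : actC q a (U q 1 1) g = actC q a (U q 0 0) g -
    (Complex.I * ((wt q a n)⁻¹ - wt q a n)) • actC q a (U q 0 1) g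

/-- The last two relations come from U E_t = L U in A: modulo A B₊ the entries of E_t on the right
may be replaced by their counits, which are the entries of L (`mkQ_mul_UL`). -/
theorem isWeightGroupLike_one : IsWeightGroupLike q a 0 (projC q a 1) where
  counit := by rw [counit_projC, Bialgebra.counit_one]
  comul := by rw [comul_projC, Bialgebra.comul_one]; rfl
  dag := by
    rw [dagC_projC]
    have := dagA_algebraMap q 1
    simp only [map_one] at this
    rw [this]
  pair := by
    have h := pairB_mul q a 1 1
    rw [mul_one, map_one (pairK q), Bialgebra.counit_one] at h
    change Complex.I * pairB q a 1 = _
    rw [Int.cast_zero, add_zero]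
    linear_combination -h
  offdiag := by
    have h := mkQ_mul_UL q a 1 0 0
    simp only [podlesL, one_mul, map_add, map_smul] at h
    simp at h
    rw [actC_projC, actC_projC, mul_one, mul_one]
    have h2 := congrArg (fun v => Complex.I • v) h
    simp only [smul_neg, smul_smul, Complex.I_mul_I, neg_smul, one_smul, neg_neg] at h2
    simp only [Submodule.mkQ_apply]
    exact (neg_eq_iff_eq_neg.2 h2).symm
  diag := by
    have h := mkQ_mul_UL q a 1 0 1
    simp only [podlesL, one_mul, map_add, map_smul] at h
    simp [-Complex.coe_smul] at h
    rw [actC_projC, actC_projC, actC_projC, mul_one, mul_one, mul_one]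
    have h2 := congrArg (fun v => Complex.I • v) h
    simp only [smul_neg, smul_smul, Complex.I_mul_I, neg_smul, one_smul, neg_neg, smul_add,
      Submodule.mkQ_apply] at h2
    rw [qDiff_wt] at h2
    simp only [Submodule.mkQ_apply]
    linear_combination (norm := module) h2

variable {q a}

namespace IsWeightGroupLike

variable {n : ℤ} {g : OqSO2 q a} (h : IsWeightGroupLike q a n g)
include h

theorem comul_U_act (i j : Fin 2) : Coalgebra.comul (R := ℂ) (actC q a (U q i j) g) =
    actC q a (U q i 0) g ⊗ₜ actC q a (U q 0 j) g +
      actC q a (U q i 1) g ⊗ₜ actC q a (U q 1 j) g := by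
  rw [comul_actC, comul_U, h.comul]
  simp

theorem act_ab : actC q a (U q 0 0) (actC q a (U q 0 1) g) =
    (q : ℂ) • actC q a (U q 0 1) (actC q a (U q 0 0) g) := actC_comm_ab q a g

theorem act_ca : actC q a (U q 1 0) (actC q a (U q 0 0) g) =
    -actC q a (U q 0 1) (actC q a (U q 0 0) g) := by
  have h1 := actC_comm_ac q a g
  rw [h.offdiag, map_neg, h.act_ab, ← smul_neg] at h1
  exact (smul_right_injective _ (cq_ne_zero q) h1).symm

theorem act_cb : actC q a (U q 1 0) (actC q a (U q 0 1) g) =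
    -actC q a (U q 0 1) (actC q a (U q 0 1) g) := by
  rw [← actC_comm_bc, h.offdiag, map_neg]

theorem act_aa : actC q a (U q 0 0) (actC q a (U q 0 0) g) =
    g - (q : ℂ) • actC q a (U q 0 1) (actC q a (U q 0 1) g) +
      (q * (Complex.I * ((wt q a n)⁻¹ - wt q a n))) •
        actC q a (U q 0 1) (actC q a (U q 0 0) g) := by
  have h1 := actC_ad q a g
  rw [h.offdiag, map_neg, h.diag, map_sub, map_smul, h.act_ab] at h1
  linear_combination (norm := module) h1

theorem act_da : actC q a (U q 1 1) (actC q a (U q 0 0) g) =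
    g - (q : ℂ)⁻¹ • actC q a (U q 0 1) (actC q a (U q 0 1) g) := by
  rw [actC_da, h.act_cb]
  module

theorem act_db : actC q a (U q 1 1) (actC q a (U q 0 1) g) =
    (q : ℂ)⁻¹ • (actC q a (U q 0 1) (actC q a (U q 0 0) g) -
      (Complex.I * ((wt q a n)⁻¹ - wt q a n)) • actC q a (U q 0 1) (actC q a (U q 0 1) g)) := by
  have h1 := actC_comm_bd q a g
  rw [eq_inv_smul_iff₀ (cq_ne_zero q), ← h1, h.diag, map_sub, map_smul]

theorem pair_a : Complex.I * pairBC q a (actC q a (U q 0 0) g) =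
    q * (qNum q (a + n) : ℂ) := by
  have hK : pairK q (U q 0 0) = q := by simp [pairK, torusChar_U, qUnit]
  rw [pairBC_actC, h.counit, h.pair, pairB_U, hK]
  simp
  ring

theorem pair_b : Complex.I * pairBC q a (actC q a (U q 0 1) g) = Complex.I := by
  have hK : pairK q (U q 0 1) = 0 := by simp [pairK, torusChar_U, qUnit]
  rw [pairBC_actC, h.counit, h.pair, pairB_U, hK]
  simp

/-- By the two relations the matrix (U_ij g) is αg · 1 + βg · N with N = (0, 1; -1, i(x - x⁻¹)). Its
comultiplication is that of a matrix coalgebra, so αg + μ βg is grouplike when μ is an eigenvalue of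
N. The eigenvalues are -i x⁻¹, used here, and i x, used in `down`. -/
theorem up : IsWeightGroupLike q a (n + 1)
    (actC q a (U q 0 0) g - (Complex.I * (wt q a n)⁻¹) • actC q a (U q 0 1) g) where
  counit := by
    rw [map_sub, map_smul, counit_actC, counit_actC, h.counit, counit_U, counit_U]
    simp
  comul := by
    rw [map_sub, map_smul, h.comul_U_act, h.comul_U_act, h.offdiag, h.diag]
    simp only [TensorProduct.tmul_sub, TensorProduct.sub_tmul, TensorProduct.tmul_smul,
      ← TensorProduct.smul_tmul', TensorProduct.tmul_neg]
    have := wt_ne_zero q a n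
    match_scalars <;> field_simp <;> simp [Complex.I_sq]
    ring
  dag := by
    have h1 : dagC q a (actC q a (U q 0 1) g) = -actC q a (U q 0 1) g := by
      rw [dagC_actC, h.dag, dagA_U, h.offdiag]
    rw [map_sub, map_smulₛₗ, h1, dagC_actC, h.dag, dagA_U]
    simp [conj_wt]
  pair := by
    rw [map_sub, map_smul, smul_eq_mul, mul_sub, h.pair_a, mul_left_comm, h.pair_b, qNum_wt,
      qNum_wt, wt_add_one]
    have := wt_ne_zero q a n
    have := cq_ne_zero q
    have := cq_sq_sub_one_ne_zero q
    field_simp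
    simp [Complex.I_sq]
    ring
  offdiag := by
    rw [map_sub, map_smul, map_sub, map_smul, h.act_ca, h.act_cb]
    module
  diag := by
    simp only [map_sub, map_smul, h.act_da, h.act_db, h.act_aa, h.act_ab]
    have := wt_ne_zero q a n
    have := cq_ne_zero q
    rw [wt_add_one]
    match_scalars <;> field_simp <;> ring_nf <;> simp [Complex.I_sq]

theorem down : IsWeightGroupLike q a (n - 1)
    (actC q a (U q 0 0) g + (Complex.I * wt q a n) • actC q a (U q 0 1) g) where
  counit := by
    rw [map_add, map_smul, counit_actC, counit_actC, h.counit, counit_U, counit_U]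
    simp
  comul := by
    rw [map_add, map_smul, h.comul_U_act, h.comul_U_act, h.offdiag, h.diag]
    simp only [TensorProduct.tmul_sub, TensorProduct.tmul_add, TensorProduct.add_tmul,
      TensorProduct.tmul_smul, ← TensorProduct.smul_tmul', TensorProduct.tmul_neg]
    have := wt_ne_zero q a n
    match_scalars <;> field_simp <;> ring_nf <;> simp [Complex.I_sq]
  dag := by
    have h1 : dagC q a (actC q a (U q 0 1) g) = -actC q a (U q 0 1) g := by
      rw [dagC_actC, h.dag, dagA_U, h.offdiag]
    rw [map_add, map_smulₛₗ, h1, dagC_actC, h.dag, dagA_U]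
    simp [conj_wt]
  pair := by
    rw [map_add, map_smul, smul_eq_mul, mul_add, h.pair_a, mul_left_comm, h.pair_b, qNum_wt,
      qNum_wt, wt_sub_one]
    have := wt_ne_zero q a n
    have := cq_ne_zero q
    have := cq_sq_sub_one_ne_zero q
    field_simp
    simp [Complex.I_sq]
    ring
  offdiag := by
    rw [map_add, map_smul, map_add, map_smul, h.act_ca, h.act_cb]
    module
  diag := by
    simp only [map_add, map_smul, h.act_da, h.act_db, h.act_aa, h.act_ab]
    have := wt_ne_zero q a n
    have := cq_ne_zero q
    rw [wt_sub_one]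
    match_scalars <;> field_simp <;> ring_nf <;> simp [Complex.I_sq]

/-- Stepping up and down are mutually inverse. At this stage nothing says that a weight has only one
grouplike element, so this is needed for a single sequence to satisfy both step formulas. -/
theorem down_up : actC q a (U q 0 0) (actC q a (U q 0 0) g -
      (Complex.I * (wt q a n)⁻¹) • actC q a (U q 0 1) g) +
    (Complex.I * wt q a (n + 1)) • actC q a (U q 0 1) (actC q a (U q 0 0) g -
      (Complex.I * (wt q a n)⁻¹) • actC q a (U q 0 1) g) = g := by
  simp only [map_sub, map_smul, h.act_aa, h.act_ab]
  have := wt_ne_zero q a n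
  have := cq_ne_zero q
  rw [wt_add_one]
  match_scalars <;> field_simp <;> ring_nf <;> simp [Complex.I_sq]

theorem up_down : actC q a (U q 0 0) (actC q a (U q 0 0) g +
      (Complex.I * wt q a n) • actC q a (U q 0 1) g) -
    (Complex.I * (wt q a (n - 1))⁻¹) • actC q a (U q 0 1) (actC q a (U q 0 0) g +
      (Complex.I * wt q a n) • actC q a (U q 0 1) g) = g := by
  simp only [map_add, map_smul, h.act_aa, h.act_ab]
  have := wt_ne_zero q a n
  have := cq_ne_zero q
  rw [wt_sub_one]
  match_scalars <;> field_simp <;> ring_nf <;> simp [Complex.I_sq]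

end IsWeightGroupLike

end GroupLike

/-! ### The grouplike basis of C, its simple subcoalgebras and the restricted dual. -/

section WeightBasis

variable (q : ℝ) [hq : Fact (q ∈ Set.Ioo (0 : ℝ) 1)] (a : ℝ)

theorem exists_weightGroupLike : ∃ g : ℤ → OqSO2 q a, g 0 = projC q a 1 ∧
    ∀ n, IsWeightGroupLike q a n (g n) ∧
      (g (n + 1) = actC q a (U q 0 0) (g n) -
        (Complex.I * (wt q a n)⁻¹) • actC q a (U q 0 1) (g n) ∧
      g n = actC q a (U q 0 0) (g (n + 1)) +
        (Complex.I * wt q a (n + 1)) • actC q a (U q 0 1) (g (n + 1))) := by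
  refine Int.exists_bi_seq (IsWeightGroupLike q a) (fun n x y => y = actC q a (U q 0 0) x -
        (Complex.I * (wt q a n)⁻¹) • actC q a (U q 0 1) x ∧
      x = actC q a (U q 0 0) y + (Complex.I * wt q a (n + 1)) • actC q a (U q 0 1) y)
    _ (isWeightGroupLike_one q a) (fun n x h => ⟨_, h.up, rfl, h.down_up.symm⟩) (fun n y h => ?_)
  have h1 := h.down
  have h2 := h.up_down
  rw [add_sub_cancel_right] at h1 h2
  exact ⟨_, h1, h2.symm, rfl⟩

/-- The grouplike element of `C` on which `i B_t` takes the value `[a + n]`. -/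
def glike (n : ℤ) : OqSO2 q a := (exists_weightGroupLike q a).choose n

theorem glike_zero : glike q a 0 = projC q a 1 := (exists_weightGroupLike q a).choose_spec.1

theorem glike_spec (n : ℤ) : IsWeightGroupLike q a n (glike q a n) :=
  ((exists_weightGroupLike q a).choose_spec.2 n).1

theorem glike_succ (n : ℤ) : glike q a (n + 1) = actC q a (U q 0 0) (glike q a n) -
    (Complex.I * (wt q a n)⁻¹) • actC q a (U q 0 1) (glike q a n) :=
  ((exists_weightGroupLike q a).choose_spec.2 n).2.1

theorem glike_pred (n : ℤ) : glike q a (n - 1) = actC q a (U q 0 0) (glike q a n) +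
    (Complex.I * wt q a n) • actC q a (U q 0 1) (glike q a n) := by
  have := ((exists_weightGroupLike q a).choose_spec.2 (n - 1)).2.2
  rw [sub_add_cancel] at this
  exact this

/-- The coefficient of the upward shift in the action of `U` on the grouplike elements. -/
def upU (x : ℂ) : Matrix (Fin 2) (Fin 2) ℂ :=
  !![x / (x + x⁻¹), Complex.I / (x + x⁻¹); -Complex.I / (x + x⁻¹), x⁻¹ / (x + x⁻¹)]

/-- The coefficient of the downward shift in the action of `U` on the grouplike elements. -/
def downU (x : ℂ) : Matrix (Fin 2) (Fin 2) ℂ :=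
  !![x⁻¹ / (x + x⁻¹), -Complex.I / (x + x⁻¹); Complex.I / (x + x⁻¹), x / (x + x⁻¹)]

/-- Solving the two step formulas for αg_n and βg_n: the two eigenvalues differ by i(x + x⁻¹), which
is nonzero because x > 0. -/
theorem actC_U_glike (i j : Fin 2) (n : ℤ) : actC q a (U q i j) (glike q a n) =
    upU (wt q a n) i j • glike q a (n + 1) + downU (wt q a n) i j • glike q a (n - 1) := by
  have h1 := wt_ne_zero q a n
  have h2 := wt_add_inv_ne_zero q a n
  have hx : wt q a n ^ 2 + 1 ≠ 0 := by
    intro h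
    apply h2
    rw [show wt q a n + (wt q a n)⁻¹ = (wt q a n ^ 2 + 1) / wt q a n by field_simp, h, zero_div]
  have h := glike_spec q a n
  rw [glike_succ, glike_pred]
  fin_cases i <;> fin_cases j <;>
    simp only [upU, downU, Fin.zero_eta, Fin.mk_one, Matrix.of_apply, Matrix.cons_val',
      Matrix.cons_val_zero, Matrix.cons_val_one, Matrix.cons_val_fin_one, h.offdiag, h.diag] <;>
    match_scalars <;> field_simp <;> ring_nf <;> simp [Complex.I_sq] <;> ring

theorem glike_injective : Function.Injective (glike q a) := by
  intro n m h
  apply qNum_wt_injective q a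
  beta_reduce
  rw [← (glike_spec q a n).pair, ← (glike_spec q a m).pair, h]

theorem isGroupLikeElem_glike (n : ℤ) : IsGroupLikeElem ℂ (glike q a n) :=
  ⟨(glike_spec q a n).counit, (glike_spec q a n).comul⟩

/-- As a left A-module C is generated by g_0 = π_C(1), and the entries of U preserve the span. -/
theorem span_glike : ⊤ ≤ Submodule.span ℂ (Set.range (glike q a)) := by
  set N := Submodule.span ℂ (Set.range (glike q a)) with hN
  have hg : ∀ n, glike q a n ∈ N := fun n => Submodule.subset_span ⟨n, rfl⟩
  have key : ∀ x : OqSU2 q, ∀ c ∈ N, actC q a x c ∈ N := by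
    intro x
    induction x using OqSU2.induction with
    | hU i j =>
      intro c hc
      induction hc using Submodule.span_induction with
      | mem c hc =>
        obtain ⟨n, rfl⟩ := hc
        rw [actC_U_glike]
        exact add_mem (N.smul_mem _ (hg _)) (N.smul_mem _ (hg _))
      | zero => simp
      | add c d _ _ hc hd => rw [map_add]; exact add_mem hc hd
      | smul r c _ hc => rw [map_smul]; exact N.smul_mem _ hc
    | hs r =>
      intro c hc
      rw [Algebra.algebraMap_eq_smul_one, map_smul, actC_one]
      exact N.smul_mem _ hc
    | ha x y hx hy => intro c hc; rw [map_add]; exact add_mem (hx c hc) (hy c hc)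
    | hm x y hx hy => intro c hc; rw [actC_mul_apply]; exact hx _ (hy c hc)
  intro c _
  obtain ⟨y, rfl⟩ := Submodule.mkQ_surjective _ c
  have := key y _ (hg 0)
  rw [glike_zero, actC_projC, mul_one] at this
  exact this

/-- The basis of `C` consisting of the grouplike elements. -/
def glikeBasis : Module.Basis ℤ ℂ (OqSO2 q a) :=
  Module.Basis.mk (v := glike q a)
    ((linearIndepOn_isGroupLikeElem (R := ℂ) (A := OqSO2 q a)).comp
      (fun n => ⟨glike q a n, isGroupLikeElem_glike q a n⟩)
      (fun _ _ h => glike_injective q a (congrArg Subtype.val h)))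
    (span_glike q a)

@[simp] theorem glikeBasis_apply (n : ℤ) : glikeBasis q a n = glike q a n := by
  simp [glikeBasis]

/-- The functional on `C` dual to a grouplike element; this is the minimal projection `p_[a + n]`. -/
def wproj (n : ℤ) : OqSO2 q a →ₗ[ℂ] ℂ := (glikeBasis q a).coord n

theorem wproj_glike (n m : ℤ) : wproj q a n (glike q a m) = if m = n then 1 else 0 := by
  rw [wproj, ← glikeBasis_apply, Module.Basis.coord_apply, Module.Basis.repr_self,
    Finsupp.single_apply]

theorem dual_ext {M : Type*} [AddCommGroup M] [Module ℂ M] {ω χ : OqSO2 q a →ₗ[ℂ] M}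
    (h : ∀ n, ω (glike q a n) = χ (glike q a n)) : ω = χ :=
  (glikeBasis q a).ext fun n => by rw [glikeBasis_apply, h]

theorem convMul_glike (ω χ : OqSO2 q a →ₗ[ℂ] ℂ) (n : ℤ) :
    convMul ω χ (glike q a n) = ω (glike q a n) * χ (glike q a n) := by
  simp [convMul, (glike_spec q a n).comul]

/-- Slicing the comultiplication isolates one grouplike component. Applied inside a subcoalgebra D,
it puts into D every g_n that occurs in an element of D; applied to a grouplike element, it shows
that this element is some g_n. -/
theorem slice_comul (n : ℤ) (c : OqSO2 q a) :
    TensorProduct.lid ℂ (OqSO2 q a) ((wproj q a n).rTensor _ (comul c)) =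
      wproj q a n c • glike q a n := by
  have : (TensorProduct.lid ℂ (OqSO2 q a)).toLinearMap ∘ₗ (wproj q a n).rTensor _ ∘ₗ comul =
      (wproj q a n).smulRight (glike q a n) := by
    refine dual_ext q a fun m => ?_
    simp only [LinearMap.comp_apply, (glike_spec q a m).comul, LinearMap.rTensor_tmul,
      LinearEquiv.coe_coe, TensorProduct.lid_tmul, LinearMap.smulRight_apply, wproj_glike]
    split_ifs with h
    · rw [h]
    · simp
  exact LinearMap.congr_fun this c

theorem glike_mem_of_isSubcoalgebra {D : Submodule ℂ (OqSO2 q a)} (hD : IsSubcoalgebra D)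
    {d : OqSO2 q a} (hd : d ∈ D) {n : ℤ} (hn : wproj q a n d ≠ 0) : glike q a n ∈ D := by
  obtain ⟨T, hT⟩ := hD d hd
  have h : ∀ T : D ⊗[ℂ] D, TensorProduct.lid ℂ (OqSO2 q a)
      ((wproj q a n).rTensor _ (TensorProduct.map D.subtype D.subtype T)) ∈ D := by
    intro T
    induction T with
    | zero => simp
    | add S T hS hT => rw [map_add, map_add, map_add]; exact add_mem hS hT
    | tmul x y => simpa using D.smul_mem _ y.2
  have := h T
  rw [hT, slice_comul] at this
  exact (D.smul_mem_iff hn).1 this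

theorem exists_wproj_ne_zero {d : OqSO2 q a} (hd : d ≠ 0) : ∃ n, wproj q a n d ≠ 0 := by
  by_contra! h
  exact hd ((glikeBasis q a).ext_elem fun n => by simpa [wproj] using h n)

theorem isSubcoalgebra_span_glike (n : ℤ) : IsSubcoalgebra (ℂ ∙ glike q a n) := by
  intro d hd
  obtain ⟨r, rfl⟩ := Submodule.mem_span_singleton.1 hd
  rw [map_smul, (glike_spec q a n).comul]
  exact Submodule.smul_mem _ _
    ⟨⟨_, Submodule.mem_span_singleton_self _⟩ ⊗ₜ ⟨_, Submodule.mem_span_singleton_self _⟩, rfl⟩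

theorem isSimpleSubcoalgebra_iff (D : Submodule ℂ (OqSO2 q a)) :
    IsSimpleSubcoalgebra D ↔ ∃ n, D = ℂ ∙ glike q a n := by
  constructor
  · rintro ⟨h1, h2, h3⟩
    obtain ⟨d, hd, h0⟩ := (Submodule.ne_bot_iff _).1 h2
    obtain ⟨n, hn⟩ := exists_wproj_ne_zero q a h0
    have hg := glike_mem_of_isSubcoalgebra q a h1 hd hn
    refine ⟨n, ?_⟩
    rcases h3 _ (by simpa using hg) (isSubcoalgebra_span_glike q a n) with h | h
    · rw [Submodule.span_singleton_eq_bot] at h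
      exact absurd h (isGroupLikeElem_glike q a n).ne_zero
    · exact h.symm
  · rintro ⟨n, rfl⟩
    have h0 := (isGroupLikeElem_glike q a n).ne_zero
    refine ⟨isSubcoalgebra_span_glike q a n, by simpa using h0, fun D' hD' hs => ?_⟩
    rw [or_iff_not_imp_left]
    intro hne
    refine le_antisymm hD' ?_
    obtain ⟨d, hd, h1⟩ := (Submodule.ne_bot_iff _).1 hne
    obtain ⟨r, rfl⟩ := Submodule.mem_span_singleton.1 (hD' hd)
    rw [Submodule.span_singleton_le_iff_mem]
    exact (D'.smul_mem_iff (by rintro rfl; simp at h1)).1 hd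

/-- The simple subcoalgebras are the distinct lines ℂ g_n, so a functional is nonzero on such a line
exactly when it is nonzero at g_n. -/
theorem mem_restrictedDual_iff (ω : OqSO2 q a →ₗ[ℂ] ℂ) :
    ω ∈ restrictedDual q a ↔ {n | ω (glike q a n) ≠ 0}.Finite := by
  have hinj : Function.Injective fun n => (ℂ ∙ glike q a n : Submodule ℂ (OqSO2 q a)) := by
    intro n m h
    have h1 : glike q a n ∈ (ℂ ∙ glike q a m : Submodule ℂ (OqSO2 q a)) := by
      beta_reduce at h
      rw [← h]
      exact Submodule.mem_span_singleton_self _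
    obtain ⟨r, hr⟩ := Submodule.mem_span_singleton.1 h1
    have h2 := congrArg (wproj q a n) hr
    rw [map_smul, wproj_glike, wproj_glike] at h2
    by_contra hne
    simp [Ne.symm hne] at h2
  have : {D : Submodule ℂ (OqSO2 q a) | IsSimpleSubcoalgebra D ∧ ∃ d ∈ D, ω d ≠ 0} =
      (fun n => (ℂ ∙ glike q a n : Submodule ℂ (OqSO2 q a))) '' {n | ω (glike q a n) ≠ 0} := by
    ext D
    constructor
    · rintro ⟨hD, d, hd, h⟩
      obtain ⟨n, rfl⟩ := (isSimpleSubcoalgebra_iff q a D).1 hD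
      obtain ⟨r, rfl⟩ := Submodule.mem_span_singleton.1 hd
      refine ⟨n, fun h1 => h ?_, rfl⟩
      rw [map_smul, h1, smul_zero]
    · rintro ⟨n, hn, rfl⟩
      exact ⟨(isSimpleSubcoalgebra_iff q a _).2 ⟨n, rfl⟩, _, Submodule.mem_span_singleton_self _, hn⟩
  change Set.Finite {D : Submodule ℂ (OqSO2 q a) | _} ↔ _
  rw [this, Set.finite_image_iff hinj.injOn]

theorem wproj_mem (n : ℤ) : wproj q a n ∈ restrictedDual q a := by
  rw [mem_restrictedDual_iff]
  refine (Set.finite_singleton n).subset fun m hm => ?_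
  by_contra h
  exact hm (by rw [wproj_glike, if_neg (by simpa using h)])

theorem eq_glike_of_isGroupLikeElem {g : OqSO2 q a} (hg : IsGroupLikeElem ℂ g) :
    ∃ n, g = glike q a n := by
  obtain ⟨n, hn⟩ := exists_wproj_ne_zero q a hg.ne_zero
  have h := slice_comul q a n g
  rw [hg.comul_eq_tmul_self, LinearMap.rTensor_tmul, TensorProduct.lid_tmul] at h
  exact ⟨n, smul_right_injective _ hn h⟩

/-- Every grouplike element is some g_m and its weight determines m, so the inner sum in `psiT` has
the single index g_n. -/
theorem psiT_eq (ω : OqSO2 q a →ₗ[ℂ] ℂ) :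
    psiT q a ω = ∑ᶠ n : ℤ, (qSum q (a + n) : ℂ) * ω (glike q a n) := by
  refine finsum_congr fun n => ?_
  have hg : ∀ g : {g : OqSO2 q a // IsGroupLikeElem ℂ g ∧
      Complex.I * pairBC q a g = (qNum q (a + n) : ℂ)},
      g = ⟨glike q a n, isGroupLikeElem_glike q a n, (glike_spec q a n).pair⟩ := by
    rintro ⟨g, h1, h2⟩
    obtain ⟨m, rfl⟩ := eq_glike_of_isGroupLikeElem q a h1
    rw [(glike_spec q a m).pair] at h2
    have := qNum_wt_injective q a h2
    subst this
    rfl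
  have : Unique {g : OqSO2 q a // IsGroupLikeElem ℂ g ∧
      Complex.I * pairBC q a g = (qNum q (a + n) : ℂ)} := ⟨⟨_⟩, hg⟩
  rw [finsum_unique, hg default]

end WeightBasis

/-! ### Relations among the entries of E_t, and how they shift grouplike elements. -/

section PodlesRelations

variable (q : ℝ) [hq : Fact (q ∈ Set.Ioo (0 : ℝ) 1)] (a : ℝ)

/-- The quantum trace q² E_00 + E_11 is unchanged by conjugation with U, hence equals q² L_00 + L_11
= -t. -/
theorem podlesE_trace : podlesE q a 1 1 =
    -(qDiff q a : ℂ) • (1 : OqSU2 q) - (q : ℂ) ^ 2 • podlesE q a 0 0 := by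
  have h := U_rels q
  have h1 : U q 0 0 * U q 1 1 = 1 + (q : ℂ) • (U q 0 1 * U q 1 0) := sub_eq_iff_eq_add.1 h.ad
  have hq' := cq_ne_zero q
  rw [podlesE_eq, podlesE_eq]
  simp only [adjMat, podlesL, Fin.zero_eta, Fin.mk_one, Matrix.of_apply, Matrix.cons_val',
    Matrix.cons_val_zero, Matrix.cons_val_one, Matrix.cons_val_fin_one, neg_mul, smul_mul_assoc,
    h1, h.cd, h.ab]
  match_scalars <;> field_simp <;> ring

/-- The scalar matrix L has trace -t and determinant -1, so L² = 1 - tL; conjugation by the unitary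
U carries this over to E_t. -/
theorem podlesE_mul_self : podlesE q a * podlesE q a =
    1 - (qDiff q a : ℂ) • podlesE q a := by
  have hUV := ((SUqRels.iff_mul hq.out.1.ne' _).1 (U_rels q))
  have hL : (podlesL q a).map (algebraMap ℂ (OqSU2 q)) * (podlesL q a).map (algebraMap ℂ (OqSU2 q))
      = 1 - (qDiff q a : ℂ) • (podlesL q a).map (algebraMap ℂ (OqSU2 q)) := by
    have : podlesL q a * podlesL q a = 1 - (qDiff q a : ℂ) • podlesL q a := by
      ext i j
      fin_cases i <;> fin_cases j <;> simp [podlesL, Matrix.mul_apply, Fin.sum_univ_two]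
      ring
    rw [← Matrix.map_mul, this]
    ext i j
    rw [Matrix.sub_apply, Matrix.smul_apply, Matrix.map_apply, Matrix.map_apply, Matrix.sub_apply,
      map_sub, Matrix.smul_apply, smul_eq_mul, map_mul, ← Algebra.smul_def, Matrix.one_apply,
      Matrix.one_apply]
    split_ifs <;> simp
  rw [podlesE, conjTranspose_U]
  calc _ = adjMat q (U q) * ((podlesL q a).map (algebraMap ℂ (OqSU2 q)) *
        (U q * adjMat q (U q)) * (podlesL q a).map (algebraMap ℂ (OqSU2 q))) * U q := by
        simp only [Matrix.mul_assoc]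
    _ = _ := by
        rw [hUV.1, Matrix.mul_one, hL, Matrix.mul_sub, Matrix.mul_one, Matrix.sub_mul, hUV.2,
          Matrix.mul_smul, Matrix.smul_mul]

/-- The entries of `E_t` as elements of the Podleś sphere. -/
def podlesGen (i j : Fin 2) : Podles q a := ⟨podlesE q a i j, podlesE_mem q a i j⟩

theorem podlesGen_trace : podlesGen q a 1 1 =
    -(qDiff q a : ℂ) • (1 : Podles q a) - (q : ℂ) ^ 2 • podlesGen q a 0 0 :=
  Subtype.ext (podlesE_trace q a)

theorem podlesGen_mul_self (i j : Fin 2) :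
    podlesGen q a i 0 * podlesGen q a 0 j + podlesGen q a i 1 * podlesGen q a 1 j =
      (1 : Matrix (Fin 2) (Fin 2) ℂ) i j • (1 : Podles q a) - (qDiff q a : ℂ) • podlesGen q a i j := by
  have h := congrFun (congrFun (podlesE_mul_self q a) i) j
  rw [Matrix.mul_apply, Fin.sum_univ_two, Matrix.sub_apply, Matrix.smul_apply] at h
  apply Subtype.ext
  refine Eq.trans h (congrArg (· - _) ?_)
  rw [Matrix.one_apply, Matrix.one_apply]
  split_ifs
  · exact (one_smul ℂ (1 : OqSU2 q)).symm
  · exact (zero_smul ℂ (1 : OqSU2 q)).symm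

theorem star_podlesGen (i j : Fin 2) : star (podlesGen q a i j) = podlesGen q a j i :=
  Subtype.ext (star_podlesE q a i j)

theorem podlesX_eq : podlesX q a = podlesGen q a 1 0 := rfl

theorem podlesY_eq : podlesY q a = podlesGen q a 0 1 := rfl

theorem podlesZ_eq : podlesZ q a = (q : ℂ) • podlesGen q a 0 0 := rfl

theorem Podles.induction_on {P : Podles q a → Prop} (hE : ∀ i j, P (podlesGen q a i j))
    (hs : ∀ c : ℂ, P (algebraMap ℂ _ c)) (ha : ∀ x y, P x → P y → P (x + y))
    (hm : ∀ x y, P x → P y → P (x * y)) (b : Podles q a) : P b := by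
  obtain ⟨x, hx⟩ := b
  have key : ∀ x ∈ Podles q a, ∃ hx : x ∈ Podles q a, P ⟨x, hx⟩ := by
    refine Podles.induction q a (P := fun x => ∃ hx : x ∈ Podles q a, P ⟨x, hx⟩)
      (fun i j => ⟨_, hE i j⟩) (fun c => ⟨_, hs c⟩) ?_ ?_
    · rintro x y ⟨_, h1⟩ ⟨_, h2⟩
      exact ⟨_, ha _ _ h1 h2⟩
    · rintro x y ⟨_, h1⟩ ⟨_, h2⟩
      exact ⟨_, hm _ _ h1 h2⟩
  exact (key x hx).2

theorem podlesCoact_podlesGen (i j : Fin 2) : podlesCoact q a (podlesGen q a i j) =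
    ∑ k, ∑ l, podlesGen q a k l ⊗ₜ[ℂ] (adjMat q (U q) i k * U q l j) := by
  apply podlesIncl_injective q a
  rw [podlesIncl_podlesCoact]
  refine (comul_podlesE q a i j).trans ?_
  simp only [map_sum]
  rfl

/-- The coefficient of the upward shift in the action of `U*` on the grouplike elements. -/
def upUstar (x : ℂ) : Matrix (Fin 2) (Fin 2) ℂ :=
  !![x⁻¹ / (x + x⁻¹), -((q : ℂ)⁻¹ * Complex.I) / (x + x⁻¹);
    (q * Complex.I) / (x + x⁻¹), x / (x + x⁻¹)]

/-- The coefficient of the downward shift in the action of `U*` on the grouplike elements. -/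
def downUstar (x : ℂ) : Matrix (Fin 2) (Fin 2) ℂ :=
  !![x / (x + x⁻¹), ((q : ℂ)⁻¹ * Complex.I) / (x + x⁻¹);
    -(q * Complex.I) / (x + x⁻¹), x⁻¹ / (x + x⁻¹)]

theorem actC_adjMat_glike (i j : Fin 2) (n : ℤ) : actC q a (adjMat q (U q) i j) (glike q a n) =
    upUstar q (wt q a n) i j • glike q a (n + 1) +
      downUstar q (wt q a n) i j • glike q a (n - 1) := by
  fin_cases i <;> fin_cases j <;>
    simp only [adjMat, Fin.zero_eta, Fin.mk_one, Matrix.of_apply, Matrix.cons_val',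
      Matrix.cons_val_zero, Matrix.cons_val_one, Matrix.cons_val_fin_one, map_neg, map_smul,
      LinearMap.neg_apply, LinearMap.smul_apply, actC_U_glike, upU, downU, upUstar, downUstar] <;>
    match_scalars <;> ring

/-- The coefficient of the upward shift in the action of `S⁻¹(U)` on the grouplike elements. -/
def upUinv (x : ℂ) : Matrix (Fin 2) (Fin 2) ℂ :=
  !![x⁻¹ / (x + x⁻¹), -(q * Complex.I) / (x + x⁻¹);
    ((q : ℂ)⁻¹ * Complex.I) / (x + x⁻¹), x / (x + x⁻¹)]

/-- The coefficient of the downward shift in the action of `S⁻¹(U)` on the grouplike elements. -/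
def downUinv (x : ℂ) : Matrix (Fin 2) (Fin 2) ℂ :=
  !![x / (x + x⁻¹), (q * Complex.I) / (x + x⁻¹);
    -((q : ℂ)⁻¹ * Complex.I) / (x + x⁻¹), x⁻¹ / (x + x⁻¹)]

theorem actC_antipodeInv_glike (i j : Fin 2) (n : ℤ) :
    actC q a (antipodeInv q (U q i j)) (glike q a n) =
      upUinv q (wt q a n) i j • glike q a (n + 1) +
        downUinv q (wt q a n) i j • glike q a (n - 1) := by
  rw [antipodeInv_U]
  fin_cases i <;> fin_cases j <;>
    simp only [antipodeInvMat, Fin.zero_eta, Fin.mk_one, Matrix.of_apply, Matrix.cons_val',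
      Matrix.cons_val_zero, Matrix.cons_val_one, Matrix.cons_val_fin_one, map_neg, map_smul,
      LinearMap.neg_apply, LinearMap.smul_apply, actC_U_glike, upU, downU, upUinv, downUinv] <;>
    match_scalars <;> ring

/-- Entries of U and of U* each move one step, so a product moves by 2, 0 or -2. The middle case is
reached along two paths, which gives its two summands. -/
theorem wproj_actC_shift (i k l j : Fin 2) (n m : ℤ) :
    wproj q a m (actC q a (adjMat q (U q) i k * U q l j) (glike q a n)) =
      (if m = n + 2 then upUstar q (wt q a (n + 1)) i k * upU (wt q a n) l j else 0) +
      (if m = n then downUstar q (wt q a (n + 1)) i k * upU (wt q a n) l j +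
        upUstar q (wt q a (n - 1)) i k * downU (wt q a n) l j else 0) +
      (if m = n - 2 then downUstar q (wt q a (n - 1)) i k * downU (wt q a n) l j else 0) := by
  rw [actC_mul_apply, actC_U_glike]
  simp only [map_add, map_smul, actC_adjMat_glike, wproj_glike, smul_eq_mul]
  rw [show n + 1 + 1 = n + 2 by ring, show n + 1 - 1 = n by ring, show n - 1 + 1 = n by ring,
    show n - 1 - 1 = n - 2 by ring]
  simp only [@eq_comm ℤ _ m]
  split_ifs <;> ring

end PodlesRelations

/-! ### Weight decomposition of a unitary representation. -/

namespace UnitaryDKRep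

variable {q : ℝ} [hq : Fact (q ∈ Set.Ioo (0 : ℝ) 1)] {a : ℝ}
variable {V : Type*} [AddCommGroup V] [Module ℂ V] (R : UnitaryDKRep q a V)

/-- The weight vectors of weight `[a + n]`. -/
def IsWt (n : ℤ) (v : V) : Prop := R.coact v = v ⊗ₜ glike q a n

/-- The projection onto the weight space of weight `[a + n]`. -/
def wp (n : ℤ) : Module.End ℂ V := R.actDual (wproj q a n)

theorem actDual_apply (ω : OqSO2 q a →ₗ[ℂ] ℂ) (v : V) :
    R.actDual ω v = TensorProduct.rid ℂ V (ω.lTensor V (R.coact v)) := rfl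

variable {R} in
theorem IsWt.actDual {n : ℤ} {v : V} (h : R.IsWt n v) (ω : OqSO2 q a →ₗ[ℂ] ℂ) :
    R.actDual ω v = ω (glike q a n) • v := by
  rw [actDual_apply, h]
  simp

variable {R} in
theorem IsWt.wp {n : ℤ} {v : V} (h : R.IsWt n v) (m : ℤ) :
    R.wp m v = if m = n then v else 0 := by
  rw [UnitaryDKRep.wp, h.actDual, wproj_glike]
  simp only [@eq_comm ℤ n]
  split_ifs <;> simp

variable {R} in
theorem IsWt.opIB {n : ℤ} {v : V} (h : R.IsWt n v) :
    R.opIB v = (qNum q (a + n) : ℂ) • v := by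
  rw [UnitaryDKRep.opIB, LinearMap.smul_apply, h.actDual, smul_smul, (glike_spec q a n).pair]

variable {R} in
theorem IsWt.add {n : ℤ} {v w : V} (h : R.IsWt n v) (h' : R.IsWt n w) : R.IsWt n (v + w) := by
  rw [IsWt, map_add, h, h', TensorProduct.add_tmul]

variable {R} in
theorem IsWt.smul {n : ℤ} {v : V} (h : R.IsWt n v) (c : ℂ) : R.IsWt n (c • v) := by
  rw [IsWt, map_smul, h, TensorProduct.smul_tmul']

/-- Coassociativity with the last leg sliced by p_n: on one side this is the coaction on `R.wp n v`,
on the other the slice of Δ leaves only multiples of g_n. -/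
theorem isWt_wp (n : ℤ) (v : V) : R.IsWt n (R.wp n v) := by
  have h := LinearMap.congr_fun R.coassoc v
  simp only [LinearMap.comp_apply] at h
  generalize hT : R.coact v = T at h
  have h2 := congrArg (TensorProduct.map LinearMap.id
    ((TensorProduct.rid ℂ _).toLinearMap ∘ₗ (wproj q a n).lTensor (OqSO2 q a))) h
  have e1 : ∀ T : V ⊗[ℂ] OqSO2 q a, TensorProduct.map LinearMap.id
      ((TensorProduct.rid ℂ _).toLinearMap ∘ₗ (wproj q a n).lTensor (OqSO2 q a))
      ((TensorProduct.assoc ℂ V (OqSO2 q a) (OqSO2 q a)).toLinearMap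
        (R.coact.rTensor (OqSO2 q a) T)) =
      R.coact (TensorProduct.rid ℂ V ((wproj q a n).lTensor V T)) := by
    intro T
    induction T with
    | zero => simp
    | add S T hS hT => simp only [map_add, hS, hT]
    | tmul v c =>
      rw [LinearMap.rTensor_tmul]
      simp only [LinearMap.lTensor_tmul, TensorProduct.rid_tmul, map_smul]
      generalize R.coact v = S
      induction S with
      | zero => simp
      | add S T hS hT => simp only [TensorProduct.add_tmul, map_add, hS, hT, smul_add]
      | tmul v d => simp
  have e2 : ∀ T : V ⊗[ℂ] OqSO2 q a, TensorProduct.map LinearMap.id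
      ((TensorProduct.rid ℂ _).toLinearMap ∘ₗ (wproj q a n).lTensor (OqSO2 q a))
      ((comul (R := ℂ)).lTensor V T) =
      TensorProduct.rid ℂ V ((wproj q a n).lTensor V T) ⊗ₜ glike q a n := by
    intro T
    induction T with
    | zero => simp
    | add S T hS hT => simp only [map_add, hS, hT, TensorProduct.add_tmul]
    | tmul v c =>
      have : TensorProduct.rid ℂ (OqSO2 q a) ((wproj q a n).lTensor (OqSO2 q a) (comul c)) =
          wproj q a n c • glike q a n := by
        have : (TensorProduct.rid ℂ (OqSO2 q a)).toLinearMap ∘ₗ (wproj q a n).lTensor _ ∘ₗ comul =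
            (wproj q a n).smulRight (glike q a n) := by
          refine dual_ext q a fun m => ?_
          simp only [LinearMap.comp_apply, (glike_spec q a m).comul, LinearMap.lTensor_tmul,
            LinearEquiv.coe_coe, TensorProduct.rid_tmul, LinearMap.smulRight_apply, wproj_glike]
          split_ifs with h
          · rw [h]
          · simp
        exact LinearMap.congr_fun this c
      simp [this, TensorProduct.smul_tmul']
  rw [e1, e2, ← hT] at h2
  exact h2

/-- The weight components of a vector. -/
def comps (v : V) : ℤ →₀ V := TensorProduct.equivFinsuppOfBasisRight (glikeBasis q a) (R.coact v)

theorem comps_apply (v : V) (n : ℤ) : R.comps v n = R.wp n v := by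
  rw [comps, wp, actDual_apply]
  generalize R.coact v = T
  induction T with
  | zero => simp
  | add S T hS hT => simp only [map_add, Finsupp.add_apply, hS, hT]
  | tmul v c =>
    rw [TensorProduct.equivFinsuppOfBasisRight_apply_tmul_apply]
    simp [wproj]

theorem sum_comps (v : V) : (R.comps v).sum (fun _ u => u) = v := by
  have h := LinearMap.congr_fun R.counit_coact v
  simp only [LinearMap.comp_apply, LinearMap.id_apply] at h
  conv_rhs => rw [← h]
  rw [comps]
  generalize R.coact v = T
  induction T with
  | zero => simp
  | add S T hS hT =>
    rw [map_add, Finsupp.sum_add_index' (by simp) (by simp), hS, hT]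
    simp only [map_add]
  | tmul v c =>
    rw [TensorProduct.equivFinsuppOfBasisRight_apply_tmul,
      Finsupp.sum_mapRange_index (by simp)]
    simp only [LinearEquiv.coe_coe, LinearMap.lTensor_tmul, TensorProduct.rid_tmul]
    conv_rhs => rw [← (glikeBasis q a).linearCombination_repr c, Finsupp.linearCombination_apply]
    simp [map_finsuppSum, (glike_spec q a _).counit, Finsupp.sum, Finset.sum_smul]

theorem ext_wp {v w : V} (h : ∀ n, R.wp n v = R.wp n w) : v = w := by
  rw [← R.sum_comps v, ← R.sum_comps w]
  congr 1
  ext n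
  rw [comps_apply, comps_apply, h]

/-- The span of weight vectors is everything. -/
theorem wt_induction {P : V → Prop} (h0 : P 0) (hadd : ∀ v w, P v → P w → P (v + w))
    (hw : ∀ n v, R.IsWt n v → P v) (v : V) : P v := by
  rw [← R.sum_comps v, Finsupp.sum]
  refine Finset.sum_induction _ P hadd h0 fun n _ => hw n _ ?_
  rw [comps_apply]
  exact R.isWt_wp n v

variable {R} in
-- Unitarity of the coaction equates a multiple of g_m with a multiple of g_n† = g_n; for n ≠ m the
-- g_m-coefficient vanishes.
theorem IsWt.ip_eq_zero {n m : ℤ} {v w : V} (hv : R.IsWt n v) (hw : R.IsWt m w) (h : n ≠ m) :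
    R.ip v w = 0 := by
  have h1 := R.ip_coact v w
  rw [hv, hw] at h1
  simp only [LinearMap.rTensor_tmul, TensorProduct.lid_tmul, map_smulₛₗ,
    (glike_spec q a n).dag] at h1
  have h2 := congrArg (wproj q a m) h1
  simpa [wproj_glike, h] using h2

theorem wp_act_podlesGen {n : ℤ} {v : V} (h : R.IsWt n v) (m : ℤ) (i j : Fin 2) :
    R.wp m (R.act (podlesGen q a i j) v) =
      ∑ k, ∑ l, wproj q a m (actC q a (adjMat q (U q) i k * U q l j) (glike q a n)) •
        R.act (podlesGen q a k l) v := by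
  rw [wp, actDual_apply, R.coact_act, h, podlesCoact_podlesGen]
  simp [tensorAct]

theorem ip_act_podlesGen (i j : Fin 2) (v w : V) :
    R.ip v (R.act (podlesGen q a i j) w) = R.ip (R.act (podlesGen q a j i) v) w := by
  rw [R.ip_act, star_podlesGen]

end UnitaryDKRep

/-! ### Coefficients of the action on a weight vector. -/

section Coefficients

variable (q : ℝ) [hq : Fact (q ∈ Set.Ioo (0 : ℝ) 1)] (a : ℝ)

theorem wt_sq_add_ne_zero (k l n : ℤ) : (q : ℂ) ^ k * wt q a n ^ 2 + (q : ℂ) ^ l ≠ 0 := by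
  have h := Real.rpow_pos_of_pos hq.out.1 (a + n)
  have h1 := zpow_pos hq.out.1 k
  have h2 := zpow_pos hq.out.1 l
  have : q ^ k * (q ^ (a + n)) ^ 2 + q ^ l ≠ 0 := by positivity
  rw [wt]
  exact_mod_cast this

theorem wt_sq_add_one_ne_zero (n : ℤ) : wt q a n ^ 2 + 1 ≠ 0 := by
  simpa using wt_sq_add_ne_zero q a 0 0 n

theorem q_sq_mul_wt_sq_add_one_ne_zero (n : ℤ) : (q : ℂ) ^ 2 * wt q a n ^ 2 + 1 ≠ 0 := by
  simpa using wt_sq_add_ne_zero q a 2 0 n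

theorem q_four_mul_wt_sq_add_one_ne_zero (n : ℤ) : (q : ℂ) ^ 4 * wt q a n ^ 2 + 1 ≠ 0 := by
  simpa using wt_sq_add_ne_zero q a 4 0 n

theorem wt_sq_add_q_sq_ne_zero (n : ℤ) : wt q a n ^ 2 + (q : ℂ) ^ 2 ≠ 0 := by
  simpa using wt_sq_add_ne_zero q a 0 2 n

/-- The components of `E_t` that raise the weight `x`, relative to the one of `E_t 0 0`. -/
def gUp (x : ℂ) : Matrix (Fin 2) (Fin 2) ℂ :=
  !![1, Complex.I * x⁻¹; Complex.I * q ^ 2 * x, -(q : ℂ) ^ 2]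

/-- The components of `E_t` that lower the weight `x`, relative to the one of `E_t 0 0`. -/
def gDown (x : ℂ) : Matrix (Fin 2) (Fin 2) ℂ :=
  !![1, -(Complex.I * x); -(Complex.I * q ^ 2 * x⁻¹), -(q : ℂ) ^ 2]

/-- The component of `E_t` that preserves the weight `x` has two summands of rank one; this is the
coefficient of the first one where the Casimir value is `lam`. -/
def gZeroL (t lam x : ℂ) : ℂ :=
  -((q : ℂ)⁻¹ * t + x⁻¹ * lam) / ((x + x⁻¹) * ((q : ℂ)⁻¹ * x + q * x⁻¹))

/-- The coefficient of the second summand of rank one. -/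
def gZeroR (t lam x : ℂ) : ℂ :=
  (x * lam - (q : ℂ)⁻¹ * t) / ((x + x⁻¹) * (q * x + (q : ℂ)⁻¹ * x⁻¹))

/-- The component of `E_t` that preserves the weight `x`. -/
def gZero (t lam x : ℂ) : Matrix (Fin 2) (Fin 2) ℂ :=
  !![gZeroL q t lam x + gZeroR q t lam x,
      Complex.I * (x⁻¹ * gZeroR q t lam x - x * gZeroL q t lam x);
    Complex.I * (x * gZeroL q t lam x - x⁻¹ * gZeroR q t lam x),
      x ^ 2 * gZeroL q t lam x + (x ^ 2)⁻¹ * gZeroR q t lam x]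

/-- The scalar by which lowering after raising acts on the weight `x`. -/
def gKappa (t lam x : ℂ) : ℂ :=
  ((1 - t * gZero q t lam x 0 0 - gZero q t lam x 0 0 ^ 2 -
      gZero q t lam x 0 1 * gZero q t lam x 1 0) -
    x⁻¹ * (-Complex.I) * (t * gZero q t lam x 0 1 + gZero q t lam x 0 0 * gZero q t lam x 0 1 +
      gZero q t lam x 0 1 * gZero q t lam x 1 1)) / ((x + x⁻¹) * (x⁻¹ + q ^ 4 * x))

end Coefficients

/-! ### Raising and lowering operators. -/

namespace UnitaryDKRep

variable {q : ℝ} [hq : Fact (q ∈ Set.Ioo (0 : ℝ) 1)] {a : ℝ}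
variable {V : Type*} [AddCommGroup V] [Module ℂ V] (R : UnitaryDKRep q a V)

/-- The raising operator on the weight space of weight `[a + n]`. -/
def raise (n : ℤ) : Module.End ℂ V := R.wp (n + 2) * R.act (podlesGen q a 0 0)

/-- The lowering operator on the weight space of weight `[a + n]`. -/
def lower (n : ℤ) : Module.End ℂ V := R.wp (n - 2) * R.act (podlesGen q a 0 0)

theorem isWt_raise (n : ℤ) (v : V) : R.IsWt (n + 2) (R.raise n v) := R.isWt_wp _ _

theorem isWt_lower (n : ℤ) (v : V) : R.IsWt (n - 2) (R.lower n v) := R.isWt_wp _ _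

theorem act_podlesGen_one_one (v : V) : R.act (podlesGen q a 1 1) v =
    -(qDiff q a : ℂ) • v - (q : ℂ) ^ 2 • R.act (podlesGen q a 0 0) v := by
  rw [podlesGen_trace, map_sub, map_smul, map_smul, map_one]
  rfl

variable {R}

theorem IsWt.casimir {n : ℤ} {v : V} (h : R.IsWt n v) : R.casimir v =
    (Complex.I * (q : ℂ)⁻¹) • R.act (podlesGen q a 1 0) v +
      (q * (wt q a n - (wt q a n)⁻¹)) • R.act (podlesGen q a 0 0) v -
      (Complex.I * (q : ℂ)) • R.act (podlesGen q a 0 1) v := by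
  have h1 := cq_sq_sub_one_ne_zero q
  rw [UnitaryDKRep.casimir, podlesX_eq, podlesY_eq, podlesZ_eq]
  simp only [LinearMap.sub_apply, LinearMap.add_apply, LinearMap.smul_apply, LinearMap.comp_apply,
    h.opIB, map_smul, qNum_wt]
  congr 2
  rw [smul_smul, smul_smul]
  congr 1
  field_simp

theorem IsWt.raise_eq {n : ℤ} {v : V} (h : R.IsWt n v) : R.raise n v =
    ∑ k, ∑ l, (upUstar q (q * wt q a n) 0 k * upU (wt q a n) l 0) •
      R.act (podlesGen q a k l) v := by
  rw [raise, Module.End.mul_apply, R.wp_act_podlesGen h]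
  simp only [wproj_actC_shift]
  rw [wt_add_one]
  have : ¬ n + 2 = n - 2 := by omega
  simp [this]

theorem IsWt.lower_eq {n : ℤ} {v : V} (h : R.IsWt n v) : R.lower n v =
    ∑ k, ∑ l, (downUstar q ((q : ℂ)⁻¹ * wt q a n) 0 k * downU (wt q a n) l 0) •
      R.act (podlesGen q a k l) v := by
  rw [lower, Module.End.mul_apply, R.wp_act_podlesGen h]
  simp only [wproj_actC_shift]
  rw [wt_sub_one]
  have : ¬ n - 2 = n + 2 := by omega
  simp [this]

/-- The action of the generators on a weight vector. -/
theorem IsWt.act_podlesGen {lam : ℂ} {n : ℤ} {v : V} (h : R.IsWt n v)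
    (hc : R.casimir v = lam • v) (i j : Fin 2) : R.act (podlesGen q a i j) v =
      gUp q (wt q a n) i j • R.raise n v + gDown q (wt q a n) i j • R.lower n v +
        gZero q (qDiff q a) lam (wt q a n) i j • v := by
  rw [h.casimir] at hc
  have hq0 := cq_ne_zero q
  have hx := wt_ne_zero q a n
  have h1 := wt_sq_add_one_ne_zero q a n
  have h2 := q_sq_mul_wt_sq_add_one_ne_zero q a n
  have h3 := wt_sq_add_q_sq_ne_zero q a n
  have h2' : wt q a n ^ 2 * (q : ℂ) ^ 2 + 1 ≠ 0 := by rwa [mul_comm]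
  have h3' : (q : ℂ) ^ 2 + wt q a n ^ 2 ≠ 0 := by rwa [add_comm]
  -- The Casimir equation eliminates E_10 v and the quantum trace eliminates E_11 v. Only E_00 v,
  -- E_01 v and v remain, and the claim becomes an identity of their coefficients, as if they were
  -- independent.
  have e10 : R.act (podlesGen q a 1 0) v = (-(Complex.I * q)) • (lam • v -
      (q * (wt q a n - (wt q a n)⁻¹)) • R.act (podlesGen q a 0 0) v +
      (Complex.I * (q : ℂ)) • R.act (podlesGen q a 0 1) v) := by
    rw [← hc]
    match_scalars <;> field_simp <;> simp [Complex.I_sq]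
  have e11 := R.act_podlesGen_one_one v
  rw [h.raise_eq, h.lower_eq]
  simp only [Fin.sum_univ_two]
  fin_cases i <;> fin_cases j <;>
    simp only [gUp, gDown, gZero, gZeroL, gZeroR, upU, downU, upUstar, downUstar, Fin.zero_eta,
      Fin.mk_one, Matrix.of_apply, Matrix.cons_val',
      Matrix.cons_val_zero, Matrix.cons_val_one, Matrix.cons_val_fin_one, e10, e11] <;>
    generalize R.act (podlesGen q a 0 0) v = e00 <;>
    generalize R.act (podlesGen q a 0 1) v = e01 <;>
    generalize wt q a n = x at * <;>
    generalize (qDiff q a : ℂ) = t at * <;>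
    generalize (q : ℂ) = p at * <;>
    match_scalars <;> field_simp <;> ring_nf <;>
    simp [Complex.I_sq, Complex.I_pow_three, Complex.I_pow_four] <;> ring

end UnitaryDKRep

/-! ### The scalar by which lowering after raising acts. -/

namespace UnitaryDKRep

variable {q : ℝ} [hq : Fact (q ∈ Set.Ioo (0 : ℝ) 1)] {a : ℝ}
variable {V : Type*} [AddCommGroup V] [Module ℂ V] {R : UnitaryDKRep q a V}

/-- Of the nine composites of raising, lowering and weight-preserving parts, three return to the
weight [a + n]. -/
theorem IsWt.wp_act_act {lam : ℂ} {n : ℤ} {v : V} (h : R.IsWt n v)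
    (hc : R.casimir = lam • LinearMap.id) (i k j : Fin 2) :
    R.wp n (R.act (podlesGen q a i k) (R.act (podlesGen q a k j) v)) =
      (gDown q (q ^ 2 * wt q a n) i k * gUp q (wt q a n) k j) • R.lower (n + 2) (R.raise n v) +
      (gUp q (((q : ℂ) ^ 2)⁻¹ * wt q a n) i k * gDown q (wt q a n) k j) •
        R.raise (n - 2) (R.lower n v) +
      (gZero q (qDiff q a) lam (wt q a n) i k * gZero q (qDiff q a) lam (wt q a n) k j) • v := by
  have hc' : ∀ w, R.casimir w = lam • w := fun w => by rw [hc]; rfl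
  have hr := R.isWt_raise n v
  have hl := R.isWt_lower n v
  have h1 := R.isWt_raise (n + 2) (R.raise n v)
  have h2 := R.isWt_lower (n + 2) (R.raise n v)
  have h3 := R.isWt_raise (n - 2) (R.lower n v)
  have h4 := R.isWt_lower (n - 2) (R.lower n v)
  rw [h.act_podlesGen (hc' _)]
  simp only [map_add, map_smul]
  rw [hr.act_podlesGen (hc' _), hl.act_podlesGen (hc' _), h.act_podlesGen (hc' _)]
  simp only [map_add, map_smul, h1.wp, h2.wp, h3.wp, h4.wp, hr.wp, hl.wp, h.wp]
  rw [if_neg (by omega), if_pos (by omega), if_neg (by omega), if_pos (by omega),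
    if_neg (by omega), if_neg (by omega), if_pos trivial, wt_add_two, wt_sub_two]
  module

/-- The relation E_t² = 1 - tE_t in weight n, where only the weight-preserving part of -tE_t
survives. With `IsWt.wp_act_act` it gives linear equations for the two composites of raising and
lowering. -/
theorem IsWt.wp_act_sq {lam : ℂ} {n : ℤ} {v : V} (h : R.IsWt n v)
    (hc : R.casimir = lam • LinearMap.id) (i j : Fin 2) :
    R.wp n (R.act (podlesGen q a i 0) (R.act (podlesGen q a 0 j) v)) +
      R.wp n (R.act (podlesGen q a i 1) (R.act (podlesGen q a 1 j) v)) =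
      (1 : Matrix (Fin 2) (Fin 2) ℂ) i j • v -
        ((qDiff q a : ℂ) * gZero q (qDiff q a) lam (wt q a n) i j) • v := by
  have hc' : R.casimir v = lam • v := by rw [hc]; rfl
  rw [← map_add, ← Module.End.mul_apply, ← Module.End.mul_apply, ← map_mul, ← map_mul,
    ← LinearMap.add_apply, ← map_add, podlesGen_mul_self, map_sub, map_smul, map_smul, map_one]
  simp only [LinearMap.sub_apply, LinearMap.smul_apply, Module.End.one_apply]
  rw [h.act_podlesGen hc']
  simp only [map_add, map_sub, map_smul, h.wp, (R.isWt_raise n v).wp, (R.isWt_lower n v).wp]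
  rw [if_pos trivial, if_neg (by omega), if_neg (by omega)]
  module

theorem IsWt.lower_raise {lam : ℂ} {n : ℤ} {v : V} (h : R.IsWt n v)
    (hc : R.casimir = lam • LinearMap.id) :
    R.lower (n + 2) (R.raise n v) = gKappa q (qDiff q a) lam (wt q a n) • v := by
  have hq0 := cq_ne_zero q
  have hx := wt_ne_zero q a n
  have h1 := wt_sq_add_one_ne_zero q a n
  have h2 := q_four_mul_wt_sq_add_one_ne_zero q a n
  have h2' : wt q a n ^ 2 * (q : ℂ) ^ 4 + 1 ≠ 0 := by rwa [mul_comm]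
  have k00 := h.wp_act_sq hc 0 0
  have k01 := h.wp_act_sq hc 0 1
  rw [h.wp_act_act hc, h.wp_act_act hc] at k00 k01
  simp only [gUp, gDown, Fin.zero_eta,
      Fin.mk_one, Matrix.of_apply, Matrix.cons_val', Matrix.one_apply,
      Matrix.cons_val_zero, Matrix.cons_val_one, Matrix.cons_val_fin_one] at k00 k01
  simp only [gKappa]
  generalize R.lower (n + 2) (R.raise n v) = P at *
  generalize R.raise (n - 2) (R.lower n v) = M at *
  generalize gZero q (qDiff q a) lam (wt q a n) = Z at *
  generalize wt q a n = x at *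
  generalize (qDiff q a : ℂ) = t at *
  generalize (q : ℂ) = p at *
  have hD : (x + x⁻¹) * (x⁻¹ + p ^ 4 * x) ≠ 0 := by
    rw [show (x + x⁻¹) * (x⁻¹ + p ^ 4 * x) = (x ^ 2 + 1) * (p ^ 4 * x ^ 2 + 1) / x ^ 2 by
      field_simp; ring]
    positivity
  rw [← sub_eq_zero]
  have e : ((x + x⁻¹) * (x⁻¹ + p ^ 4 * x)) • P =
      ((1 - t * Z 0 0 - Z 0 0 ^ 2 - Z 0 1 * Z 1 0) -
      x⁻¹ * (-Complex.I) * (t * Z 0 1 + Z 0 0 * Z 0 1 + Z 0 1 * Z 1 1)) • v := by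
    -- In entry (0,0) the raising-after-lowering term has coefficient 1 + q⁴x⁻², in entry (0,1) it
    -- has -i x times that. The multiplier -i x⁻¹ cancels it and leaves (x + x⁻¹)(x⁻¹ + q⁴x) in
    -- front of lowering after raising.
    have k := congrArg₂ (· + ·) k00 (congrArg (fun w => (-(Complex.I * x⁻¹)) • w) k01)
    beta_reduce at k
    rw [← sub_eq_zero] at k ⊢
    rw [← k]
    simp only [if_true, zero_ne_one, if_false]
    match_scalars <;> field_simp <;> ring_nf <;>
    simp [Complex.I_sq, Complex.I_pow_three, Complex.I_pow_four] <;> ring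
  rw [sub_eq_zero, div_eq_inv_mul, mul_smul, ← e, inv_smul_smul₀ hD]

/-- With the other composite known, entry (0,0) alone can be solved, since 1 + q⁴x⁻² ≠ 0. Its value
is not needed, only that it is a scalar. -/
theorem IsWt.exists_raise_lower {lam : ℂ} {n : ℤ} {v : V} (h : R.IsWt n v)
    (hc : R.casimir = lam • LinearMap.id) :
    ∃ c : ℂ, R.raise (n - 2) (R.lower n v) = c • v := by
  have hx := wt_ne_zero q a n
  have h1 := wt_sq_add_ne_zero q a 0 4 n
  have k00 := h.wp_act_sq hc 0 0
  rw [h.wp_act_act hc, h.wp_act_act hc, h.lower_raise hc] at k00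
  simp only [gUp, gDown, Matrix.of_apply, Matrix.cons_val', Matrix.one_apply_eq,
      Matrix.cons_val_zero, Matrix.cons_val_one, Matrix.cons_val_fin_one] at k00
  generalize gZero q (qDiff q a) lam (wt q a n) = Z at *
  generalize gKappa q (qDiff q a) lam (wt q a n) = K at *
  generalize R.raise (n - 2) (R.lower n v) = M at *
  have hD : (1 + (q : ℂ) ^ 4 * (wt q a n ^ 2)⁻¹) ≠ 0 := by
    rw [show (1 + (q : ℂ) ^ 4 * (wt q a n ^ 2)⁻¹) =
      ((q : ℂ) ^ (0 : ℤ) * wt q a n ^ 2 + (q : ℂ) ^ (4 : ℤ)) / wt q a n ^ 2 by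
        rw [zpow_zero, one_mul, zpow_ofNat]; field_simp]
    exact div_ne_zero h1 (pow_ne_zero _ hx)
  refine ⟨(1 + (q : ℂ) ^ 4 * (wt q a n ^ 2)⁻¹)⁻¹ * (1 - (qDiff q a : ℂ) * Z 0 0 - Z 0 0 * Z 0 0 -
    Z 0 1 * Z 1 0 - (1 + (q : ℂ) ^ 4 * wt q a n ^ 2) * K), ?_⟩
  rw [mul_smul, eq_inv_smul_iff₀ hD, ← sub_eq_zero]
  rw [← sub_eq_zero] at k00
  rw [← k00]
  have hq0 := cq_ne_zero q
  match_scalars <;> field_simp <;> ring_nf <;> simp [Complex.I_sq]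

end UnitaryDKRep

/-! ### Irreducible representations with given Casimir value and weights: uniqueness. -/

namespace UnitaryDKRep

variable {q : ℝ} [hq : Fact (q ∈ Set.Ioo (0 : ℝ) 1)] {a : ℝ}
variable {V : Type*} [AddCommGroup V] [Module ℂ V] {R : UnitaryDKRep q a V}

/-- `R` is irreducible with Casimir value `lam` and weights `[a + n]` for `n ∈ e + 2ℤ`. -/
structure IsSeries (R : UnitaryDKRep q a V) (e : ℤ) (lam : ℂ) : Prop where
  irr : R.IsIrreducible
  casimir : R.casimir = lam • LinearMap.id
  wt_iff : ∀ n, (∃ v, v ≠ 0 ∧ R.IsWt n v) ↔ ∃ k, n = 2 * k + e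

theorem wp_opIB (n : ℤ) (v : V) : R.wp n (R.opIB v) = (qNum q (a + n) : ℂ) • R.wp n v := by
  refine R.wt_induction (P := fun v => R.wp n (R.opIB v) = (qNum q (a + n) : ℂ) • R.wp n v)
    (by simp) (fun v w hv hw => by simp only [map_add, hv, hw, smul_add])
    (fun m v h => ?_) v
  rw [h.opIB, map_smul, h.wp]
  split_ifs with hm
  · rw [hm]
  · simp

/-- iB_t is diagonal for the weight decomposition with distinct values on distinct weights, so all
but one component of an eigenvector vanish. Eigenvalues may thus be replaced by weights. -/
theorem hasEigenvalue_opIB_iff (n : ℤ) :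
    R.opIB.HasEigenvalue (qNum q (a + n) : ℂ) ↔ ∃ v, v ≠ 0 ∧ R.IsWt n v := by
  constructor
  · intro h
    obtain ⟨v, hv⟩ := h.exists_hasEigenvector
    have hm : ∀ m, m ≠ n → R.wp m v = 0 := by
      intro m hm
      have h1 := R.wp_opIB m v
      rw [hv.apply_eq_smul, map_smul, ← sub_eq_zero, ← sub_smul, smul_eq_zero] at h1
      exact h1.resolve_left fun h2 => hm (qNum_wt_injective q a (sub_eq_zero.1 h2)).symm
    refine ⟨R.wp n v, fun h0 => hv.2 (R.ext_wp fun m => ?_), R.isWt_wp n v⟩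
    rw [map_zero]
    by_cases h1 : m = n
    · rw [h1, h0]
    · exact hm m h1
  · rintro ⟨v, hv, h⟩
    exact Module.End.hasEigenvalue_of_hasEigenvector
      (Module.End.hasEigenvector_iff.2 ⟨Module.End.mem_eigenspace_iff.2 h.opIB, hv⟩)

theorem eigenvalue_iff_wt_iff (e : ℤ) (hμ : ∀ μ, R.opIB.HasEigenvalue μ → ∃ n : ℤ, μ = (qNum q (a + n) : ℂ)) :
    (∀ μ : ℂ, R.opIB.HasEigenvalue μ ↔ ∃ k : ℤ, μ = (qNum q (a + (2 * k + e : ℤ)) : ℂ)) ↔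
      ∀ n, (∃ v, v ≠ 0 ∧ R.IsWt n v) ↔ ∃ k, n = 2 * k + e := by
  constructor
  · intro h n
    rw [← hasEigenvalue_opIB_iff, h]
    exact exists_congr fun k => ⟨fun h => qNum_wt_injective q a h, fun h => by rw [h]⟩
  · intro h μ
    constructor
    · intro hm
      obtain ⟨n, rfl⟩ := hμ μ hm
      rw [hasEigenvalue_opIB_iff, h] at hm
      obtain ⟨k, rfl⟩ := hm
      exact ⟨k, rfl⟩
    · rintro ⟨k, rfl⟩
      rw [hasEigenvalue_opIB_iff, h]
      exact ⟨k, rfl⟩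

theorem exists_eq_of_hasEigenvalue {μ : ℂ} (h : R.opIB.HasEigenvalue μ) :
    ∃ n : ℤ, μ = (qNum q (a + n) : ℂ) := by
  obtain ⟨v, hv⟩ := h.exists_hasEigenvector
  by_contra! hn
  refine hv.2 (R.ext_wp fun m => ?_)
  have h1 := R.wp_opIB m v
  rw [hv.apply_eq_smul, map_smul, ← sub_eq_zero, ← sub_smul, smul_eq_zero] at h1
  rw [map_zero, h1.resolve_left fun h2 => hn m (sub_eq_zero.1 h2)]

theorem isEvenSeries_iff (lam : ℝ) : R.IsEvenSeries lam ↔ R.IsSeries 0 lam := by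
  have h := eigenvalue_iff_wt_iff (R := R) 0 fun μ => exists_eq_of_hasEigenvalue
  have h1 : (∀ μ : ℂ, R.opIB.HasEigenvalue μ ↔ ∃ k : ℤ, μ = (qNum q (a + 2 * k) : ℂ)) ↔
      ∀ n, (∃ v, v ≠ 0 ∧ R.IsWt n v) ↔ ∃ k, n = 2 * k + 0 := by
    rw [← h]
    push_cast
    simp only [add_zero]
  exact ⟨fun ⟨h2, h3, h4⟩ => ⟨h2, h3, h1.1 h4⟩, fun ⟨h2, h3, h4⟩ => ⟨h2, h3, h1.2 h4⟩⟩

theorem isOddSeries_iff (lam : ℝ) : R.IsOddSeries lam ↔ R.IsSeries 1 lam := by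
  have h := eigenvalue_iff_wt_iff (R := R) 1 fun μ => exists_eq_of_hasEigenvalue
  have h1 : (∀ μ : ℂ, R.opIB.HasEigenvalue μ ↔ ∃ k : ℤ, μ = (qNum q (a + 2 * k + 1) : ℂ)) ↔
      ∀ n, (∃ v, v ≠ 0 ∧ R.IsWt n v) ↔ ∃ k, n = 2 * k + 1 := by
    rw [← h]
    push_cast
    simp only [add_assoc]
  exact ⟨fun ⟨h2, h3, h4⟩ => ⟨h2, h3, h1.1 h4⟩, fun ⟨h2, h3, h4⟩ => ⟨h2, h3, h1.2 h4⟩⟩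

theorem IsWt.ip_wp {n : ℤ} {u : V} (h : R.IsWt n u) (v : V) : R.ip (R.wp n v) u = R.ip v u := by
  refine R.wt_induction (P := fun v => R.ip (R.wp n v) u = R.ip v u) (by simp)
    (fun v w hv hw => ?_) (fun m v hv => ?_) v
  · simp only [map_add, LinearMap.add_apply, hv, hw]
  · rw [hv.wp]
    split_ifs with hm
    · rfl
    · rw [hv.ip_eq_zero h (Ne.symm hm)]
      simp

theorem IsWt.ip_wp_right {n : ℤ} {u : V} (h : R.IsWt n u) (v : V) :
    R.ip u (R.wp n v) = R.ip u v := by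
  rw [← R.ip_symm, h.ip_wp, R.ip_symm]

/-- Raising and lowering are the outer weight components of E_00, which is self-adjoint, and the
weight projections are orthogonal. -/
theorem IsWt.ip_raise {n : ℤ} {v u : V} (hv : R.IsWt n v) (hu : R.IsWt (n + 2) u) :
    R.ip (R.raise n v) u = R.ip v (R.lower (n + 2) u) := by
  rw [raise, lower, Module.End.mul_apply, Module.End.mul_apply, hu.ip_wp, ← ip_act_podlesGen,
    add_sub_cancel_right, hv.ip_wp_right]

/-- This makes the norms along a chain of raisings a function of λ, and shows κ ≠ 0 wherever raising
does not annihilate a vector. -/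
theorem IsWt.ip_raise_raise {lam : ℂ} {n : ℤ} {v w : V} (hv : R.IsWt n v) (hw : R.IsWt n w)
    (hc : R.casimir = lam • LinearMap.id) :
    R.ip (R.raise n v) (R.raise n w) =
      gKappa q (qDiff q a) lam (wt q a n) * R.ip v w := by
  rw [hv.ip_raise (R.isWt_raise n w), hw.lower_raise hc, map_smul, smul_eq_mul]

theorem ip_self_ne_zero {v : V} (hv : v ≠ 0) : R.ip v v ≠ 0 := fun h => by
  have := R.ip_pos v hv
  simp [h] at this

theorem act_mem {W : Submodule ℂ V} (h : ∀ i j, ∀ w ∈ W, R.act (podlesGen q a i j) w ∈ W)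
    (b : Podles q a) : ∀ w ∈ W, R.act b w ∈ W := by
  induction b using Podles.induction_on with
  | hE i j => exact h i j
  | hs c =>
    intro w hw
    rw [AlgHom.commutes]
    exact W.smul_mem c hw
  | ha x y hx hy => intro w hw; rw [map_add]; exact add_mem (hx w hw) (hy w hw)
  | hm x y hx hy => intro w hw; rw [map_mul]; exact hx _ (hy w hw)

/-- The iterated raising operators on a weight vector. -/
def raiseSeq (R : UnitaryDKRep q a V) (n : ℤ) (v : V) : ℕ → V
  | 0 => v
  | k + 1 => R.raise (n + 2 * k) (raiseSeq R n v k)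

/-- The iterated lowering operators on a weight vector. -/
def lowerSeq (R : UnitaryDKRep q a V) (n : ℤ) (v : V) : ℕ → V
  | 0 => v
  | k + 1 => R.lower (n - 2 * k) (lowerSeq R n v k)

theorem IsWt.raiseSeq {n : ℤ} {v : V} (h : R.IsWt n v) (k : ℕ) :
    R.IsWt (n + 2 * k) (R.raiseSeq n v k) := by
  cases k with
  | zero =>
    rw [Nat.cast_zero, mul_zero, add_zero]
    exact h
  | succ k =>
    rw [show n + 2 * ((k + 1 : ℕ) : ℤ) = n + 2 * k + 2 by push_cast; ring]
    exact R.isWt_raise _ _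

theorem IsWt.lowerSeq {n : ℤ} {v : V} (h : R.IsWt n v) (k : ℕ) :
    R.IsWt (n - 2 * k) (R.lowerSeq n v k) := by
  cases k with
  | zero =>
    rw [Nat.cast_zero, mul_zero, sub_zero]
    exact h
  | succ k =>
    rw [show n - 2 * ((k + 1 : ℕ) : ℤ) = n - 2 * k - 2 by push_cast; ring]
    exact R.isWt_lower _ _

/-- A weight vector that is orthogonal to the iterates of raising and lowering of a nonzero
vector vanishes. -/
theorem IsIrreducible.eq_zero {lam : ℂ} (hi : R.IsIrreducible)
    (hc : R.casimir = lam • LinearMap.id) {n : ℤ} {v : V} (hv : R.IsWt n v) (h0 : v ≠ 0) {u : V}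
    (h1 : ∀ k, R.ip (R.raiseSeq n v k) u = 0) (h2 : ∀ k, R.ip (R.lowerSeq n v k) u = 0) : u = 0 := by
  have hc' : ∀ w, R.casimir w = lam • w := fun w => by rw [hc]; rfl
  set S := Set.range (R.raiseSeq n v) ∪ Set.range (R.lowerSeq n v) with hS
  set W := Submodule.span ℂ S with hW
  have hr : ∀ k, R.raiseSeq n v k ∈ W := fun k => Submodule.subset_span (Or.inl ⟨k, rfl⟩)
  have hl : ∀ k, R.lowerSeq n v k ∈ W := fun k => Submodule.subset_span (Or.inr ⟨k, rfl⟩)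
  -- Each generator is a combination of raising, lowering and a scalar; a step back along either
  -- chain is a scalar multiple of the previous vector.
  have hact : ∀ i j, ∀ w ∈ W, R.act (podlesGen q a i j) w ∈ W := by
    intro i j
    suffices h : W ≤ W.comap (R.act (podlesGen q a i j)) from h
    refine Submodule.span_le.2 ?_
    rintro w (⟨k, rfl⟩ | ⟨k, rfl⟩)
    · rw [SetLike.mem_coe, Submodule.mem_comap, (hv.raiseSeq k).act_podlesGen (hc' _)]
      refine add_mem (add_mem (W.smul_mem _ (hr (k + 1))) (W.smul_mem _ ?_)) (W.smul_mem _ (hr k))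
      cases k with
      | zero => simpa [UnitaryDKRep.raiseSeq, UnitaryDKRep.lowerSeq] using hl 1
      | succ k =>
        have := (hv.raiseSeq k).lower_raise hc
        rw [show n + 2 * ((k + 1 : ℕ) : ℤ) = n + 2 * k + 2 by push_cast; ring]
        rw [UnitaryDKRep.raiseSeq, this]
        exact W.smul_mem _ (hr k)
    · rw [SetLike.mem_coe, Submodule.mem_comap, (hv.lowerSeq k).act_podlesGen (hc' _)]
      refine add_mem (add_mem (W.smul_mem _ ?_) (W.smul_mem _ (hl (k + 1)))) (W.smul_mem _ (hl k))
      cases k with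
      | zero => simpa [UnitaryDKRep.raiseSeq, UnitaryDKRep.lowerSeq] using hr 1
      | succ k =>
        obtain ⟨c, this⟩ := (hv.lowerSeq k).exists_raise_lower hc
        rw [show n - 2 * ((k + 1 : ℕ) : ℤ) = n - 2 * k - 2 by push_cast; ring]
        rw [UnitaryDKRep.lowerSeq, this]
        exact W.smul_mem _ (hl k)
  have hdual : ∀ ω ∈ restrictedDual q a, ∀ w ∈ W, R.actDual ω w ∈ W := by
    intro ω _
    suffices h : W ≤ W.comap (R.actDual ω) from h
    refine Submodule.span_le.2 ?_
    rintro w (⟨k, rfl⟩ | ⟨k, rfl⟩)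
    · rw [SetLike.mem_coe, Submodule.mem_comap, (hv.raiseSeq k).actDual]
      exact W.smul_mem _ (hr k)
    · rw [SetLike.mem_coe, Submodule.mem_comap, (hv.lowerSeq k).actDual]
      exact W.smul_mem _ (hl k)
  have horth : ∀ w ∈ W, R.ip w u = 0 := by
    intro w hw
    induction hw using Submodule.span_induction with
    | mem w hw =>
      rcases hw with ⟨k, rfl⟩ | ⟨k, rfl⟩
      · exact h1 k
      · exact h2 k
    | zero => simp
    | add x y _ _ hx hy => rw [map_add, LinearMap.add_apply, hx, hy, add_zero]
    | smul c x _ hx => rw [map_smulₛₗ, LinearMap.smul_apply, hx, smul_zero]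
  by_contra hu
  have hpos := R.ip_pos u hu
  -- The span is dense, so some w in it satisfies ‖u - w‖² < ‖u‖². Orthogonality gives ‖u - w‖² =
  -- ‖u‖² + ‖w‖², a contradiction.
  obtain ⟨w, hw, hlt⟩ := hi.2 W (act_mem hact) hdual
    (fun h => h0 ((Submodule.eq_bot_iff _).1 h v (hr 0))) u _ hpos
  have e1 := horth w hw
  have e2 : R.ip u w = 0 := by rw [← R.ip_symm, e1, map_zero]
  have e3 : 0 ≤ (R.ip w w).re := by
    by_cases h : w = 0
    · simp [h]
    · exact (R.ip_pos w h).le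
  simp only [map_sub, LinearMap.sub_apply, e1, e2, Complex.sub_re, Complex.zero_re] at hlt
  linarith

/-- Multiplicity one: u minus its projection to v is orthogonal to v, and to all other iterates
because their weights differ, hence vanishes by `IsIrreducible.eq_zero`. -/
theorem IsSeries.eq_smul {e : ℤ} {lam : ℂ} (hs : R.IsSeries e lam) {n : ℤ} {v u : V}
    (hv : R.IsWt n v) (h0 : v ≠ 0) (hu : R.IsWt n u) : ∃ c : ℂ, u = c • v := by
  have hvv := ip_self_ne_zero (R := R) h0
  refine ⟨R.ip v u / R.ip v v, ?_⟩
  rw [← sub_eq_zero]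
  have hu' : R.IsWt n (u - (R.ip v u / R.ip v v) • v) := by
    rw [sub_eq_add_neg, ← neg_smul]
    exact hu.add (hv.smul _)
  have hz : R.ip v (u - (R.ip v u / R.ip v v) • v) = 0 := by
    rw [map_sub, map_smul, smul_eq_mul, div_mul_cancel₀ _ hvv, sub_self]
  refine hs.irr.eq_zero hs.casimir hv h0 (fun k => ?_) fun k => ?_
  · rcases Nat.eq_zero_or_pos k with rfl | hk
    · exact hz
    · exact (hv.raiseSeq k).ip_eq_zero hu' (by omega)
  · rcases Nat.eq_zero_or_pos k with rfl | hk
    · exact hz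
    · exact (hv.lowerSeq k).ip_eq_zero hu' (by omega)

/-- Otherwise the chain through v stops at weight n, and any vector of the next weight n + 2, which
does occur, is orthogonal to all iterates. -/
theorem IsSeries.raise_ne_zero {e : ℤ} {lam : ℂ} (hs : R.IsSeries e lam) {n : ℤ} {v : V}
    (hv : R.IsWt n v) (h0 : v ≠ 0) : R.raise n v ≠ 0 := by
  intro h
  obtain ⟨k, hk⟩ := (hs.wt_iff n).1 ⟨v, h0, hv⟩
  obtain ⟨u, hu0, hu⟩ := (hs.wt_iff (n + 2)).2 ⟨k + 1, by rw [hk]; ring⟩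
  refine hu0 (hs.irr.eq_zero hs.casimir hv h0 (fun k => ?_) fun k => ?_)
  · by_cases hk : k = 1
    · subst hk
      have : R.raiseSeq n v 1 = 0 := by
        simpa [UnitaryDKRep.raiseSeq] using h
      rw [this]
      simp
    · exact (hv.raiseSeq k).ip_eq_zero hu (by omega)
  · exact (hv.lowerSeq k).ip_eq_zero hu (by omega)

/-- A sequence of vectors in which each is the image of its predecessor under raising. -/
structure IsRaiseSeq (R : UnitaryDKRep q a V) (e : ℤ) (w : ℤ → V) : Prop where
  isWt : ∀ k, R.IsWt (2 * k + e) (w k)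
  ne_zero : ∀ k, w k ≠ 0
  raise : ∀ k, R.raise (2 * k + e) (w k) = w (k + 1)
  unit : R.ip (w 0) (w 0) = 1

/-- Upwards the chain continues by raising a unit vector. Downwards, a nonzero vector two weights
lower has a nonzero raising, which by multiplicity one is proportional to the given vector, so
rescaling fits it in. -/
theorem IsSeries.exists_isRaiseSeq {e : ℤ} {lam : ℂ} (hs : R.IsSeries e lam) :
    ∃ w, R.IsRaiseSeq e w := by
  obtain ⟨v, h0, hv⟩ := (hs.wt_iff (2 * 0 + e)).2 ⟨0, rfl⟩
  have hpos := R.ip_pos v h0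
  have him : R.ip v v = ((R.ip v v).re : ℂ) := (Complex.conj_eq_iff_re.1 (R.ip_symm v v)).symm
  set r : ℝ := (Real.sqrt (R.ip v v).re)⁻¹ with hr
  have hr0 : r ≠ 0 := inv_ne_zero (Real.sqrt_pos.2 hpos).ne'
  have hunit : R.ip ((r : ℂ) • v) ((r : ℂ) • v) = 1 := by
    rw [map_smul, map_smulₛₗ, LinearMap.smul_apply, Complex.conj_ofReal, him, smul_eq_mul,
      smul_eq_mul, ← mul_assoc, ← Complex.ofReal_mul, ← Complex.ofReal_mul, hr, ← mul_inv,
      Real.mul_self_sqrt hpos.le, inv_mul_cancel₀ hpos.ne', Complex.ofReal_one]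
  obtain ⟨w, hw0, hw⟩ := Int.exists_bi_seq
    (fun k w => R.IsWt (2 * k + e) w ∧ w ≠ 0) (fun k x y => R.raise (2 * k + e) x = y)
    ((r : ℂ) • v) ⟨hv.smul _, smul_ne_zero (by exact_mod_cast hr0) h0⟩
    (fun k x hx => ⟨_, ⟨by
      rw [show 2 * (k + 1) + e = 2 * k + e + 2 by ring]
      exact R.isWt_raise _ _, hs.raise_ne_zero hx.1 hx.2⟩, rfl⟩)
    (fun k y hy => by
      obtain ⟨x, hx0, hx⟩ := (hs.wt_iff (2 * k + e)).2 ⟨k, rfl⟩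
      have hy1 := hy.1
      rw [show 2 * (k + 1) + e = 2 * k + e + 2 by ring] at hy1
      obtain ⟨c, hc⟩ := hs.eq_smul (R.isWt_raise _ x) (hs.raise_ne_zero hx hx0) hy1
      refine ⟨c • x, ⟨hx.smul c, smul_ne_zero ?_ hx0⟩, by rw [map_smul, ← hc]⟩
      rintro rfl
      exact hy.2 (by rw [hc, zero_smul]))
  exact ⟨w, fun k => (hw k).1.1, fun k => (hw k).1.2, fun k => (hw k).2, by rw [hw0, hunit]⟩

theorem IsRaiseSeq.linearIndependent {e : ℤ} {w : ℤ → V} (hw : R.IsRaiseSeq e w) :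
    LinearIndependent ℂ w := by
  rw [linearIndependent_iff']
  intro s c h i hi
  have h1 := congrArg (R.wp (2 * i + e)) h
  rw [map_sum, map_zero, Finset.sum_eq_single i] at h1
  · rw [map_smul, (hw.isWt i).wp, if_pos rfl, smul_eq_zero] at h1
    exact h1.resolve_right (hw.ne_zero i)
  · intro k _ hk
    rw [map_smul, (hw.isWt k).wp, if_neg (by omega), smul_zero]
  · exact fun h => absurd hi h

theorem IsRaiseSeq.span {e : ℤ} {lam : ℂ} (hs : R.IsSeries e lam) {w : ℤ → V}
    (hw : R.IsRaiseSeq e w) : ⊤ ≤ Submodule.span ℂ (Set.range w) := by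
  intro v _
  refine R.wt_induction (zero_mem _) (fun _ _ => add_mem) (fun n v hv => ?_) v
  by_cases h0 : v = 0
  · rw [h0]; exact zero_mem _
  obtain ⟨k, rfl⟩ := (hs.wt_iff n).1 ⟨v, h0, hv⟩
  obtain ⟨c, rfl⟩ := hs.eq_smul (hw.isWt k) (hw.ne_zero k) hv
  exact Submodule.smul_mem _ _ (Submodule.subset_span ⟨k, rfl⟩)

theorem IsRaiseSeq.ip_succ {e : ℤ} {lam : ℂ} (hc : R.casimir = lam • LinearMap.id) {w : ℤ → V}
    (hw : R.IsRaiseSeq e w) (k : ℤ) : R.ip (w (k + 1)) (w (k + 1)) =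
      gKappa q (qDiff q a) lam (wt q a (2 * k + e)) * R.ip (w k) (w k) := by
  rw [← hw.raise, (hw.isWt k).ip_raise_raise (hw.isWt k) hc]

/-- As w_k is the raising of w_(k-1), lowering it multiplies w_(k-1) by κ. The structure constants
thus involve only λ and the weights. -/
theorem IsRaiseSeq.act {e : ℤ} {lam : ℂ} (hc : R.casimir = lam • LinearMap.id) {w : ℤ → V}
    (hw : R.IsRaiseSeq e w) (i j : Fin 2) (k : ℤ) : R.act (podlesGen q a i j) (w k) =
      gUp q (wt q a (2 * k + e)) i j • w (k + 1) +
      (gDown q (wt q a (2 * k + e)) i j *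
        gKappa q (qDiff q a) lam (wt q a (2 * (k - 1) + e))) • w (k - 1) +
      gZero q (qDiff q a) lam (wt q a (2 * k + e)) i j • w k := by
  have h1 : R.lower (2 * k + e) (w k) =
      gKappa q (qDiff q a) lam (wt q a (2 * (k - 1) + e)) • w (k - 1) := by
    have h2 := (hw.isWt (k - 1)).lower_raise hc
    rw [hw.raise] at h2
    rw [← h2, sub_add_cancel]
    congr 2
    ring
  rw [(hw.isWt k).act_podlesGen (lam := lam) (by rw [hc]; rfl), hw.raise, h1, mul_smul]

/-- Unitary equivalence of representations. -/
def UnitaryEquiv {V' : Type*} [AddCommGroup V'] [Module ℂ V'] (R : UnitaryDKRep q a V)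
    (R' : UnitaryDKRep q a V') (T : V ≃ₗ[ℂ] V') : Prop :=
  (∀ v w, R.ip v w = R'.ip (T v) (T w)) ∧ (∀ b v, T (R.act b v) = R'.act b (T v)) ∧
    ∀ ω v, T (R.actDual ω v) = R'.actDual ω (T v)

/-- Matching two raising chains is unitary and intertwining, since norms and actions have the same
formulas in λ on both sides. -/
theorem IsSeries.exists_unitaryEquiv {V' : Type*} [AddCommGroup V'] [Module ℂ V']
    {R' : UnitaryDKRep q a V'} {e : ℤ} {lam : ℂ} (hs : R.IsSeries e lam)
    (hs' : R'.IsSeries e lam) : ∃ T, UnitaryEquiv R R' T := by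
  obtain ⟨w, hw⟩ := hs.exists_isRaiseSeq
  obtain ⟨w', hw'⟩ := hs'.exists_isRaiseSeq
  let b := Module.Basis.mk hw.linearIndependent (hw.span hs)
  let b' := Module.Basis.mk hw'.linearIndependent (hw'.span hs')
  have hb : ∀ k, b k = w k := fun k => by simp [b]
  let T := b.equiv b' (Equiv.refl ℤ)
  have hT : ∀ k, T (w k) = w' k := by
    intro k
    rw [← hb k]
    simp [T, b']
  have hip : ∀ k, R.ip (w k) (w k) = R'.ip (w' k) (w' k) := by
    intro k
    -- Needed for negative k, where equality of norms is carried downwards by cancelling κ.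
    have hkappa : ∀ k : ℤ, gKappa q (qDiff q a) lam (wt q a (2 * k + e)) ≠ 0 := by
      intro k h
      have := hw.ip_succ hs.casimir k
      rw [h, zero_mul] at this
      exact ip_self_ne_zero (hw.ne_zero _) this
    induction k using Int.induction_on with
    | zero => rw [hw.unit, hw'.unit]
    | succ k ih => rw [hw.ip_succ hs.casimir, hw'.ip_succ hs'.casimir, ih]
    | pred k ih =>
      have h1 := hw.ip_succ hs.casimir (-(k : ℤ) - 1)
      have h2 := hw'.ip_succ hs'.casimir (-(k : ℤ) - 1)
      rw [sub_add_cancel] at h1 h2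
      rw [h1, h2] at ih
      exact mul_left_cancel₀ (hkappa _) ih
  have hip2 : ∀ k v, R.ip (w k) v = R'.ip (w' k) (T v) := by
    intro k v
    have : R.ip (w k) = R'.ip (w' k) ∘ₗ T.toLinearMap := by
      refine b.ext fun l => ?_
      rw [hb, LinearMap.comp_apply, LinearEquiv.coe_coe, hT]
      by_cases hkl : k = l
      · subst hkl; exact hip k
      · rw [(hw.isWt k).ip_eq_zero (hw.isWt l) (by omega),
          (hw'.isWt k).ip_eq_zero (hw'.isWt l) (by omega)]
    exact LinearMap.congr_fun this v
  refine ⟨T, fun u v => ?_, fun x => ?_, fun ω v => ?_⟩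
  · have : R.ip u = R'.ip (T u) ∘ₗ T.toLinearMap := by
      refine b.ext fun l => ?_
      rw [hb, LinearMap.comp_apply, LinearEquiv.coe_coe, hT, ← R.ip_symm, hip2, R'.ip_symm]
    exact LinearMap.congr_fun this v
  · induction x using Podles.induction_on with
    | hE i j =>
      intro v
      have : T.toLinearMap ∘ₗ R.act (podlesGen q a i j) =
          R'.act (podlesGen q a i j) ∘ₗ T.toLinearMap := by
        refine b.ext fun k => ?_
        simp only [hb, LinearMap.comp_apply, LinearEquiv.coe_coe, hT, hw.act hs.casimir,
          hw'.act hs'.casimir, map_add, map_smul]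
      exact LinearMap.congr_fun this v
    | hs c =>
      intro v
      rw [AlgHom.commutes, AlgHom.commutes]
      exact map_smul T c v
    | ha x y hx hy =>
      intro v
      simp only [map_add, LinearMap.add_apply, hx, hy]
    | hm x y hx hy =>
      intro v
      simp only [map_mul, Module.End.mul_apply, hx, hy]
  · have : T.toLinearMap ∘ₗ R.actDual ω = R'.actDual ω ∘ₗ T.toLinearMap := by
      refine b.ext fun k => ?_
      simp only [hb, LinearMap.comp_apply, LinearEquiv.coe_coe, hT, (hw.isWt k).actDual,
        (hw'.isWt k).actDual, map_smul]
    exact LinearMap.congr_fun this v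

end UnitaryDKRep

/-! ### Subrepresentations and a criterion for irreducibility. -/

namespace UnitaryDKRep

variable {q : ℝ} [hq : Fact (q ∈ Set.Ioo (0 : ℝ) 1)] {a : ℝ}
variable {V : Type*} [AddCommGroup V] [Module ℂ V] (R : UnitaryDKRep q a V)

section SubRep

variable (W : Submodule ℂ V) (hact : ∀ b, ∀ w ∈ W, R.act b w ∈ W)
  (hco : ∀ w ∈ W, R.coact w ∈ LinearMap.range (W.subtype.rTensor (OqSO2 q a)))

theorem rTensor_subtype_injective {N : Type*} [AddCommGroup N] [Module ℂ N] :
    Function.Injective (W.subtype.rTensor N) :=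
  Module.Flat.rTensor_preserves_injective_linearMap _ W.subtype_injective

/-- The action on an invariant subspace. -/
def subAct : Podles q a →ₐ[ℂ] Module.End ℂ W :=
  AlgHom.ofLinearMap
    { toFun := fun b => (R.act b).restrict (hact b)
      map_add' := fun x y => by ext w; simp
      map_smul' := fun c x => by ext w; simp }
    (by ext w; simp) (fun x y => by ext w; simp)

/-- The coaction on an invariant subspace. -/
def subCoact : W →ₗ[ℂ] W ⊗[ℂ] OqSO2 q a :=
  (LinearEquiv.ofInjective (W.subtype.rTensor (OqSO2 q a))
    (rTensor_subtype_injective W)).symm.toLinearMap ∘ₗ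
    (R.coact ∘ₗ W.subtype).codRestrict _ (fun w => hco w w.2)

theorem rTensor_subCoact (w : W) :
    W.subtype.rTensor (OqSO2 q a) (R.subCoact W hco w) = R.coact w :=
  congrArg Subtype.val ((LinearEquiv.ofInjective (W.subtype.rTensor (OqSO2 q a))
    (rTensor_subtype_injective W)).apply_symm_apply
      ((R.coact ∘ₗ W.subtype).codRestrict _ (fun w => hco w w.2) w))

theorem rTensor_subtype_tensorAct (X : Podles q a ⊗[ℂ] OqSU2 q) (T : W ⊗[ℂ] OqSO2 q a) :
    W.subtype.rTensor (OqSO2 q a) (tensorAct q a (R.subAct W hact) X T) =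
      tensorAct q a R.act X (W.subtype.rTensor (OqSO2 q a) T) := by
  induction X with
  | zero => simp
  | add X Y hX hY => simp only [map_add, LinearMap.add_apply, hX, hY]
  | tmul b x =>
    induction T with
    | zero => simp
    | add S T hS hT => simp only [map_add, hS, hT]
    | tmul w c => rfl

/-- The restriction of a representation to an invariant subspace. -/
def subrep : UnitaryDKRep q a W where
  ip := R.ip.domRestrict₁₂ W W
  ip_symm v w := R.ip_symm v w
  ip_pos v hv := R.ip_pos v (by simpa using hv)
  act := R.subAct W hact
  coact := R.subCoact W hco
  coassoc := by
    -- Over a field tensoring preserves injections, so identities for the restricted coaction may be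
    -- checked in the ambient space.
    refine LinearMap.ext fun w => rTensor_subtype_injective W ?_
    have e1 : ∀ S : (W ⊗[ℂ] OqSO2 q a) ⊗[ℂ] OqSO2 q a,
        W.subtype.rTensor _ (TensorProduct.assoc ℂ W (OqSO2 q a) (OqSO2 q a) S) =
        TensorProduct.assoc ℂ V (OqSO2 q a) (OqSO2 q a)
          ((W.subtype.rTensor (OqSO2 q a)).rTensor (OqSO2 q a) S) := by
      intro S
      induction S with
      | zero => simp
      | add S T hS hT => simp only [map_add, hS, hT]
      | tmul T c =>
        induction T with
        | zero => simp
        | add S T hS hT => simp only [TensorProduct.add_tmul, map_add, hS, hT]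
        | tmul w d => rfl
    have e2 : W.subtype.rTensor (OqSO2 q a) ∘ₗ R.subCoact W hco = R.coact ∘ₗ W.subtype :=
      LinearMap.ext fun w => R.rTensor_subCoact W hco w
    have h := LinearMap.congr_fun R.coassoc (w : V)
    simp only [LinearMap.comp_apply, LinearEquiv.coe_coe] at h ⊢
    rw [e1, ← LinearMap.rTensor_comp_apply, e2, LinearMap.rTensor_comp_apply,
      R.rTensor_subCoact W hco, h, ← LinearMap.comp_apply (LinearMap.rTensor _ _),
      LinearMap.rTensor_comp_lTensor, ← LinearMap.lTensor_comp_rTensor, LinearMap.comp_apply,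
      R.rTensor_subCoact W hco]
  counit_coact := by
    refine LinearMap.ext fun w => W.subtype_injective ?_
    have e1 : ∀ T : W ⊗[ℂ] OqSO2 q a, W.subtype (TensorProduct.rid ℂ W
        ((counit (R := ℂ) (A := OqSO2 q a)).lTensor W T)) = TensorProduct.rid ℂ V
        ((counit (R := ℂ) (A := OqSO2 q a)).lTensor V (W.subtype.rTensor (OqSO2 q a) T)) := by
      intro T
      induction T with
      | zero => simp
      | add S T hS hT => simp only [map_add, hS, hT]
      | tmul w d => simp
    have h := LinearMap.congr_fun R.counit_coact (w : V)
    simp only [LinearMap.comp_apply, LinearEquiv.coe_coe] at h ⊢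
    rw [e1, R.rTensor_subCoact W hco, h]
    rfl
  coact_act b v := by
    apply rTensor_subtype_injective W
    rw [R.rTensor_subCoact W hco, rTensor_subtype_tensorAct, R.rTensor_subCoact W hco]
    exact R.coact_act b v
  ip_act b v w := R.ip_act b v w
  ip_coact v w := by
    have e : ∀ v w : W, (R.ip.domRestrict₁₂ W W v).rTensor (OqSO2 q a) (R.subCoact W hco w) =
        (R.ip v).rTensor (OqSO2 q a) (R.coact w) := by
      intro v w
      rw [← R.rTensor_subCoact W hco, ← LinearMap.rTensor_comp_apply]
      rfl
    rw [e, e]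
    exact R.ip_coact v w

theorem isWt_subrep {n : ℤ} {w : W} : (R.subrep W hact hco).IsWt n w ↔ R.IsWt n (w : V) := by
  rw [IsWt, IsWt, ← R.rTensor_subCoact W hco]
  exact ⟨fun h => by rw [show R.subCoact W hco w = _ from h]; rfl,
    fun h => rTensor_subtype_injective W h⟩

theorem actDual_subrep (ω : OqSO2 q a →ₗ[ℂ] ℂ) (w : W) :
    ((R.subrep W hact hco).actDual ω w : V) = R.actDual ω w := by
  rw [actDual_apply, actDual_apply, ← R.rTensor_subCoact W hco]
  change ((TensorProduct.rid ℂ W (ω.lTensor W (R.subCoact W hco w)) : W) : V) = _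
  generalize R.subCoact W hco w = T
  induction T with
  | zero => simp
  | add S T hS hT => simp only [map_add, Submodule.coe_add, hS, hT]
  | tmul w d => simp

theorem casimir_subrep (w : W) :
    ((R.subrep W hact hco).casimir w : V) = R.casimir w := by
  simp only [casimir, opIB, LinearMap.sub_apply, LinearMap.add_apply, LinearMap.smul_apply,
    LinearMap.comp_apply, Submodule.coe_sub, Submodule.coe_add, Submodule.coe_smul]
  rw [← actDual_subrep R W hact hco]
  rfl

end SubRep

/-- A criterion for a representation to belong to the series of irreducible representations. -/
theorem isSeries_of_raise {R : UnitaryDKRep q a V} {e : ℤ} {lam : ℂ}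
    (hc : R.casimir = lam • LinearMap.id)
    (hw : ∀ n, (∃ v, v ≠ 0 ∧ R.IsWt n v) ↔ ∃ k, n = 2 * k + e)
    (h1 : ∀ n u v, R.IsWt n u → R.IsWt n v → u ≠ 0 → ∃ c : ℂ, v = c • u)
    (hr : ∀ n v, R.IsWt n v → v ≠ 0 → R.raise n v ≠ 0) : R.IsSeries e lam := by
  -- An invariant nonzero W turns out to be everything, even before completion, so the approximating
  -- vector can be v itself.
  refine ⟨⟨?_, fun W hact hdual hne v ε hε => ⟨v, ?_, by simpa using hε⟩⟩, hc, hw⟩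
  · obtain ⟨v, hv, -⟩ := (hw (2 * 0 + e)).2 ⟨0, rfl⟩
    exact ⟨v, 0, hv⟩
  obtain ⟨w, hwW, hw0⟩ := (Submodule.ne_bot_iff _).1 hne
  obtain ⟨n, hn⟩ : ∃ n, R.wp n w ≠ 0 := by
    by_contra! h
    exact hw0 (R.ext_wp fun n => by rw [h, map_zero])
  -- W is stable under the weight projections, which lie in the restricted dual; hence it contains a
  -- weight vector and is stable under raising and lowering.
  have key : ∀ k : ℤ, ∃ u ∈ W, u ≠ 0 ∧ R.IsWt (n + 2 * k) u := by
    intro k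
    induction k using Int.induction_on with
    | zero => exact ⟨_, hdual _ (wproj_mem q a n) _ hwW, hn, by
        rw [mul_zero, add_zero]; exact R.isWt_wp n w⟩
    | succ k ih =>
      obtain ⟨u, hu, h0, hwt⟩ := ih
      refine ⟨_, hdual _ (wproj_mem q a _) _ (hact _ _ hu), hr _ u hwt h0, ?_⟩
      rw [show n + 2 * ((k : ℤ) + 1) = n + 2 * k + 2 by ring]
      exact R.isWt_raise _ _
    | pred k ih =>
      obtain ⟨u, hu, h0, hwt⟩ := ih
      obtain ⟨l, hl⟩ := (hw _).1 ⟨u, h0, hwt⟩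
      obtain ⟨x, hx0, hx⟩ := (hw (n + 2 * (-(k : ℤ) - 1))).2 ⟨l - 1, by omega⟩
      rw [show n + 2 * -(k : ℤ) = n + 2 * (-(k : ℤ) - 1) + 2 by ring] at hwt
      have hrx := hr _ x hx hx0
      obtain ⟨c, hcu⟩ := h1 _ _ _ (R.isWt_raise _ x) hwt hrx
      -- Here u is a multiple of the raising of x, so lowering u gives a multiple of κ x. Positivity
      -- of ‖raise x‖² = κ‖x‖² makes κ nonzero: no assumption on lowering is needed.
      have hkap : gKappa q (qDiff q a) lam (wt q a (n + 2 * (-(k : ℤ) - 1))) ≠ 0 := by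
        intro h
        have := hx.ip_raise_raise hx hc
        rw [h, zero_mul] at this
        exact ip_self_ne_zero hrx this
      refine ⟨R.lower (n + 2 * (-(k : ℤ) - 1) + 2) u,
        hdual _ (wproj_mem q a _) _ (hact _ _ hu), ?_, ?_⟩
      · rw [hcu, map_smul, hx.lower_raise hc]
        refine smul_ne_zero ?_ (smul_ne_zero hkap hx0)
        rintro rfl
        exact h0 (by rw [hcu, zero_smul])
      · have := R.isWt_lower (n + 2 * (-(k : ℤ) - 1) + 2) u
        rwa [add_sub_cancel_right] at this
  refine R.wt_induction (P := fun v => v ∈ W) (zero_mem _) (fun _ _ => add_mem) (fun m v hv => ?_) v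
  by_cases hv0 : v = 0
  · rw [hv0]; exact zero_mem _
  obtain ⟨l, hl⟩ := (hw m).1 ⟨v, hv0, hv⟩
  obtain ⟨l', hl'⟩ := (hw n).1 ⟨_, hn, R.isWt_wp n w⟩
  obtain ⟨u, hu, h0, hwt⟩ := key (l - l')
  rw [show n + 2 * (l - l') = m by omega] at hwt
  obtain ⟨c, rfl⟩ := h1 _ _ _ hwt hv h0
  exact W.smul_mem c hu

/-! ### Splitting by the parity of the weight. -/

section Parity

/-- The span of the weight vectors whose weight `[a + n]` satisfies `n ∈ e + 2ℤ`. -/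
def parityPart (e : ℤ) : Submodule ℂ V :=
  Submodule.span ℂ {v | ∃ k : ℤ, R.IsWt (2 * k + e) v}

variable {R}

theorem IsWt.mem_parityPart {e n : ℤ} {v : V} (hv : R.IsWt n v) (h : ∃ k, n = 2 * k + e) :
    v ∈ R.parityPart e := by
  obtain ⟨k, rfl⟩ := h
  exact Submodule.subset_span ⟨k, hv⟩

theorem wp_of_mem_parityPart {e n : ℤ} {v : V} (hv : v ∈ R.parityPart e)
    (h : ¬ ∃ k, n = 2 * k + e) : R.wp n v = 0 := by
  suffices h : R.parityPart e ≤ LinearMap.ker (R.wp n) from h hv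
  refine Submodule.span_le.2 ?_
  rintro w ⟨k, hw⟩
  rw [SetLike.mem_coe, LinearMap.mem_ker, hw.wp, if_neg fun h1 => h ⟨k, h1⟩]

theorem parityPart_act {lam : ℂ} (hc : R.casimir = lam • LinearMap.id) (e : ℤ) (b : Podles q a) :
    ∀ w ∈ R.parityPart e, R.act b w ∈ R.parityPart e := by
  refine act_mem (fun i j => ?_) b
  suffices h : R.parityPart e ≤ (R.parityPart e).comap (R.act (podlesGen q a i j)) from h
  refine Submodule.span_le.2 ?_
  rintro w ⟨k, hw⟩
  rw [SetLike.mem_coe, Submodule.mem_comap,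
    hw.act_podlesGen (show R.casimir w = lam • w by rw [hc]; rfl)]
  refine add_mem (add_mem (Submodule.smul_mem _ _ ?_) (Submodule.smul_mem _ _ ?_))
    (Submodule.smul_mem _ _ (hw.mem_parityPart ⟨k, rfl⟩))
  · exact (R.isWt_raise _ w).mem_parityPart ⟨k + 1, by ring⟩
  · exact (R.isWt_lower _ w).mem_parityPart ⟨k - 1, by ring⟩

theorem parityPart_coact (e : ℤ) : ∀ w ∈ R.parityPart e,
    R.coact w ∈ LinearMap.range ((R.parityPart e).subtype.rTensor (OqSO2 q a)) := by
  suffices h : R.parityPart e ≤ (LinearMap.range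
    ((R.parityPart e).subtype.rTensor (OqSO2 q a))).comap R.coact from h
  refine Submodule.span_le.2 ?_
  rintro w ⟨k, hw⟩
  rw [SetLike.mem_coe, Submodule.mem_comap, hw]
  exact ⟨⟨w, hw.mem_parityPart ⟨k, rfl⟩⟩ ⊗ₜ glike q a (2 * k + e), rfl⟩

theorem isCompl_parityPart : IsCompl (R.parityPart 0) (R.parityPart 1) := by
  constructor
  · rw [Submodule.disjoint_def]
    intro v h0 h1
    refine R.ext_wp fun n => ?_
    rw [map_zero]
    by_cases h : ∃ k, n = 2 * k + 0
    · exact wp_of_mem_parityPart h1 (by omega)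
    · exact wp_of_mem_parityPart h0 h
  · rw [codisjoint_iff, eq_top_iff]
    intro v _
    refine R.wt_induction (P := fun v => v ∈ R.parityPart 0 ⊔ R.parityPart 1) (zero_mem _)
      (fun _ _ => add_mem) (fun n v hv => ?_) v
    rcases Int.even_or_odd' n with ⟨k, h | h⟩
    · exact Submodule.mem_sup_left (hv.mem_parityPart ⟨k, by omega⟩)
    · exact Submodule.mem_sup_right (hv.mem_parityPart ⟨k, h⟩)

theorem ip_parityPart {v w : V} (hv : v ∈ R.parityPart 0) (hw : w ∈ R.parityPart 1) :
    R.ip v w = 0 := by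
  suffices h : R.parityPart 1 ≤ LinearMap.ker (R.ip v) from h hw
  refine Submodule.span_le.2 ?_
  rintro w ⟨k, hw⟩
  rw [SetLike.mem_coe, LinearMap.mem_ker, ← hw.ip_wp,
    wp_of_mem_parityPart hv (by omega), map_zero, LinearMap.zero_apply]

/-- Weights, multiplicity one and the raising operator are inherited from R, so `isSeries_of_raise`
applies to the restriction. -/
theorem isSeries_parityPart {lam : ℂ} (hc : R.casimir = lam • LinearMap.id)
    (h0 : ∀ n, ∃ v, v ≠ 0 ∧ R.IsWt n v)
    (h1 : ∀ n u v, R.IsWt n u → R.IsWt n v → u ≠ 0 → ∃ c : ℂ, v = c • u) (e : ℤ)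
    (hr : ∀ k v, R.IsWt (2 * k + e) v → v ≠ 0 → R.raise (2 * k + e) v ≠ 0) :
    (R.subrep (R.parityPart e) (parityPart_act hc e) (parityPart_coact e)).IsSeries e lam := by
  have hwt : ∀ n (v : R.parityPart e), v ≠ 0 → R.IsWt n (v : V) → ∃ k, n = 2 * k + e := by
    intro n v hv0 hv
    by_contra h
    have h2 := wp_of_mem_parityPart v.2 h
    rw [hv.wp, if_pos rfl] at h2
    exact hv0 (Subtype.ext h2)
  refine isSeries_of_raise ?_ (fun n => ⟨?_, ?_⟩) ?_ ?_
  · refine LinearMap.ext fun w => Subtype.ext ?_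
    rw [casimir_subrep, hc]
    rfl
  · rintro ⟨v, hv0, hv⟩
    rw [isWt_subrep] at hv
    exact hwt n v hv0 hv
  · rintro ⟨k, rfl⟩
    obtain ⟨v, hv0, hv⟩ := h0 (2 * k + e)
    refine ⟨⟨v, hv.mem_parityPart ⟨k, rfl⟩⟩, fun h => hv0 (congrArg Subtype.val h), ?_⟩
    rw [isWt_subrep]
    exact hv
  · intro n u v hu hv hu0
    rw [isWt_subrep] at hu hv
    obtain ⟨c, h⟩ := h1 n u v hu hv fun h => hu0 (Subtype.ext h)
    exact ⟨c, Subtype.ext h⟩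
  · intro n v hv hv0 h
    rw [isWt_subrep] at hv
    obtain ⟨k, rfl⟩ := hwt n v hv0 hv
    refine hr k v hv (fun h => hv0 (Subtype.ext h)) ?_
    have h2 := congrArg Subtype.val h
    rw [raise, Module.End.mul_apply, wp, actDual_subrep] at h2
    exact h2

/-- The two parts are complementary, orthogonal and invariant; uniqueness of the series supplies a
unitary equivalence on each. -/
theorem equivDirectSum_of_parityPart {V₁ V₂ : Type*} [AddCommGroup V₁] [Module ℂ V₁]
    [AddCommGroup V₂] [Module ℂ V₂] {R₁ : UnitaryDKRep q a V₁} {R₂ : UnitaryDKRep q a V₂}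
    {lam : ℂ} (hc : R.casimir = lam • LinearMap.id)
    (h0 : (R.subrep (R.parityPart 0) (parityPart_act hc 0) (parityPart_coact 0)).IsSeries 0 lam)
    (h1 : (R.subrep (R.parityPart 1) (parityPart_act hc 1) (parityPart_coact 1)).IsSeries 1 lam)
    (h0' : R₁.IsSeries 0 lam) (h1' : R₂.IsSeries 1 lam) : R.EquivDirectSum R₁ R₂ := by
  obtain ⟨T₁, hT₁⟩ := h0.exists_unitaryEquiv h0'
  obtain ⟨T₂, hT₂⟩ := h1.exists_unitaryEquiv h1'
  let D := Submodule.prodEquivOfIsCompl _ _ (isCompl_parityPart (R := R))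
  have hD : ∀ p, D p = (p.1 : V) + p.2 := fun p => rfl
  refine ⟨D.symm.trans (T₁.prodCongr T₂), fun v w => ?_, fun b v => ?_, fun ω _ v => ?_⟩
  · obtain ⟨⟨v₁, v₂⟩, rfl⟩ := D.surjective v
    obtain ⟨⟨w₁, w₂⟩, rfl⟩ := D.surjective w
    simp only [LinearEquiv.trans_apply, LinearEquiv.symm_apply_apply, LinearEquiv.prodCongr_apply,
      ← hT₁.1, ← hT₂.1]
    have e1 := ip_parityPart v₁.2 w₂.2
    have e2 : R.ip (v₂ : V) w₁ = 0 := by rw [← R.ip_symm, ip_parityPart w₁.2 v₂.2, map_zero]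
    rw [hD, hD, map_add, map_add, LinearMap.add_apply, LinearMap.add_apply, e1, e2,
      add_zero, zero_add]
    rfl
  · obtain ⟨⟨v₁, v₂⟩, rfl⟩ := D.surjective v
    have : R.act b (D (v₁, v₂)) = D (R.subAct _ (parityPart_act hc 0) b v₁,
        R.subAct _ (parityPart_act hc 1) b v₂) := by
      rw [hD, hD, map_add]
      rfl
    rw [this]
    simp only [LinearEquiv.trans_apply, LinearEquiv.symm_apply_apply, LinearEquiv.prodCongr_apply,
      ← hT₁.2.1, ← hT₂.2.1]
    rfl
  · obtain ⟨⟨v₁, v₂⟩, rfl⟩ := D.surjective v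
    have : R.actDual ω (D (v₁, v₂)) =
        D ((R.subrep _ (parityPart_act hc 0) (parityPart_coact 0)).actDual ω v₁,
          (R.subrep _ (parityPart_act hc 1) (parityPart_coact 1)).actDual ω v₂) := by
      rw [hD, hD, map_add, actDual_subrep, actDual_subrep]
    rw [this]
    simp only [LinearEquiv.trans_apply, LinearEquiv.symm_apply_apply, LinearEquiv.prodCongr_apply,
      ← hT₁.2.2, ← hT₂.2.2]

end Parity

end UnitaryDKRep

/-! ### The induced action on functionals. -/

section InducedAction

variable (q : ℝ) [hq : Fact (q ∈ Set.Ioo (0 : ℝ) 1)] (a : ℝ)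

/-- The operators `ω ↦ ω(S⁻¹(x) -)` as a homomorphism. -/
def leftTransHom : OqSU2 q →ₐ[ℂ] Module.End ℂ (OqSO2 q a →ₗ[ℂ] ℂ) :=
  AlgHom.ofLinearMap (leftTrans q a)
    (by
      ext ω c
      have h : antipodeInv q 1 = 1 := by simpa using antipodeInv_algebraMap q 1
      change ω (actC q a (antipodeInv q 1) _) = ω _
      rw [h, actC_one]
      rfl)
    (fun x y => by
      refine LinearMap.ext fun ω => LinearMap.ext fun c => ?_
      change ω (actC q a (antipodeInv q (x * y)) c) =
        ω (actC q a (antipodeInv q y) (actC q a (antipodeInv q x) c))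
      rw [antipodeInv_mul, actC_mul_apply])

theorem leftTransHom_apply (x : OqSU2 q) (ω : OqSO2 q a →ₗ[ℂ] ℂ) (c : OqSO2 q a) :
    leftTransHom q a x ω c = ω (actC q a (antipodeInv q x) c) := rfl

/-- The operators `π_g(x)` as a homomorphism. -/
def piGHom : OqSU2 q →ₐ[ℂ] Module.End ℂ (OqSO2 q a →ₗ[ℂ] ℂ) :=
  ((Algebra.TensorProduct.lid ℂ _).toAlgHom.comp
    (Algebra.TensorProduct.map (pairGHalf q) (leftTransHom q a))).comp
      (Bialgebra.comulAlgHom ℂ (OqSU2 q))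

/-- The action of the Podleś sphere on the full dual of `C` induced from a character. -/
def inducedHom (χ : Podles q a →⋆ₐ[ℂ] ℂ) :
    Podles q a →ₐ[ℂ] Module.End ℂ (OqSO2 q a →ₗ[ℂ] ℂ) :=
  ((Algebra.TensorProduct.lid ℂ _).toAlgHom.comp
    (Algebra.TensorProduct.map χ.toAlgHom (piGHom q a))).comp (podlesCoact q a)

theorem pairGHalf_U (i j : Fin 2) : pairGHalf q (U q i j) =
    !![((q ^ (-(1 / 2) : ℝ) : ℝ) : ℂ), 0; 0, (((q ^ (-(1 / 2) : ℝ) : ℝ) : ℂ))⁻¹] i j := by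
  rw [pairGHalf, torusChar_U]
  simp [qUnit]

/-- The character g^(1/2) vanishes off the diagonal, so one term of the comultiplication survives.
For U* the antipode reverses the tensor factors, and the surviving index in `piGHom_adjMat` is j. -/
theorem piGHom_U (i j : Fin 2) : piGHom q a (U q i j) =
    pairGHalf q (U q i i) • leftTransHom q a (U q i j) := by
  have : piGHom q a (U q i j) = pairGHalf q (U q i 0) • leftTransHom q a (U q 0 j) +
      pairGHalf q (U q i 1) • leftTransHom q a (U q 1 j) := by
    change TensorProduct.lid ℂ _ (Algebra.TensorProduct.map (pairGHalf q) (leftTransHom q a)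
      (comul (R := ℂ) (U q i j))) = _
    rw [comul_U, map_add, map_add]
    rfl
  rw [this]
  fin_cases i <;> simp [pairGHalf_U]

theorem piGHom_adjMat (i j : Fin 2) : piGHom q a (adjMat q (U q) i j) =
    pairGHalf q (adjMat q (U q) j j) • leftTransHom q a (adjMat q (U q) i j) := by
  fin_cases i <;> fin_cases j <;> simp [adjMat, piGHom_U, pairGHalf_U, -Complex.coe_smul] <;> rw [smul_comm]

theorem antipodeInv_adjMat (i j : Fin 2) : antipodeInv q (adjMat q (U q) i j) = U q i j := by
  rw [← antipodeLin_U, antipodeInv_antipode]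

/-- The values of the character `χ * g ^ (1/2)` on the generators. -/
def chiMat (z t : ℂ) : Matrix (Fin 2) (Fin 2) ℂ :=
  !![0, q * starRingEnd ℂ z; (q : ℂ)⁻¹ * z, -t]

variable {q a}

/-- The two half powers of g multiply to q at (0,1), to q⁻¹ at (1,0) and cancel on the diagonal. The
value -t at (1,1) is forced by the quantum trace and χ(Z_t) = 0. -/
theorem chi_podlesGen {χ : Podles q a →⋆ₐ[ℂ] ℂ} {z : ℂ} (hχ : IsPodlesChar q a χ z) (i j : Fin 2) :
    χ (podlesGen q a i j) * (pairGHalf q (adjMat q (U q) i i) * pairGHalf q (U q j j)) =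
      chiMat q z (qDiff q a) i j := by
  obtain ⟨h0, h1, h2⟩ := hχ
  rw [podlesX_eq] at h1
  rw [podlesY_eq] at h2
  rw [podlesZ_eq, map_smul, smul_eq_mul, mul_eq_zero] at h0
  have h00 := h0.resolve_left (cq_ne_zero q)
  have h11 : χ (podlesGen q a 1 1) = -(qDiff q a : ℂ) := by
    rw [podlesGen_trace, map_sub, map_smul, map_smul, map_one, h00]
    simp
  have hs : ((q ^ (-(1 / 2) : ℝ) : ℝ) : ℂ) * ((q ^ (-(1 / 2) : ℝ) : ℝ) : ℂ) = (q : ℂ)⁻¹ := by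
    rw [← Complex.ofReal_mul, ← Real.rpow_add hq.out.1, ← Complex.ofReal_inv,
      ← Real.rpow_neg_one]
    norm_num
  have hs0 : ((q ^ (-(1 / 2) : ℝ) : ℝ) : ℂ) ≠ 0 := by
    exact_mod_cast (Real.rpow_pos_of_pos hq.out.1 _).ne'
  have hs' : (((q ^ (-(1 / 2) : ℝ) : ℝ) : ℂ))⁻¹ * (((q ^ (-(1 / 2) : ℝ) : ℝ) : ℂ))⁻¹ = q := by
    rw [← mul_inv, hs, inv_inv]
  fin_cases i <;> fin_cases j <;>
    simp only [adjMat, chiMat, Fin.zero_eta, Fin.mk_one, Matrix.of_apply, Matrix.cons_val',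
      Matrix.cons_val_zero, Matrix.cons_val_one, Matrix.cons_val_fin_one, h00, h1, h2, h11,
      pairGHalf_U, zero_mul, hs, hs', mul_inv_cancel₀ hs0, inv_mul_cancel₀ hs0, mul_one] <;>
    ring

/-- The inverse antipode reverses the product of an entry of U* = S(U) with an entry of U and turns
the former back into an entry of U. -/
theorem inducedHom_podlesGen {χ : Podles q a →⋆ₐ[ℂ] ℂ} {z : ℂ} (hχ : IsPodlesChar q a χ z)
    (i j : Fin 2) (ω : OqSO2 q a →ₗ[ℂ] ℂ) (c : OqSO2 q a) :
    inducedHom q a χ (podlesGen q a i j) ω c = ∑ k, ∑ l, chiMat q z (qDiff q a) k l *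
      ω (actC q a (antipodeInv q (U q l j)) (actC q a (U q i k) c)) := by
  have h1 : inducedHom q a χ (podlesGen q a i j) = ∑ k, ∑ l, χ (podlesGen q a k l) •
      piGHom q a (adjMat q (U q) i k * U q l j) := by
    change TensorProduct.lid ℂ _ (Algebra.TensorProduct.map χ.toAlgHom (piGHom q a)
      (podlesCoact q a (podlesGen q a i j))) = _
    rw [podlesCoact_podlesGen, map_sum, map_sum]
    refine Finset.sum_congr rfl fun k _ => ?_
    rw [map_sum, map_sum]
    rfl
  rw [h1]
  simp only [LinearMap.sum_apply, LinearMap.smul_apply]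
  refine Finset.sum_congr rfl fun k _ => Finset.sum_congr rfl fun l _ => ?_
  rw [map_mul, piGHom_adjMat, piGHom_U, ← chi_podlesGen hχ]
  simp only [Module.End.mul_apply, LinearMap.smul_apply, map_smul, smul_eq_mul, leftTransHom_apply,
    antipodeInv_adjMat]
  ring

/-- The coefficient of the raising operator of the induced representation at the weight `x`. -/
def indUp (q : ℝ) (z t x : ℂ) : ℂ :=
  (q : ℂ)⁻¹ * (t - Complex.I * starRingEnd ℂ z * (q * x)⁻¹ - Complex.I * z * (q * x)) /
    ((q * x + (q * x)⁻¹) * (q ^ 2 * x + (q ^ 2 * x)⁻¹))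

/-- The coefficient of the lowering operator of the induced representation at the weight `x`. -/
def indDown (q : ℝ) (z t x : ℂ) : ℂ :=
  (q : ℂ)⁻¹ * (t + Complex.I * z * ((q : ℂ)⁻¹ * x)⁻¹ +
      Complex.I * starRingEnd ℂ z * ((q : ℂ)⁻¹ * x)) /
    (((q : ℂ)⁻¹ * x + ((q : ℂ)⁻¹ * x)⁻¹) * (((q : ℂ) ^ 2)⁻¹ * x + (((q : ℂ) ^ 2)⁻¹ * x)⁻¹))

/-- The Casimir value appears here: the weight-preserving part has the universal form `gZero` with λ
= i(z - conj z). Raising moves ω from g_(m-2) to g_m, which is why the raising coefficients are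
taken at m - 2. -/
theorem inducedHom_glike {χ : Podles q a →⋆ₐ[ℂ] ℂ} {z : ℂ} (hχ : IsPodlesChar q a χ z)
    (i j : Fin 2) (ω : OqSO2 q a →ₗ[ℂ] ℂ) (m : ℤ) :
    inducedHom q a χ (podlesGen q a i j) ω (glike q a m) =
      gUp q (wt q a (m - 2)) i j * indUp q z (qDiff q a) (wt q a (m - 2)) * ω (glike q a (m - 2)) +
      gDown q (wt q a (m + 2)) i j * indDown q z (qDiff q a) (wt q a (m + 2)) *
        ω (glike q a (m + 2)) +
      gZero q (qDiff q a) (Complex.I * (z - starRingEnd ℂ z)) (wt q a m) i j * ω (glike q a m) := by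
  rw [inducedHom_podlesGen hχ]
  have hq0 := cq_ne_zero q
  have hx := wt_ne_zero q a m
  have h1 := wt_sq_add_one_ne_zero q a m
  have h2 := q_sq_mul_wt_sq_add_one_ne_zero q a m
  have h3 := wt_sq_add_q_sq_ne_zero q a m
  have h2' : wt q a m ^ 2 * (q : ℂ) ^ 2 + 1 ≠ 0 := by rwa [mul_comm]
  have h3' : (q : ℂ) ^ 2 + wt q a m ^ 2 ≠ 0 := by rwa [add_comm]
  simp only [actC_U_glike, map_add, map_smul, actC_antipodeInv_glike, Fin.sum_univ_two]
  rw [show m + 1 + 1 = m + 2 by ring, show m + 1 - 1 = m by ring, show m - 1 + 1 = m by ring,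
    show m - 1 - 1 = m - 2 by ring, wt_add_one, wt_sub_one, wt_add_two, wt_sub_two]
  generalize ω (glike q a (m + 2)) = r1
  generalize ω (glike q a (m - 2)) = r2
  generalize ω (glike q a m) = r3
  generalize (qDiff q a : ℂ) = t
  generalize hzz : starRingEnd ℂ z = zz
  generalize wt q a m = x at *
  fin_cases i <;> fin_cases j <;>
    simp only [gUp, gDown, gZero, gZeroL, gZeroR, upU, downU, upUinv, downUinv, chiMat, indUp,
      indDown, hzz, Fin.zero_eta,
      Fin.mk_one, Matrix.of_apply, Matrix.cons_val', smul_eq_mul,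
      Matrix.cons_val_zero, Matrix.cons_val_one, Matrix.cons_val_fin_one] <;>
    generalize (q : ℂ) = p at *
  · field_simp
    ring_nf
    simp [Complex.I_sq, Complex.I_pow_three, Complex.I_pow_four]
    ring
  · field_simp
    ring_nf
    simp [Complex.I_sq, Complex.I_pow_three, Complex.I_pow_four]
    ring
  · field_simp
    ring_nf
    simp [Complex.I_sq, Complex.I_pow_three, Complex.I_pow_four]
    ring
  · field_simp
    ring_nf

end InducedAction

/-! ### Compatibility of the coefficient matrices with the coaction. -/

section ShiftIdentities

variable (q : ℝ) [hq : Fact (q ∈ Set.Ioo (0 : ℝ) 1)] (a : ℝ)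

/-- If the generators act by the matrix of coefficients `M` between two weight vectors, then the
compatibility with the coaction at the weight `[a + n]` shifts the weight by `2 * s`. -/
structure IsShift (s : ℤ) (n : ℤ) (M : Matrix (Fin 2) (Fin 2) ℂ) : Prop where
  up : upUstar q (wt q a (n + 1)) * M * upU (wt q a n) = if s = 1 then M else 0
  zero : downUstar q (wt q a (n + 1)) * M * upU (wt q a n) +
    upUstar q (wt q a (n - 1)) * M * downU (wt q a n) = if s = 0 then M else 0
  down : downUstar q (wt q a (n - 1)) * M * downU (wt q a n) = if s = -1 then M else 0

/-- The matrix is the column (1, i q² x) times the row (1, i x⁻¹). The row is fixed by `upU` and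
killed by `downU` at x; the column is fixed by `upUstar` and killed by `downUstar` at qx. -/
theorem isShift_gUp (n : ℤ) : IsShift q a 1 n (gUp q (wt q a n)) := by
  have hq0 := cq_ne_zero q
  have hx := wt_ne_zero q a n
  have h1 := wt_sq_add_one_ne_zero q a n
  have h2 := q_sq_mul_wt_sq_add_one_ne_zero q a n
  have h3 := wt_sq_add_q_sq_ne_zero q a n
  have h2' : wt q a n ^ 2 * (q : ℂ) ^ 2 + 1 ≠ 0 := by rwa [mul_comm]
  have h3' : (q : ℂ) ^ 2 + wt q a n ^ 2 ≠ 0 := by rwa [add_comm]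
  constructor <;> simp only [wt_add_one, wt_sub_one]
  all_goals
    generalize wt q a n = x at *
    ext i j
    fin_cases i <;> fin_cases j <;>
    simp only [gUp, upU, downU, upUstar, downUstar, Matrix.mul_apply, Matrix.add_apply,
      Fin.sum_univ_two, Fin.zero_eta, Fin.mk_one,
      Matrix.of_apply, Matrix.cons_val', Matrix.zero_apply, Matrix.cons_val_zero,
      Matrix.cons_val_one, Matrix.cons_val_fin_one, if_true, one_ne_zero, if_false,
      show ¬ (1 : ℤ) = -1 by decide] <;>
    generalize (q : ℂ) = p at * <;>
    field_simp <;> ring_nf <;>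
    simp [Complex.I_sq, Complex.I_pow_three, Complex.I_pow_four] <;> ring

theorem isShift_gDown (n : ℤ) : IsShift q a (-1) n (gDown q (wt q a n)) := by
  have hq0 := cq_ne_zero q
  have hx := wt_ne_zero q a n
  have h1 := wt_sq_add_one_ne_zero q a n
  have h2 := q_sq_mul_wt_sq_add_one_ne_zero q a n
  have h3 := wt_sq_add_q_sq_ne_zero q a n
  have h2' : wt q a n ^ 2 * (q : ℂ) ^ 2 + 1 ≠ 0 := by rwa [mul_comm]
  have h3' : (q : ℂ) ^ 2 + wt q a n ^ 2 ≠ 0 := by rwa [add_comm]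
  constructor <;> simp only [wt_add_one, wt_sub_one]
  all_goals
    generalize wt q a n = x at *
    ext i j
    fin_cases i <;> fin_cases j <;>
    simp only [gDown, upU, downU, upUstar, downUstar, Matrix.mul_apply, Matrix.add_apply,
      Fin.sum_univ_two, Fin.zero_eta, Fin.mk_one,
      Matrix.of_apply, Matrix.cons_val', Matrix.zero_apply, Matrix.cons_val_zero,
      Matrix.cons_val_one, Matrix.cons_val_fin_one, if_true, one_ne_zero, if_false,
      show ¬ (-1 : ℤ) = 1 by decide, show ¬ (-1 : ℤ) = 0 by decide] <;>
    generalize (q : ℂ) = p at * <;>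
    field_simp <;> ring_nf <;>
    simp [Complex.I_sq, Complex.I_pow_three, Complex.I_pow_four] <;> ring

/-- The summand with `gZeroL` is the column (1, i x) times the row (1, -i x), a step down by U
followed by a step up by U*; the one with `gZeroR` is (1, -i x⁻¹) times (1, i x⁻¹), up and then
down. The identity holds for arbitrary coefficients of the two. -/
theorem isShift_gZero (t lam : ℂ) (n : ℤ) : IsShift q a 0 n (gZero q t lam (wt q a n)) := by
  have hq0 := cq_ne_zero q
  have hx := wt_ne_zero q a n
  have h1 := wt_sq_add_one_ne_zero q a n
  have h2 := q_sq_mul_wt_sq_add_one_ne_zero q a n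
  have h3 := wt_sq_add_q_sq_ne_zero q a n
  have h2' : wt q a n ^ 2 * (q : ℂ) ^ 2 + 1 ≠ 0 := by rwa [mul_comm]
  have h3' : (q : ℂ) ^ 2 + wt q a n ^ 2 ≠ 0 := by rwa [add_comm]
  constructor <;> simp only [wt_add_one, wt_sub_one]
  all_goals
    generalize wt q a n = x at *
    ext i j
    fin_cases i <;> fin_cases j <;>
    simp only [gZero, upU, downU, upUstar, downUstar, Matrix.mul_apply, Matrix.add_apply,
      Fin.sum_univ_two, Fin.zero_eta, Fin.mk_one,
      Matrix.of_apply, Matrix.cons_val', Matrix.zero_apply, Matrix.cons_val_zero,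
      Matrix.cons_val_one, Matrix.cons_val_fin_one, if_true, zero_ne_one, if_false,
      show ¬ (0 : ℤ) = -1 by decide] <;>
    generalize gZeroL q t lam x = r <;>
    generalize gZeroR q t lam x = s <;>
    generalize (q : ℂ) = p at * <;>
    field_simp <;> ring_nf <;>
    simp [Complex.I_sq, Complex.I_pow_three, Complex.I_pow_four] <;> ring

end ShiftIdentities

theorem Module.Basis.induction_on {ι K V : Type*} [Semiring K] [AddCommMonoid V] [Module K V]
    (b : Module.Basis ι K V) {P : V → Prop} (h0 : P 0) (hadd : ∀ v w, P v → P w → P (v + w))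
    (hsmul : ∀ (c : K) v, P v → P (c • v)) (hb : ∀ i, P (b i)) (v : V) : P v := by
  have hv : v ∈ Submodule.span K (Set.range b) := b.mem_span v
  induction hv using Submodule.span_induction with
  | mem x hx => obtain ⟨i, rfl⟩ := hx; exact hb i
  | zero => exact h0
  | add x y _ _ hx hy => exact hadd _ _ hx hy
  | smul c x _ hx => exact hsmul _ _ hx

theorem tensorAct_mul {q : ℝ} [Fact (q ∈ Set.Ioo (0 : ℝ) 1)] {a : ℝ} {V : Type*} [AddCommGroup V]
    [Module ℂ V] (act : Podles q a →ₐ[ℂ] Module.End ℂ V) (X Y : Podles q a ⊗[ℂ] OqSU2 q) :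
    tensorAct q a act (X * Y) = tensorAct q a act X * tensorAct q a act Y := by
  induction X with
  | zero => simp
  | add X₁ X₂ h₁ h₂ => rw [add_mul, map_add, h₁, h₂, map_add, add_mul]
  | tmul b x =>
    induction Y with
    | zero => simp
    | add X₁ X₂ h₁ h₂ => rw [mul_add, map_add, h₁, h₂, map_add, mul_add]
    | tmul c y =>
      refine TensorProduct.ext' fun v d => ?_
      simp [tensorAct, actC_mul_apply]

/-! ### Sesquilinear forms with an orthogonal basis. -/

section DiagonalForm

variable {ι V : Type*} [AddCommGroup V] [Module ℂ V]

/-- The sesquilinear form for which the basis `b` is orthogonal with squared norms `N`. -/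
def Module.Basis.diagForm (b : Module.Basis ι ℂ V) (N : ι → ℝ) : V →ₗ⋆[ℂ] V →ₗ[ℂ] ℂ where
  toFun v := b.constr ℂ fun n => (N n : ℂ) * starRingEnd ℂ (b.repr v n)
  map_add' v w := b.ext fun n => by simp [mul_add]
  map_smul' c v := b.ext fun n => by simp [mul_left_comm]

variable (b : Module.Basis ι ℂ V) (N : ι → ℝ)

theorem Module.Basis.diagForm_eq_finsum (v w : V) : b.diagForm N v w =
    ∑ᶠ n, (N n : ℂ) * (starRingEnd ℂ (b.repr v n) * b.repr w n) := by
  change b.constr ℂ _ w = _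
  rw [b.constr_apply, Finsupp.sum, finsum_eq_sum_of_support_subset (s := (b.repr w).support)]
  · exact Finset.sum_congr rfl fun n _ => by rw [smul_eq_mul]; ring
  · intro n hn
    rw [Finset.mem_coe, Finsupp.mem_support_iff]
    rintro h
    simp [h] at hn

theorem Module.Basis.diagForm_eq_sum (v w : V) : b.diagForm N v w =
    ∑ n ∈ (b.repr v).support, (N n : ℂ) * (starRingEnd ℂ (b.repr v n) * b.repr w n) := by
  rw [b.diagForm_eq_finsum, finsum_eq_sum_of_support_subset]
  intro n hn
  rw [Finset.mem_coe, Finsupp.mem_support_iff]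
  rintro h
  simp [h] at hn

theorem Module.Basis.diagForm_symm (v w : V) :
    starRingEnd ℂ (b.diagForm N v w) = b.diagForm N w v := by
  rw [b.diagForm_eq_sum, map_sum, b.diagForm_eq_finsum,
    finsum_eq_sum_of_support_subset (s := (b.repr v).support)]
  · exact Finset.sum_congr rfl fun n _ => by
      rw [map_mul, map_mul, Complex.conj_ofReal, Complex.conj_conj]; ring
  · intro n hn
    rw [Finset.mem_coe, Finsupp.mem_support_iff]
    rintro h
    simp [h] at hn

theorem Module.Basis.diagForm_pos {N : ι → ℝ} (hN : ∀ n, 0 < N n) (v : V) (hv : v ≠ 0) :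
    0 < (b.diagForm N v v).re := by
  rw [b.diagForm_eq_sum, Complex.re_sum]
  have hs : (b.repr v).support.Nonempty := by
    rw [Finsupp.support_nonempty_iff]
    simpa using hv
  refine Finset.sum_pos (fun n hn => ?_) hs
  rw [mul_comm (starRingEnd ℂ _), Complex.mul_conj, ← Complex.ofReal_mul, Complex.ofReal_re]
  exact mul_pos (hN n) (Complex.normSq_pos.2 (Finsupp.mem_support_iff.1 hn))

theorem Module.Basis.diagForm_basis [DecidableEq ι] (m n : ι) :
    b.diagForm N (b m) (b n) = if m = n then (N n : ℂ) else 0 := by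
  change b.constr ℂ _ (b n) = _
  rw [b.constr_basis, b.repr_self, Finsupp.single_apply]
  split_ifs <;> simp

end DiagonalForm

/-! ### Adjoint relations between the coefficient matrices. -/

section Conjugation

variable (q : ℝ) [hq : Fact (q ∈ Set.Ioo (0 : ℝ) 1)] (a : ℝ)

theorem conj_gDown (i j : Fin 2) (n : ℤ) :
    starRingEnd ℂ (gDown q ((q : ℂ) ^ 2 * wt q a n) j i) = gUp q (wt q a n) i j := by
  have hq0 := cq_ne_zero q
  have hx := wt_ne_zero q a n
  fin_cases i <;> fin_cases j <;> simp [gDown, gUp, conj_wt] <;> field_simp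

theorem conj_gZeroL {lam : ℂ} (hlam : starRingEnd ℂ lam = lam) (n : ℤ) :
    starRingEnd ℂ (gZeroL q (qDiff q a) lam (wt q a n)) =
      gZeroL q (qDiff q a) lam (wt q a n) := by
  simp [gZeroL, conj_wt, hlam]

theorem conj_gZeroR {lam : ℂ} (hlam : starRingEnd ℂ lam = lam) (n : ℤ) :
    starRingEnd ℂ (gZeroR q (qDiff q a) lam (wt q a n)) =
      gZeroR q (qDiff q a) lam (wt q a n) := by
  simp [gZeroR, conj_wt, hlam]

theorem conj_gZero {lam : ℂ} (n : ℤ) (hlam : starRingEnd ℂ lam = lam) (i j : Fin 2) :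
    starRingEnd ℂ (gZero q (qDiff q a) lam (wt q a n) j i) =
      gZero q (qDiff q a) lam (wt q a n) i j := by
  fin_cases i <;> fin_cases j <;>
    simp [gZero, conj_wt, conj_gZeroL q a hlam, conj_gZeroR q a hlam] <;> ring

end Conjugation

/-! ### Unitary representations built from a basis of weight vectors. -/

section WeightBasisRep

variable {q : ℝ} [hq : Fact (q ∈ Set.Ioo (0 : ℝ) 1)] {a : ℝ}
variable {V : Type*} [AddCommGroup V] [Module ℂ V]

/-- An action of the Podleś sphere on a space with a basis of weight vectors, by raising and
lowering operators and at the Casimir value `lam`. -/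
structure IsWeightAction (act : Podles q a →ₐ[ℂ] Module.End ℂ V) (b : Module.Basis ℤ ℂ V)
    (u d : ℤ → ℂ) (lam : ℂ) : Prop where
  act_basis : ∀ i j n, act (podlesGen q a i j) (b n) =
    (gUp q (wt q a n) i j * u n) • b (n + 2) + (gDown q (wt q a n) i j * d n) • b (n - 2) +
      gZero q (qDiff q a) lam (wt q a n) i j • b n

/-- The coaction for which `b` is a basis of weight vectors. -/
def weightCoact (q : ℝ) [hq : Fact (q ∈ Set.Ioo (0 : ℝ) 1)] (a : ℝ) (b : Module.Basis ℤ ℂ V) :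
    V →ₗ[ℂ] V ⊗[ℂ] OqSO2 q a :=
  b.constr ℂ fun n => b n ⊗ₜ glike q a n

theorem weightCoact_basis (b : Module.Basis ℤ ℂ V) (n : ℤ) :
    weightCoact q a b (b n) = b n ⊗ₜ glike q a n := by
  rw [weightCoact, b.constr_basis]

namespace IsWeightAction

variable {act : Podles q a →ₐ[ℂ] Module.End ℂ V} {b : Module.Basis ℤ ℂ V} {u d : ℤ → ℂ} {lam : ℂ}

theorem tensorAct_podlesGen (i j : Fin 2) (v : V) (n : ℤ) :
    tensorAct q a act (podlesCoact q a (podlesGen q a i j)) (v ⊗ₜ glike q a n) =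
      ∑ k, ∑ l, act (podlesGen q a k l) v ⊗ₜ
        ((upUstar q (wt q a (n + 1)) i k * upU (wt q a n) l j) • glike q a (n + 2) +
        (downUstar q (wt q a (n + 1)) i k * upU (wt q a n) l j +
          upUstar q (wt q a (n - 1)) i k * downU (wt q a n) l j) • glike q a n +
        (downUstar q (wt q a (n - 1)) i k * downU (wt q a n) l j) • glike q a (n - 2)) := by
  rw [podlesCoact_podlesGen]
  simp only [map_sum, LinearMap.sum_apply]
  refine Finset.sum_congr rfl fun k _ => Finset.sum_congr rfl fun l _ => ?_
  change act (podlesGen q a k l) v ⊗ₜ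
    actC q a (adjMat q (U q) i k * U q l j) (glike q a n) = _
  congr 1
  rw [actC_mul_apply, actC_U_glike, map_add, map_smul, map_smul, actC_adjMat_glike,
    actC_adjMat_glike, show n + 1 + 1 = n + 2 by ring, show n + 1 - 1 = n by ring,
    show n - 1 + 1 = n by ring, show n - 1 - 1 = n - 2 by ring]
  module

/-- The three matrix identities of `IsShift` are the coefficients of g_(n+2), g_n and g_(n-2); at
most one of them is nonzero, the one selected by s. -/
theorem sum_shift {s n : ℤ} {M : Matrix (Fin 2) (Fin 2) ℂ} (h : IsShift q a s n M)
    (hs : s = 1 ∨ s = 0 ∨ s = -1) (i j : Fin 2) (c : ℂ) (w : V) :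
    ∑ k, ∑ l, ((M k l * c) • w) ⊗ₜ[ℂ]
        ((upUstar q (wt q a (n + 1)) i k * upU (wt q a n) l j) • glike q a (n + 2) +
        (downUstar q (wt q a (n + 1)) i k * upU (wt q a n) l j +
          upUstar q (wt q a (n - 1)) i k * downU (wt q a n) l j) • glike q a n +
        (downUstar q (wt q a (n - 1)) i k * downU (wt q a n) l j) • glike q a (n - 2)) =
      ((M i j * c) • w) ⊗ₜ[ℂ] glike q a (n + 2 * s) := by
  have h1 := congrFun (congrFun h.up i) j
  have h2 := congrFun (congrFun h.zero i) j
  have h3 := congrFun (congrFun h.down i) j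
  simp only [Matrix.add_apply, Matrix.mul_apply, Fin.sum_univ_two] at h1 h2 h3
  have key : ((M i j * c) • w) ⊗ₜ[ℂ] glike q a (n + 2 * s) =
      (c * (if s = 1 then M else 0) i j) • (w ⊗ₜ[ℂ] glike q a (n + 2)) +
      (c * (if s = 0 then M else 0) i j) • (w ⊗ₜ[ℂ] glike q a n) +
      (c * (if s = -1 then M else 0) i j) • (w ⊗ₜ[ℂ] glike q a (n - 2)) := by
    rcases hs with rfl | rfl | rfl
    · simp [← TensorProduct.smul_tmul', mul_comm c]
    · simp [← TensorProduct.smul_tmul', mul_comm c]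
    · simp [← TensorProduct.smul_tmul', mul_comm c, sub_eq_add_neg]
  rw [key, ← h1, ← h2, ← h3]
  simp only [Fin.sum_univ_two, TensorProduct.tmul_add, TensorProduct.tmul_smul,
    ← TensorProduct.smul_tmul']
  module

/-- Both sides are multiplicative in x, so generators suffice. On a basis vector the action has
three pieces, each of which satisfies its own shift identity. -/
theorem coact_act (h : IsWeightAction act b u d lam) (x : Podles q a) (v : V) :
    weightCoact q a b (act x v) = tensorAct q a act (podlesCoact q a x) (weightCoact q a b v) := by
  induction x using Podles.induction_on generalizing v with
  | hE i j =>
    induction v using b.induction_on with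
    | h0 => simp
    | hadd v w hv hw => simp only [map_add, hv, hw]
    | hsmul c v hv => simp only [map_smul, hv]
    | hb n =>
      rw [weightCoact_basis, tensorAct_podlesGen]
      simp only [h.act_basis, TensorProduct.add_tmul, Finset.sum_add_distrib]
      have e0 := sum_shift (isShift_gZero q a (qDiff q a) lam n) (by simp) i j 1 (b n)
      simp only [mul_one] at e0
      rw [sum_shift (isShift_gUp q a n) (by simp), sum_shift (isShift_gDown q a n) (by simp), e0]
      simp [weightCoact_basis, TensorProduct.smul_tmul', sub_eq_add_neg]
  | hs c =>
    rw [AlgHom.commutes, AlgHom.commutes, Algebra.algebraMap_eq_smul_one,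
      Algebra.algebraMap_eq_smul_one, map_smul, LinearMap.smul_apply, LinearMap.smul_apply,
      map_smul]
    congr 1
    rw [Algebra.TensorProduct.one_def]
    change _ = TensorProduct.map (act 1) (actC q a 1) (weightCoact q a b v)
    rw [map_one, actC_one]
    exact (LinearMap.congr_fun TensorProduct.map_id _).symm
  | ha x y hx hy => simp only [map_add, LinearMap.add_apply, hx, hy]
  | hm x y hx hy =>
    rw [map_mul, map_mul, tensorAct_mul, Module.End.mul_apply, Module.End.mul_apply, hx, hy]

/-- The matrices already satisfy the adjoint relations (`conj_gDown`, `conj_gZero` for real λ), so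
`hN` is the one remaining condition: raising and lowering coefficients are adjoint for the norms N.
-/
theorem diagForm_act {N : ℤ → ℝ} (h : IsWeightAction act b u d lam)
    (hlam : starRingEnd ℂ lam = lam)
    (hN : ∀ n, (N (n + 2) : ℂ) * u n = starRingEnd ℂ ((N n : ℂ) * d (n + 2))) (x : Podles q a)
    (v w : V) : b.diagForm N v (act x w) = b.diagForm N (act (star x) v) w := by
  induction x using Podles.induction_on generalizing v w with
  | hE i j =>
    rw [star_podlesGen]
    induction v using b.induction_on with
    | h0 => simp
    | hadd v v' hv hv' => simp only [map_add, LinearMap.add_apply, hv, hv']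
    | hsmul c v hv => simp only [map_smulₛₗ, LinearMap.smul_apply, RingHom.id_apply, hv]
    | hb m =>
      induction w using b.induction_on with
      | h0 => simp
      | hadd v v' hv hv' => simp only [map_add, hv, hv']
      | hsmul c v hv => simp only [map_smul, hv]
      | hb n =>
        rw [h.act_basis, h.act_basis]
        simp only [map_add, map_smulₛₗ, LinearMap.add_apply, LinearMap.smul_apply,
          RingHom.id_apply, b.diagForm_basis, smul_eq_mul]
        by_cases h1 : m = n + 2
        · subst h1
          have hN' := hN n
          rw [map_mul, Complex.conj_ofReal] at hN'
          rw [if_pos rfl, if_neg (by omega), if_neg (by omega), if_neg (by omega),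
            if_pos (by omega), mul_zero, mul_zero, mul_zero, map_mul, wt_add_two, conj_gDown]
          linear_combination gUp q (wt q a n) i j * hN'
        by_cases h2 : n = m + 2
        · subst h2
          have hN' := congrArg (starRingEnd ℂ) (hN m)
          simp only [map_mul, Complex.conj_ofReal, Complex.conj_conj] at hN'
          have hg := congrArg (starRingEnd ℂ) (conj_gDown q a j i m)
          rw [Complex.conj_conj] at hg
          rw [if_neg (by omega), if_pos (by omega), if_neg (by omega), if_pos rfl,
            if_neg (by omega), map_mul, wt_add_two, hg, add_sub_cancel_right]
          linear_combination -starRingEnd ℂ (gUp q (wt q a m) j i) * hN'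
        by_cases h3 : m = n
        · subst h3
          rw [if_neg (by omega), if_neg (by omega), if_pos rfl, if_neg (by omega),
            if_neg (by omega), conj_gZero q a _ hlam]
          ring
        · rw [if_neg h1, if_neg (by omega), if_neg h3, if_neg (by omega), if_neg (by omega)]
          simp
  | hs c =>
    rw [← algebraMap_star_comm, AlgHom.commutes, AlgHom.commutes, Algebra.algebraMap_eq_smul_one,
      Algebra.algebraMap_eq_smul_one, LinearMap.smul_apply, LinearMap.smul_apply, map_smul,
      map_smulₛₗ, LinearMap.smul_apply]
    simp
  | ha x y hx hy => simp only [star_add, map_add, LinearMap.add_apply, hx, hy]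
  | hm x y hx hy =>
    rw [star_mul, map_mul, map_mul, Module.End.mul_apply, Module.End.mul_apply, hx, hy]

/-- The unitary representation given by an action on a space with a basis of weight vectors. -/
def toUnitaryDKRep {N : ℤ → ℝ} (h : IsWeightAction act b u d lam) (hpos : ∀ n, 0 < N n)
    (hlam : starRingEnd ℂ lam = lam)
    (hN : ∀ n, (N (n + 2) : ℂ) * u n = starRingEnd ℂ ((N n : ℂ) * d (n + 2))) :
    UnitaryDKRep q a V where
  ip := b.diagForm N
  ip_symm := b.diagForm_symm N
  ip_pos := b.diagForm_pos hpos
  act := act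
  coact := weightCoact q a b
  coassoc := b.ext fun n => by
    simp [weightCoact_basis, (glike_spec q a n).comul]
  counit_coact := b.ext fun n => by
    simp [weightCoact_basis, (glike_spec q a n).counit]
  coact_act := h.coact_act
  ip_act := h.diagForm_act hlam hN
  ip_coact v w := by
    induction v using b.induction_on with
    | h0 => simp
    | hadd v v' hv hv' =>
      rw [map_add, LinearMap.rTensor_add, LinearMap.add_apply, map_add, hv, hv']
      simp only [map_add]
    | hsmul c v hv =>
      rw [map_smulₛₗ, LinearMap.rTensor_smul, LinearMap.smul_apply, map_smul, hv]
      simp only [map_smul, map_smulₛₗ]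
    | hb m =>
      induction w using b.induction_on with
      | h0 => simp
      | hadd v v' hv hv' =>
        rw [map_add (b.diagForm N), LinearMap.rTensor_add, LinearMap.add_apply]
        simp only [map_add, hv, hv']
      | hsmul c v hv =>
        rw [map_smulₛₗ (b.diagForm N), LinearMap.rTensor_smul, LinearMap.smul_apply]
        simp only [map_smul, map_smulₛₗ, hv, Complex.conj_conj]
      | hb n =>
        simp only [weightCoact_basis, LinearMap.rTensor_tmul, TensorProduct.lid_tmul, map_smulₛₗ,
          (glike_spec q a m).dag, b.diagForm_basis]
        by_cases hmn : m = n
        · subst hmn; simp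
        · rw [if_neg hmn, if_neg (Ne.symm hmn)]; simp

variable {N : ℤ → ℝ} (h : IsWeightAction act b u d lam) (hpos : ∀ n, 0 < N n)
  (hlam : starRingEnd ℂ lam = lam)
  (hN : ∀ n, (N (n + 2) : ℂ) * u n = starRingEnd ℂ ((N n : ℂ) * d (n + 2)))

theorem isWt_basis (n : ℤ) : (h.toUnitaryDKRep hpos hlam hN).IsWt n (b n) :=
  weightCoact_basis b n

theorem wp_eq (n : ℤ) (v : V) : (h.toUnitaryDKRep hpos hlam hN).wp n v = b.repr v n • b n := by
  induction v using b.induction_on with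
  | h0 => simp
  | hadd v w hv hw => simp only [map_add, hv, hw, Finsupp.add_apply, add_smul]
  | hsmul c v hv => simp only [map_smul, hv, Finsupp.smul_apply, smul_assoc]
  | hb m =>
    rw [(h.isWt_basis hpos hlam hN m).wp, b.repr_self, Finsupp.single_apply]
    by_cases hm : n = m
    · subst hm; simp
    · rw [if_neg hm, if_neg (Ne.symm hm), zero_smul]

theorem exists_smul_of_isWt {n : ℤ} {v : V} (hv : (h.toUnitaryDKRep hpos hlam hN).IsWt n v) :
    ∃ c : ℂ, v = c • b n := by
  refine ⟨b.repr v n, ?_⟩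
  rw [← h.wp_eq hpos hlam hN, hv.wp, if_pos rfl]

/-- The Casimir combination of the entries of `gUp`, and of `gDown`, is zero, so u and d do not
matter; in `gZero` the same combination returns λ. -/
theorem casimir_eq : (h.toUnitaryDKRep hpos hlam hN).casimir = lam • LinearMap.id := by
  refine b.ext fun n => ?_
  have hq0 := cq_ne_zero q
  have hx := wt_ne_zero q a n
  have h1 := wt_sq_add_one_ne_zero q a n
  have h2 := q_sq_mul_wt_sq_add_one_ne_zero q a n
  have h3 := wt_sq_add_q_sq_ne_zero q a n
  have h2' : wt q a n ^ 2 * (q : ℂ) ^ 2 + 1 ≠ 0 := by rwa [mul_comm]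
  have h3' : (q : ℂ) ^ 2 + wt q a n ^ 2 ≠ 0 := by rwa [add_comm]
  rw [(h.isWt_basis hpos hlam hN n).casimir]
  change _ • act _ _ + _ • act _ _ - _ • act _ _ = _
  simp only [h.act_basis, gUp, gDown, gZero, gZeroL, gZeroR, Matrix.of_apply, Matrix.cons_val',
      Matrix.cons_val_zero, Matrix.cons_val_one, Matrix.cons_val_fin_one, LinearMap.smul_apply,
      LinearMap.id_apply]
  generalize wt q a n = x at *
  generalize (qDiff q a : ℂ) = t at *
  generalize (q : ℂ) = p at *
  match_scalars <;> field_simp <;> ring_nf <;>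
    simp [Complex.I_sq, Complex.I_pow_three, Complex.I_pow_four] <;> ring

theorem raise_basis (n : ℤ) : (h.toUnitaryDKRep hpos hlam hN).raise n (b n) = u n • b (n + 2) := by
  rw [UnitaryDKRep.raise, Module.End.mul_apply]
  change UnitaryDKRep.wp _ _ (act _ _) = _
  rw [h.act_basis]
  simp only [map_add, map_smul, h.wp_eq, b.repr_self, Finsupp.single_apply]
  simp [gUp, show ¬ (n - 2 = n + 2) by omega]

theorem actDual_basis (ω : OqSO2 q a →ₗ[ℂ] ℂ) (n : ℤ) :
    (h.toUnitaryDKRep hpos hlam hN).actDual ω (b n) = ω (glike q a n) • b n :=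
  (h.isWt_basis hpos hlam hN n).actDual ω

/-- Every weight space is a line spanned by a basis vector, on which raising is multiplication by u
up to the shift. -/
theorem isSeries_parityPart (e : ℤ) (hu : ∀ k, u (2 * k + e) ≠ 0) :
    ((h.toUnitaryDKRep hpos hlam hN).subrep _
      (UnitaryDKRep.parityPart_act (h.casimir_eq hpos hlam hN) e)
      (UnitaryDKRep.parityPart_coact e)).IsSeries e lam := by
  refine UnitaryDKRep.isSeries_parityPart (h.casimir_eq hpos hlam hN)
    (fun n => ⟨b n, b.ne_zero n, h.isWt_basis hpos hlam hN n⟩)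
    (fun n v w hv hw hv0 => ?_) e (fun k v hv hv0 => ?_)
  · obtain ⟨c, rfl⟩ := h.exists_smul_of_isWt hpos hlam hN hv
    obtain ⟨c', rfl⟩ := h.exists_smul_of_isWt hpos hlam hN hw
    have hc : c ≠ 0 := by rintro rfl; simp at hv0
    exact ⟨c' / c, by rw [smul_smul, div_mul_cancel₀ _ hc]⟩
  · obtain ⟨c, rfl⟩ := h.exists_smul_of_isWt hpos hlam hN hv
    have hc : c ≠ 0 := by rintro rfl; simp at hv0
    rw [map_smul, h.raise_basis]
    exact smul_ne_zero hc (smul_ne_zero (hu k) (b.ne_zero _))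

end IsWeightAction

end WeightBasisRep

/-! ### The restricted dual as finitely supported functions on the weights. -/

section RestrictedDual

variable (q : ℝ) [hq : Fact (q ∈ Set.Ioo (0 : ℝ) 1)] (a : ℝ)

/-- The values of an element of the restricted dual on the grouplike elements. -/
def restrictedDualEquiv : restrictedDual q a ≃ₗ[ℂ] ℤ →₀ ℂ where
  toFun y := Finsupp.ofSupportFinite (fun n => (y : OqSO2 q a →ₗ[ℂ] ℂ) (glike q a n))
    ((mem_restrictedDual_iff q a _).1 y.2)
  map_add' y z := by ext n; rfl
  map_smul' c y := by ext n; rfl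
  invFun f := ⟨(glikeBasis q a).constr ℂ f, by
    rw [mem_restrictedDual_iff]
    refine f.hasFiniteSupport.subset fun n hn => ?_
    rwa [Set.mem_ofPred_eq, ← glikeBasis_apply, Module.Basis.constr_basis] at hn⟩
  left_inv y := by
    refine Subtype.ext (dual_ext q a fun n => ?_)
    rw [← glikeBasis_apply, Module.Basis.constr_basis, glikeBasis_apply]
    rfl
  right_inv f := by
    ext n
    change (glikeBasis q a).constr ℂ f (glike q a n) = _
    rw [← glikeBasis_apply, Module.Basis.constr_basis]

/-- The basis of minimal projections of the restricted dual. -/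
def wprojBasis : Module.Basis ℤ ℂ (restrictedDual q a) :=
  Module.Basis.ofRepr (restrictedDualEquiv q a)

theorem wprojBasis_repr (y : restrictedDual q a) (n : ℤ) :
    (wprojBasis q a).repr y n = (y : OqSO2 q a →ₗ[ℂ] ℂ) (glike q a n) := rfl

theorem wprojBasis_apply (n : ℤ) :
    (wprojBasis q a n : OqSO2 q a →ₗ[ℂ] ℂ) = wproj q a n := by
  refine dual_ext q a fun m => ?_
  rw [← wprojBasis_repr, Module.Basis.repr_self, wproj_glike, Finsupp.single_apply]
  simp only [eq_comm]

end RestrictedDual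

/-! ### The induced representation in the basis of minimal projections. -/

section InducedRep

variable {q : ℝ} [hq : Fact (q ∈ Set.Ioo (0 : ℝ) 1)] {a : ℝ} {χ : Podles q a →⋆ₐ[ℂ] ℂ} {z : ℂ}

theorem inducedHom_wproj (hχ : IsPodlesChar q a χ z) (i j : Fin 2) (n : ℤ) :
    inducedHom q a χ (podlesGen q a i j) (wproj q a n) =
      (gUp q (wt q a n) i j * indUp q z (qDiff q a) (wt q a n)) • wproj q a (n + 2) +
      (gDown q (wt q a n) i j * indDown q z (qDiff q a) (wt q a n)) • wproj q a (n - 2) +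
      gZero q (qDiff q a) (Complex.I * (z - starRingEnd ℂ z)) (wt q a n) i j • wproj q a n := by
  refine dual_ext q a fun m => ?_
  rw [inducedHom_glike hχ]
  simp only [LinearMap.add_apply, LinearMap.smul_apply, wproj_glike, smul_eq_mul]
  by_cases h1 : m = n + 2
  · subst h1
    simp [show ¬(n + 2 + 2 = n) by omega, show ¬(n + 2 = n - 2) by omega]
  by_cases h2 : m = n - 2
  · subst h2
    simp [show ¬(n - 2 - 2 = n) by omega, show ¬(n - 2 = n + 2) by omega]
  rw [if_neg h1, if_neg h2, if_neg (by omega), if_neg (by omega)]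
  by_cases h3 : m = n
  · subst h3
    simp
  · simp [h3]

theorem inducedHom_mem (hχ : IsPodlesChar q a χ z) (x : Podles q a) :
    ∀ y ∈ restrictedDual q a, inducedHom q a χ x y ∈ restrictedDual q a := by
  induction x using Podles.induction_on with
  | hE i j =>
    intro y hy
    lift y to restrictedDual q a using hy
    induction y using (wprojBasis q a).induction_on with
    | h0 => simp
    | hadd v w hv hw => rw [Submodule.coe_add, map_add]; exact add_mem hv hw
    | hsmul c v hv => rw [Submodule.coe_smul, map_smul]; exact Submodule.smul_mem _ _ hv
    | hb n =>
      rw [wprojBasis_apply, inducedHom_wproj hχ]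
      exact add_mem (add_mem (Submodule.smul_mem _ _ (wproj_mem q a _))
        (Submodule.smul_mem _ _ (wproj_mem q a _))) (Submodule.smul_mem _ _ (wproj_mem q a _))
  | hs c =>
    intro y hy
    rw [AlgHom.commutes]
    exact Submodule.smul_mem _ c hy
  | ha x x' h h' => intro y hy; rw [map_add]; exact add_mem (h y hy) (h' y hy)
  | hm x x' h h' => intro y hy; rw [map_mul]; exact h _ (h' y hy)

/-- The action of the induced representation on the restricted dual. -/
def restrictedInducedHom (hχ : IsPodlesChar q a χ z) :
    Podles q a →ₐ[ℂ] Module.End ℂ (restrictedDual q a) :=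
  AlgHom.ofLinearMap
    { toFun := fun b => (inducedHom q a χ b).restrict (inducedHom_mem hχ b)
      map_add' := fun x y => by ext w; simp
      map_smul' := fun c x => by ext w; simp }
    (by ext w; simp) (fun x y => by ext w; simp)

theorem coe_restrictedInducedHom (hχ : IsPodlesChar q a χ z) (b : Podles q a)
    (y : restrictedDual q a) : (restrictedInducedHom hχ b y : OqSO2 q a →ₗ[ℂ] ℂ) =
      inducedHom q a χ b y := rfl

theorem isWeightAction_induced (hχ : IsPodlesChar q a χ z) :
    IsWeightAction (restrictedInducedHom hχ) (wprojBasis q a)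
      (fun n => indUp q z (qDiff q a) (wt q a n)) (fun n => indDown q z (qDiff q a) (wt q a n))
      (Complex.I * (z - starRingEnd ℂ z)) where
  act_basis i j n := by
    refine Subtype.ext ?_
    rw [coe_restrictedInducedHom, wprojBasis_apply, inducedHom_wproj hχ]
    simp only [Submodule.coe_add, Submodule.coe_smul, wprojBasis_apply]

theorem qSum_pos (x : ℝ) : 0 < qSum q x :=
  add_pos (Real.rpow_pos_of_pos hq.out.1 _) (Real.rpow_pos_of_pos hq.out.1 _)

/-- Each weight ⟨c⟩ of ψ_t cancels one factor of the denominator beside it. What remains on both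
sides is the same numerator up to conjugation, over q⟨a + n + 1⟩. -/
theorem indUp_eq_conj_indDown (z : ℂ) (n : ℤ) :
    (qSum q (a + (n + 2 : ℤ)) : ℂ) * indUp q z (qDiff q a) (wt q a n) =
      starRingEnd ℂ ((qSum q (a + n) : ℂ) * indDown q z (qDiff q a) (wt q a (n + 2))) := by
  have hq0 := cq_ne_zero q
  have h0 := wt_add_inv_ne_zero q a n
  have h1 := wt_add_inv_ne_zero q a (n + 1)
  have h2 := wt_add_inv_ne_zero q a (n + 2)
  have e1 : (q : ℂ)⁻¹ * wt q a (n + 2) = q * wt q a n := by rw [wt_add_two]; field_simp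
  have e2 : ((q : ℂ) ^ 2)⁻¹ * wt q a (n + 2) = wt q a n := by rw [wt_add_two]; field_simp
  rw [qSum_wt, qSum_wt, indUp, indDown, e1, e2, ← wt_add_one, ← wt_add_two]
  simp only [map_mul, map_add, map_div₀, map_inv₀, conj_wt, Complex.conj_ofReal, Complex.conj_I,
    Complex.conj_conj]
  generalize wt q a (n + 2) + (wt q a (n + 2))⁻¹ = r2 at *
  generalize wt q a (n + 1) + (wt q a (n + 1))⁻¹ = r1 at *
  generalize wt q a n + (wt q a n)⁻¹ = r0 at *
  field_simp
  ring

theorem conj_casimirValue (z : ℂ) : starRingEnd ℂ (Complex.I * (z - starRingEnd ℂ z)) =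
    Complex.I * (z - starRingEnd ℂ z) := by
  simp only [map_mul, map_sub, Complex.conj_I, Complex.conj_conj]
  ring

/-- The induced representation of a character with `χ(Z_t) = 0`. -/
def inducedRep (hχ : IsPodlesChar q a χ z) : UnitaryDKRep q a (restrictedDual q a) :=
  (isWeightAction_induced hχ).toUnitaryDKRep (N := fun n => qSum q (a + n)) (fun _ => qSum_pos _)
    (conj_casimirValue z) (indUp_eq_conj_indDown z)

/-- Convolution is pointwise on grouplike elements and g_n† = g_n, so ψ_t(y* w) is the diagonal form
with norms ⟨a + n⟩, and left multiplication by ω scales p_n by ω(g_n). -/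
theorem inducedRep_isInduced (hχ : IsPodlesChar q a χ z) : (inducedRep hχ).IsInduced χ := by
  refine ⟨fun y w => ?_, fun b y => rfl, fun ω _ y => ?_⟩
  · rw [psiT_eq]
    refine ((wprojBasis q a).diagForm_eq_finsum _ y w).trans (finsum_congr fun n => ?_)
    rw [convMul_glike, wprojBasis_repr, wprojBasis_repr]
    congr 2
    change _ = starRingEnd ℂ ((y : OqSO2 q a →ₗ[ℂ] ℂ) (dagC q a (glike q a n)))
    rw [(glike_spec q a n).dag]
  · refine dual_ext q a fun m => ?_
    rw [convMul_glike]
    induction y using (wprojBasis q a).induction_on with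
    | h0 => simp
    | hadd v w hv hw =>
      simp only [map_add, Submodule.coe_add, LinearMap.add_apply, hv, hw, mul_add]
    | hsmul c v hv =>
      simp only [map_smul, Submodule.coe_smul, LinearMap.smul_apply, hv, smul_eq_mul]
      ring
    | hb n =>
      rw [inducedRep, IsWeightAction.actDual_basis, Submodule.coe_smul, wprojBasis_apply,
        LinearMap.smul_apply, wproj_glike, smul_eq_mul]
      split_ifs with h
      · rw [h]
      · simp

end InducedRep

/-! ### Nonvanishing of the raising coefficients, and the conclusion. -/

section PrincipalSeries

variable {q : ℝ} [hq : Fact (q ∈ Set.Ioo (0 : ℝ) 1)] {a : ℝ}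

theorem qDiff_injective : Function.Injective (qDiff q) := fun x y h =>
  (qNum_strictMono q).injective (by
    change qDiff q x / _ = qDiff q y / _
    rw [h])

theorem qDiff_neg (x : ℝ) : qDiff q (-x) = -qDiff q x := by
  simp [qDiff]

theorem exp_eq (θ : ℝ) : Complex.exp (-(Complex.I * θ)) =
    (Real.cos θ : ℂ) - Real.sin θ * Complex.I := by
  rw [show -(Complex.I * θ) = ((-θ : ℝ) : ℂ) * Complex.I by push_cast; ring, Complex.exp_mul_I,
    ← Complex.ofReal_cos, ← Complex.ofReal_sin, Real.cos_neg, Real.sin_neg]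
  push_cast
  ring

theorem conj_exp_eq (θ : ℝ) : starRingEnd ℂ (Complex.exp (-(Complex.I * θ))) =
    (Real.cos θ : ℂ) + Real.sin θ * Complex.I := by
  rw [exp_eq, map_sub, map_mul, Complex.conj_ofReal, Complex.conj_ofReal, Complex.conj_I]
  ring

theorem casimirValue_exp (θ : ℝ) : Complex.I * (Complex.exp (-(Complex.I * θ)) -
    starRingEnd ℂ (Complex.exp (-(Complex.I * θ)))) = ((2 * Real.sin θ : ℝ) : ℂ) := by
  rw [conj_exp_eq, exp_eq]
  push_cast
  linear_combination -2 * Complex.sin θ * Complex.I_mul_I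

/-- The raising coefficient vanishes only at the boundary of the range of parameters. -/
theorem eq_of_indUp_eq_zero {θ : ℝ} {n : ℤ}
    (h : indUp q (Complex.exp (-(Complex.I * θ))) (qDiff q a) (wt q a n) = 0) :
    (Real.sin θ = 1 ∧ n = -1) ∨ (Real.sin θ = -1 ∧ 2 * a = -(n + 1 : ℤ)) := by
  have hq0 := cq_ne_zero q
  have h1 := wt_add_inv_ne_zero q a (n + 1)
  have h2 := wt_add_inv_ne_zero q a (n + 2)
  rw [indUp, ← wt_add_one, ← wt_add_two, div_eq_zero_iff, or_iff_left (mul_ne_zero h1 h2),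
    mul_eq_zero, or_iff_right (inv_ne_zero hq0), conj_exp_eq, exp_eq] at h
  have hY : 0 < q ^ (a + (n + 1 : ℤ)) := Real.rpow_pos_of_pos hq.out.1 _
  have ht : qDiff q (a + (n + 1 : ℤ)) = q ^ (a + (n + 1 : ℤ)) - (q ^ (a + (n + 1 : ℤ)))⁻¹ := by
    rw [qDiff, Real.rpow_neg hq.out.1.le]
  rw [wt] at h
  set Y := q ^ (a + (n + 1 : ℤ)) with hYdef
  -- With Y = q^(a+n+1) the real part of the numerator gives t = sin θ (Y - Y⁻¹), the imaginary part
  -- cos θ (Y + Y⁻¹) = 0. So sin θ = ±1, and injectivity of x ↦ q^x - q^(-x) compares the exponents.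
  have hre := congrArg Complex.re h
  have him := congrArg Complex.im h
  simp [← Complex.ofReal_inv, -Complex.ofReal_cos, -Complex.ofReal_sin] at hre him
  have hc : Real.cos θ = 0 := by
    have : Real.cos θ * (Y + Y⁻¹) = 0 := by linarith
    exact (mul_eq_zero.1 this).resolve_right (by positivity)
  have hs : Real.sin θ = 1 ∨ Real.sin θ = -1 := by
    have := Real.sin_sq_add_cos_sq θ
    rw [hc] at this
    exact sq_eq_one_iff.1 (by linarith)
  rcases hs with hs | hs <;> rw [hs] at hre
  · left
    refine ⟨hs, ?_⟩
    have := qDiff_injective (q := q) (a₁ := a) (a₂ := a + (n + 1 : ℤ)) (by rw [ht]; linarith)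
    have h0 : ((n + 1 : ℤ) : ℝ) = 0 := by linarith
    have := Int.cast_eq_zero.1 h0
    omega
  · right
    refine ⟨hs, ?_⟩
    have := qDiff_injective (q := q) (a₁ := a) (a₂ := -(a + (n + 1 : ℤ)))
      (by rw [qDiff_neg, ht]; linarith)
    linarith

theorem qSum_zero : qSum q 0 = 2 := by
  simp [qSum]
  norm_num

/-- The case sin θ = 1 needs the odd index -1. The case sin θ = -1 makes a a half-integer; then ⌈a⌉
- a = 1/2, the lower end of the range is -⟨0⟩ = -2, and λ = -2 is excluded. -/
theorem indUp_ne_zero_of_even {θ : ℝ} (h : 2 * Real.sin θ ∈ evenRange q a) (k : ℤ) :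
    indUp q (Complex.exp (-(Complex.I * θ))) (qDiff q a) (wt q a (2 * k)) ≠ 0 := by
  intro h0
  rcases eq_of_indUp_eq_zero h0 with ⟨_, hk⟩ | ⟨hs, ha⟩
  · omega
  · have ha' : a = ((-k - 1 : ℤ) : ℝ) + 1 / 2 := by push_cast at ha ⊢; linarith
    have hceil : ⌈a⌉ = -k := by
      rw [Int.ceil_eq_iff, ha']
      push_cast
      constructor <;> linarith
    have hr := h.1
    rw [hs, hceil, ha', show (1 - 2 * (((-k : ℤ) : ℝ) - (((-k - 1 : ℤ) : ℝ) + 1 / 2))) = 0 by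
      push_cast; ring, qSum_zero] at hr
    norm_num at hr

/-- Now λ = 2 is excluded by the upper end of the range. For sin θ = -1 the number a is an integer,
and the lower end is again -2. -/
theorem indUp_ne_zero_of_odd {θ : ℝ} (h : 2 * Real.sin θ ∈ oddRange q a) (k : ℤ) :
    indUp q (Complex.exp (-(Complex.I * θ))) (qDiff q a) (wt q a (2 * k + 1)) ≠ 0 := by
  intro h0
  rcases eq_of_indUp_eq_zero h0 with ⟨hs, _⟩ | ⟨hs, ha⟩
  · have hr := h.2
    rw [hs, qSum_zero] at hr
    norm_num at hr
  · have ha' : a = ((-k - 1 : ℤ) : ℝ) := by push_cast at ha ⊢; linarith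
    have hceil : ⌈a - 1 / 2⌉ = -k - 1 := by
      rw [Int.ceil_eq_iff, ha']
      push_cast
      constructor <;> linarith
    have hr := h.1
    rw [hs, hceil, ha', show (1 - 2 * (((-k - 1 : ℤ) : ℝ) - (((-k - 1 : ℤ) : ℝ) - 1 / 2))) = 0 by
      push_cast; ring, qSum_zero] at hr
    norm_num at hr

end PrincipalSeries

/-- For `z = exp(-iθ)`, the representation induced from the character `χ = χ_z` exists and is
unitarily equivalent to the direct sum of the principal series `L⁺` and `L⁻` at the Casimir value
`2 sin θ`. -/
theorem theorem4p6 (q a : ℝ) [Fact (q ∈ Set.Ioo (0 : ℝ) 1)] (θ : ℝ)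
    (hplus : 2 * Real.sin θ ∈ evenRange q a) (hminus : 2 * Real.sin θ ∈ oddRange q a)
    (χ : Podles q a →⋆ₐ[ℂ] ℂ) (hχ : IsPodlesChar q a χ (Complex.exp (-(Complex.I * θ)))) :
    ∃ R : UnitaryDKRep q a (restrictedDual q a), R.IsInduced χ ∧
      (∃ (V : Type) (_ : AddCommGroup V) (_ : Module ℂ V) (Rplus : UnitaryDKRep q a V),
        Rplus.IsEvenSeries (2 * Real.sin θ)) ∧
      (∃ (W : Type) (_ : AddCommGroup W) (_ : Module ℂ W) (Rminus : UnitaryDKRep q a W),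
        Rminus.IsOddSeries (2 * Real.sin θ)) ∧
      ∀ (V W : Type*) [AddCommGroup V] [Module ℂ V] [AddCommGroup W] [Module ℂ W]
        (Rplus : UnitaryDKRep q a V) (Rminus : UnitaryDKRep q a W),
        Rplus.IsEvenSeries (2 * Real.sin θ) → Rminus.IsOddSeries (2 * Real.sin θ) →
          R.EquivDirectSum Rplus Rminus := by
  have h0 := (isWeightAction_induced hχ).isSeries_parityPart (N := fun n => qSum q (a + n))
    (fun _ => qSum_pos _) (conj_casimirValue _) (indUp_eq_conj_indDown _) 0
    (fun k => by rw [add_zero]; exact indUp_ne_zero_of_even hplus k)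
  have h1 := (isWeightAction_induced hχ).isSeries_parityPart (N := fun n => qSum q (a + n))
    (fun _ => qSum_pos _) (conj_casimirValue _) (indUp_eq_conj_indDown _) 1
    (indUp_ne_zero_of_odd hminus)
  have hlam := casimirValue_exp θ
  -- The even and odd parts of the induced representation witness existence of the two series, once
  -- i(z - conj z) is rewritten as 2 sin θ.
  refine ⟨inducedRep hχ, inducedRep_isInduced hχ,
    ⟨_, _, _, _, (UnitaryDKRep.isEvenSeries_iff _).2
      (hlam.subst (motive := fun l => UnitaryDKRep.IsSeries _ 0 l) h0)⟩,
    ⟨_, _, _, _, (UnitaryDKRep.isOddSeries_iff _).2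
      (hlam.subst (motive := fun l => UnitaryDKRep.IsSeries _ 1 l) h1)⟩, ?_⟩
  intro V W _ _ _ _ Rplus Rminus hp hm
  rw [UnitaryDKRep.isEvenSeries_iff, ← hlam] at hp
  rw [UnitaryDKRep.isOddSeries_iff, ← hlam] at hm
  exact UnitaryDKRep.equivDirectSum_of_parityPart
    ((isWeightAction_induced hχ).casimir_eq _ _ _) h0 h1 hp hm

end
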